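/- Let $d\ge 1$, and for $n\in\mathbb N$ and $0<\tau<1$ let $$\mathcal K_n(Z,Z')=\frac{1}{\pi^d(1-\tau^2)^{d/2}}\sum_{|j|<n}\frac{(\tau/2)^{|j|}}{j_1!\cdots j_d!}\prod_{k=1}^d\sqrt{\omega(Z_k)\omega(Z_k')}\,H_{j_k}\Big(\frac{Z_k}{\sqrt{2\tau}}\Big)\overline{H_{j_k}\Big(\frac{Z_k'}{\sqrt{2\tau}}\Big)},\qquad Z,Z'\in\mathbb C^d,$$ be the correlation kernel of the $d$-dimensional elliptic Ginibre ensemble, where the sum runs over multi-indices $j\in\mathbb Z_{\ge0}^d$ with $|j|=j_1+\dots+j_d<n$, $H_m$ is the (physicists') Hermite polynomial of degree $m$, and $\omega(z)=\exp\big(-\frac{(\operatorname{Re}z)^2}{1+\tau}-\frac{(\operatorname{Im}z)^2}{1-\tau}\big)$. Put $\mathbb K_n(Z,Z')=n^d\,\mathcal K_n(\sqrt n\,Z,\sqrt n\,Z')$. Let $\kappa>0$ be a constant, $\tau=1-\kappa n^{-1/3}$, let $\Omega$ be a fixed element of the unit sphere of $\mathbb R^d$, $X=(1+\tau)\Omega$,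 and let $U,V\in\mathbb C^d$. Write $AB=\sum_{k=1}^d A_kB_k$ for $A,B\in\mathbb C^d$. Then, as $n\to\infty$, $$\frac{1}{n^{4d/3}}\mathbb K_n\Big(X+\frac{U}{n^{2/3}},X+\frac{V}{n^{2/3}}\Big)=C_\Omega^n(U,V)\,\frac{1}{(\kappa\pi)^{d/2}(2\pi)^d}\,e^{-\frac{|\operatorname{Im}U|^2+|\operatorname{Im}V|^2}{2\kappa}}\,e^{\frac16\kappa^3+\frac12\kappa\,\Omega(U+\overline V)}$$ $$\times\int_{\mathbb R^d}e^{-iQ(U-\overline V)}\int_0^\infty e^{2^{-2/3}\kappa s}\operatorname{Ai}\Big(2^{2/3}|Q|^2+2^{-4/3}\big(\kappa^2+2\,\Omega(U+\overline V)\big)+s\Big)\,ds\,d^dQ+\mathcal O(n^{-1/3}),$$ where $\operatorname{Ai}$ is the Airy function, the double integral converges absolutely, and $C_\Omega^n(U,V)=e^{i n^{1/3}\langle\Omega,\operatorname{Im}(U-V)\rangle}$ is a cocycle, i.e. of the form $g(U)/g(V)$ with $g$ nowhere zero. The constant in the $\mathcal O$-term may depend on $d,\kappa,\Omega,U,V$.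 -/

import Mathlib

open Filter Asymptotics MeasureTheory

noncomputable section

namespace EllipticGinibre

/-- Physicists' Hermite polynomials evaluated at a complex number:
`H_j(z) = 2^{j/2} He_j(√2 z)`, where `He_j` is Mathlib's (probabilists') Hermite polynomial. -/
def hermiteH (j : ℕ) (z : ℂ) : ℂ :=
  ((Real.sqrt 2 : ℝ) : ℂ) ^ j *
    Polynomial.aeval (((Real.sqrt 2 : ℝ) : ℂ) * z) (Polynomial.hermite j)

/-- The one-variable weight `ω(z) = exp(-(Re z)²/(1+τ) - (Im z)²/(1-τ))`. -/
def weight (τ : ℝ) (z : ℂ) : ℝ :=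
  Real.exp (-(z.re ^ 2 / (1 + τ)) - z.im ^ 2 / (1 - τ))

/-- The multi-indices `j = (j_1, …, j_d)` with `j_1 + … + j_d < n`. -/
def multiIndices (d n : ℕ) : Finset (Fin d → ℕ) :=
  (Fintype.piFinset fun _ : Fin d => Finset.range n).filter fun j => ∑ k, j k < n

/-- The correlation kernel `𝒦_n` of the `d`-dimensional elliptic Ginibre ensemble. -/
def kernel (d n : ℕ) (τ : ℝ) (Z Z' : EuclideanSpace ℂ (Fin d)) : ℂ :=
  ((1 / (Real.pi ^ d * (1 - τ ^ 2) ^ ((d : ℝ) / 2)) : ℝ) : ℂ) *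
    ∑ j ∈ multiIndices d n,
      (((τ / 2) ^ (∑ k, j k) / ∏ k, ((j k).factorial : ℝ) : ℝ) : ℂ) *
        ∏ k, ((Real.sqrt (weight τ (Z k) * weight τ (Z' k)) : ℝ) : ℂ) *
          hermiteH (j k) (Z k / ((Real.sqrt (2 * τ) : ℝ) : ℂ)) *
          (starRingEnd ℂ) (hermiteH (j k) (Z' k / ((Real.sqrt (2 * τ) : ℝ) : ℂ)))

/-- The rescaled kernel `𝕂_n(Z, Z') = n^d 𝒦_n(√n Z, √n Z')`. -/
def scaledKernel (d n : ℕ) (τ : ℝ) (Z Z' : EuclideanSpace ℂ (Fin d)) : ℂ :=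
  (n : ℂ) ^ d *
    kernel d n τ (((Real.sqrt n : ℝ) : ℂ) • Z) (((Real.sqrt n : ℝ) : ℂ) • Z')

/-- The Airy function on `ℂ`,
`Ai(z) = (1 / 2πi) ∫_Γ exp(-z t + t³/3) dt`, with `Γ` the upward vertical line `t = 1 + i y`. -/
def airyAi (z : ℂ) : ℂ :=
  (1 / (2 * Real.pi) : ℂ) *
    ∫ y : ℝ, Complex.exp (-z * (1 + Complex.I * y) + (1 + Complex.I * y) ^ 3 / 3)

variable {d : ℕ}

/-- A real vector, seen as a complex vector. -/
def ofRealVec (x : EuclideanSpace ℝ (Fin d)) : EuclideanSpace ℂ (Fin d) :=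
  WithLp.toLp 2 fun k => (x k : ℂ)

/-- The entrywise imaginary part of a complex vector. -/
def imVec (U : EuclideanSpace ℂ (Fin d)) : EuclideanSpace ℝ (Fin d) :=
  WithLp.toLp 2 fun k => (U k).im

/-- The entrywise complex conjugate of a complex vector. -/
def conjVec (U : EuclideanSpace ℂ (Fin d)) : EuclideanSpace ℂ (Fin d) :=
  WithLp.toLp 2 fun k => (starRingEnd ℂ) (U k)

/-- The bilinear (not sesquilinear) product `U V = ∑ U_k V_k` on `ℂ^d`. -/
def dot (U V : EuclideanSpace ℂ (Fin d)) : ℂ := ∑ k, U k * V k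

/-- Multiplying a kernel by `g(U) / g(V)`, with `g` nowhere zero, does not change
the determinants that define the correlation functions; such a factor is a cocycle. -/
def IsCocycle (C : EuclideanSpace ℂ (Fin d) → EuclideanSpace ℂ (Fin d) → ℂ) : Prop :=
  ∃ g : EuclideanSpace ℂ (Fin d) → ℂ, (∀ U, g U ≠ 0) ∧ ∀ U V, C U V = g U / g V

/-- `C_Ω^n(U, V) = exp(i n^{1/3} ⟨Ω, Im (U - V)⟩)`. -/
def edgeCocycle (n : ℕ) (Ω : EuclideanSpace ℝ (Fin d)) (U V : EuclideanSpace ℂ (Fin d)) : ℂ :=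
  Complex.exp (Complex.I * (((n : ℝ) ^ (1 / 3 : ℝ) * inner ℝ Ω (imVec (U - V)) : ℝ) : ℂ))

/-- The `s`-integrand
`exp(2^{-2/3} κ s) Ai(2^{2/3} |Q|² + 2^{-4/3} (κ² + 2 Ω(U + V̄)) + s)`. -/
def airyFactor (κ : ℝ) (Ω : EuclideanSpace ℝ (Fin d)) (U V : EuclideanSpace ℂ (Fin d))
    (Q : EuclideanSpace ℝ (Fin d)) (s : ℝ) : ℂ :=
  Complex.exp (((2 : ℝ) ^ (-(2 / 3) : ℝ) * κ * s : ℝ) : ℂ) *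
    airyAi ((((2 : ℝ) ^ (2 / 3 : ℝ) * ‖Q‖ ^ 2 : ℝ) : ℂ) +
      (((2 : ℝ) ^ (-(4 / 3) : ℝ) : ℝ) : ℂ) *
        ((κ : ℂ) ^ 2 + 2 * dot (ofRealVec Ω) (U + conjVec V)) + (s : ℂ))

/-- The plane wave `exp(-i Q(U - V̄))`. -/
def planeWave (U V : EuclideanSpace ℂ (Fin d)) (Q : EuclideanSpace ℝ (Fin d)) : ℂ :=
  Complex.exp (-Complex.I * dot (ofRealVec Q) (U - conjVec V))

/-- The deformed `d`-dimensional Airy kernel, without its cocycle. -/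
def deformedAiryKernel (κ : ℝ) (Ω : EuclideanSpace ℝ (Fin d))
    (U V : EuclideanSpace ℂ (Fin d)) : ℂ :=
  ((1 / ((κ * Real.pi) ^ ((d : ℝ) / 2) * (2 * Real.pi) ^ d) : ℝ) : ℂ) *
    ((Real.exp (-((‖imVec U‖ ^ 2 + ‖imVec V‖ ^ 2) / (2 * κ))) : ℝ) : ℂ) *
    Complex.exp ((κ : ℂ) ^ 3 / 6 + (κ : ℂ) / 2 * dot (ofRealVec Ω) (U + conjVec V)) *
    ∫ Q : EuclideanSpace ℝ (Fin d),
      planeWave U V Q * ∫ s in Set.Ioi (0 : ℝ), airyFactor κ Ω U V Q s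

/-- The point `X + U / n^{2/3}`, where `X` is a real vector. -/
def edgePoint (n : ℕ) (X : EuclideanSpace ℝ (Fin d)) (U : EuclideanSpace ℂ (Fin d)) :
    EuclideanSpace ℂ (Fin d) :=
  ofRealVec X + ((((n : ℝ) ^ (2 / 3 : ℝ))⁻¹ : ℝ) : ℂ) • U

/-- The weak non-Hermiticity parameter `τ = 1 - κ n^{-1/3}`. -/
def edgeTau (κ : ℝ) (n : ℕ) : ℝ := 1 - κ * (n : ℝ) ^ (-(1 / 3) : ℝ)

end EllipticGinibre

end

/-! The kernel is a truncated Mehler series. Mehler's formula (`hasSum_mehler`) sums each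
one-dimensional series in `s τ` in closed form; multiplying the product of the `d` series by `1 / (1
- s)` turns the cutoff on the total degree into the extraction of a single coefficient. Cauchy's
formula on a circle `|s| = r < 1` then gives `kernel_eq_integral`, in which the vectors enter only
through scalar products and norms.

With `ε = n^(-1/3)`, take the radius `exp (-ε)` and write `s = exp (ε σ)`, `σ = -1 + i y`, `|y| ≤ π
/ ε`. The parts of the exponent that diverge cancel against the weight and against `s ^ (-N)`,
except for a purely imaginary term, which is the cocycle. This is still an exact identity
(`scaledKernel_eq_integral`), with exponent `edgePhase`. For `ε (1 + |y|) ≤ 1` the exponent differs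
from `limitPhase` by `O(ε (1 + |y|)^4)` (`edgePhase_sub_limitPhase_le`), and on the whole circle its
real part is at most `A - a y²` (`exists_re_edgePhase_le`). Together these bound the difference of
the two integrals by `O(ε)` (`integral_edgePhase_sub_le`).

On the other side, the Airy function is written as an integral over `t = 2^(-2/3) (κ - σ)` with the
same `σ`. The exponent then separates (`planeWave_mul_airyIntegrand`): the `Q`-integral is Gaussian,
the `s`-integral is elementary, and by Fubini what remains is the integral of `exp limitPhase`
(`integral_planeWave_mul_airyFactor`). The integrability behind Fubini also yields the absolute
convergence of the double integral. -/

namespace Polynomial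

/-! ### Hermite polynomials: recurrence, generating function, bounds. -/

theorem derivative_hermite_succ (n : ℕ) :
    derivative (hermite (n + 1)) = ((n : ℤ[X]) + 1) * hermite n := by
  induction n with
  | zero => simp [hermite_zero]
  | succ n ih =>
    rw [hermite_succ (n + 1), ih, derivative_sub, derivative_mul, derivative_X, ih,
      derivative_mul]
    have h : derivative ((n : ℤ[X]) + 1) = 0 := by simp
    rw [h, hermite_succ n]
    push_cast
    ring

theorem hermite_add_two (n : ℕ) :
    hermite (n + 2) = X * hermite (n + 1) - ((n : ℤ[X]) + 1) * hermite n := by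
  rw [hermite_succ (n + 1), derivative_hermite_succ]

theorem aeval_hermite_add_two (n : ℕ) (x : ℂ) :
    aeval x (hermite (n + 2)) =
      x * aeval x (hermite (n + 1)) - ((n : ℂ) + 1) * aeval x (hermite n) := by
  rw [hermite_add_two]; simp

/-- Differentiating once more produces `(x - t) He_n(x - t) - He_n'(x - t)`, which is the defining
recursion of `hermite`. At `t = 0` these are the Taylor coefficients of an entire function. -/
theorem iteratedDeriv_exp_sub_sq (x : ℂ) (n : ℕ) :
    iteratedDeriv n (fun t : ℂ => Complex.exp (x * t - t ^ 2 / 2)) =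
      fun t => aeval (x - t) (hermite n) * Complex.exp (x * t - t ^ 2 / 2) := by
  induction n with
  | zero => ext t; simp
  | succ n ih =>
    rw [iteratedDeriv_succ, ih]
    ext t
    have h1 : HasDerivAt (fun t : ℂ => aeval (x - t) (hermite n))
        (aeval (x - t) (derivative (hermite n)) * (-1)) t :=
      ((hermite n).hasDerivAt_aeval (x - t)).comp t ((hasDerivAt_id t).const_sub x)
    have h2 : HasDerivAt (fun t : ℂ => Complex.exp (x * t - t ^ 2 / 2))
        (Complex.exp (x * t - t ^ 2 / 2) * (x - t)) t := by
      refine HasDerivAt.cexp ?_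
      have := ((hasDerivAt_id t).const_mul x).sub ((hasDerivAt_pow 2 t).div_const 2)
      convert! this using 1
      simp
    refine (h1.mul h2).deriv.trans ?_
    rw [hermite_succ]
    simp only [map_sub, map_mul, aeval_X]
    ring

/-- The exponential generating function of the Hermite polynomials. -/
theorem hasSum_hermite (x t : ℂ) :
    HasSum (fun n : ℕ => t ^ n / n.factorial * aeval x (hermite n))
      (Complex.exp (x * t - t ^ 2 / 2)) := by
  have h := Complex.hasSum_taylorSeries_of_entire
    (f := fun t : ℂ => Complex.exp (x * t - t ^ 2 / 2)) (by fun_prop) 0 t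
  convert! h using 1
  ext n
  rw [iteratedDeriv_exp_sub_sq]
  simp [div_eq_inv_mul, mul_assoc]

/-- Majorants of the Hermite polynomials on the disc of radius `a`. -/
noncomputable def hermiteMajorant (a : ℝ) : ℕ → ℝ
  | 0 => 1
  | 1 => a
  | n + 2 => a * hermiteMajorant a (n + 1) + (n + 1) * hermiteMajorant a n

/-- The majorant satisfies the three-term recurrence with its minus sign made positive, so the
triangle inequality propagates the bound. At `x = i a` the sign change is absorbed by `i ^ n`, so
the majorant inherits an explicit generating function from `hasSum_hermite`. -/
theorem hermiteMajorant_spec {a : ℝ} (ha : 0 ≤ a) (n : ℕ) :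
    0 ≤ hermiteMajorant a n ∧
      aeval (Complex.I * a) (hermite n) = Complex.I ^ n * (hermiteMajorant a n : ℂ) ∧
      ∀ x : ℂ, ‖x‖ ≤ a → ‖aeval x (hermite n)‖ ≤ hermiteMajorant a n := by
  induction n using Nat.twoStepInduction with
  | zero => simp [hermiteMajorant]
  | one => simpa [hermiteMajorant] using ha
  | more n h0 h1 =>
    have hn : (0 : ℝ) ≤ (n : ℝ) + 1 := by positivity
    refine ⟨?_, ?_, fun x hx => ?_⟩
    · rw [hermiteMajorant]
      exact add_nonneg (mul_nonneg ha h1.1) (mul_nonneg hn h0.1)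
    · rw [aeval_hermite_add_two, h0.2.1, h1.2.1, hermiteMajorant]
      push_cast
      linear_combination -((n : ℂ) + 1) * Complex.I ^ n * (hermiteMajorant a n : ℂ) * Complex.I_sq
    · rw [aeval_hermite_add_two, hermiteMajorant]
      refine (norm_sub_le _ _).trans ?_
      rw [norm_mul, norm_mul]
      have : ‖(n : ℂ) + 1‖ = n + 1 := by
        rw [← Nat.cast_succ, Complex.norm_natCast]; push_cast; ring
      rw [this]
      gcongr
      · exact h1.2.2 x hx
      · exact h0.2.2 x hx

theorem hasSum_hermiteMajorant {a : ℝ} (ha : 0 ≤ a) (t : ℝ) :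
    HasSum (fun n : ℕ => t ^ n / n.factorial * hermiteMajorant a n)
      (Real.exp (a * t + t ^ 2 / 2)) := by
  have h := hasSum_hermite (Complex.I * a) (-Complex.I * t)
  rw [← Complex.hasSum_ofReal]
  convert! h using 1
  · ext n
    rw [(hermiteMajorant_spec ha n).2.1]
    push_cast
    rw [mul_pow]
    have : (-Complex.I) ^ n * Complex.I ^ n = 1 := by
      rw [← mul_pow]; simp
    linear_combination (-(t : ℂ) ^ n / n.factorial * (hermiteMajorant a n : ℂ)) * this
  · push_cast
    congr 1
    linear_combination ((a * t : ℂ) + (t : ℂ) ^ 2 / 2) * Complex.I_sq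

theorem sum_norm_hermite_le (x : ℂ) {t : ℝ} (ht : 0 ≤ t) (s : Finset ℕ) :
    ∑ n ∈ s, t ^ n / n.factorial * ‖aeval x (hermite n)‖ ≤
      Real.exp (‖x‖ * t + t ^ 2 / 2) := by
  have h := hasSum_hermiteMajorant (norm_nonneg x) t
  calc _ ≤ ∑ n ∈ s, t ^ n / n.factorial * hermiteMajorant ‖x‖ n := by
        refine Finset.sum_le_sum fun n _ => ?_
        gcongr
        exact (hermiteMajorant_spec (norm_nonneg x) n).2.2 x le_rfl
    _ ≤ _ := sum_le_hasSum s (fun n _ => mul_nonneg (by positivity)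
        (hermiteMajorant_spec (norm_nonneg x) n).1) h

end Polynomial

namespace EllipticGinibre
open Polynomial

/-! ### Hermite polynomials as Gaussian averages. -/

theorem integrable_of_norm_le_exp_neg_sq {E : Type*} [NormedAddCommGroup E] {f : ℝ → E}
    (hf : AEStronglyMeasurable f) {A b c : ℝ} (hb : 0 < b)
    (h : ∀ t, ‖f t‖ ≤ Real.exp (A + c * |t| - b * t ^ 2)) : Integrable f := by
  refine Integrable.mono' (g := fun t => Real.exp (A + c ^ 2 / (2 * b)) *
    Real.exp (-(b / 2) * t ^ 2)) ((integrable_exp_neg_mul_sq (half_pos hb)).const_mul _) hf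
    (Eventually.of_forall fun t => (h t).trans ?_)
  rw [← Real.exp_add]
  gcongr
  have h1 : c ^ 2 / (2 * b) + (-(b / 2) * t ^ 2) - (c * |t| - b * t ^ 2) =
      (c - b * |t|) ^ 2 / (2 * b) := by
    rw [← sq_abs t]; field_simp; ring
  have : 0 ≤ (c - b * |t|) ^ 2 / (2 * b) := by positivity
  linarith

theorem pow_le_factorial_mul_exp {a : ℝ} (ha : 0 ≤ a) (n : ℕ) :
    a ^ n ≤ n.factorial * Real.exp a := by
  have := Real.pow_div_factorial_le_exp a ha n
  rwa [div_le_iff₀ (by positivity), mul_comm] at this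

theorem norm_add_I_mul_le (x : ℂ) (t : ℝ) : ‖x + Complex.I * t‖ ≤ ‖x‖ + |t| := by
  refine (norm_add_le _ _).trans ?_
  simp

theorem integrable_pow_mul_gaussian (x : ℂ) (n : ℕ) :
    Integrable fun t : ℝ => (x + Complex.I * t) ^ n * Complex.exp (-(t : ℂ) ^ 2 / 2) := by
  -- Dividing by `n!` lets the power be bounded by an exponential of its base, so it costs only a
  -- linear term in the Gaussian exponent.
  refine (integrable_of_norm_le_exp_neg_sq (A := ‖x‖) (b := 1 / 2) (c := 1)
    (f := fun t : ℝ => ((n.factorial : ℂ))⁻¹ *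
      ((x + Complex.I * t) ^ n * Complex.exp (-(t : ℂ) ^ 2 / 2)))
    (Continuous.aestronglyMeasurable (by fun_prop)) (by norm_num) fun t => ?_).const_mul
      (n.factorial : ℂ) |>.congr (Eventually.of_forall fun t => ?_)
  · rw [norm_mul, norm_mul, norm_pow, norm_inv, Complex.norm_natCast,
      inv_mul_le_iff₀ (by positivity), Complex.norm_exp]
    have h1 : (-(t : ℂ) ^ 2 / 2).re = -t ^ 2 / 2 := by
      norm_cast
    rw [h1]
    calc _ ≤ (n.factorial * Real.exp ‖x + Complex.I * t‖) * Real.exp (-t ^ 2 / 2) := by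
          gcongr; exact pow_le_factorial_mul_exp (norm_nonneg _) n
      _ = n.factorial * Real.exp (‖x + Complex.I * t‖ + -t ^ 2 / 2) := by
          rw [mul_assoc, Real.exp_add]
      _ ≤ _ := by
          gcongr
          linarith [norm_add_I_mul_le x t]
  · have : (n.factorial : ℂ) ≠ 0 := by exact_mod_cast n.factorial_ne_zero
    simp only
    field_simp

/-- Integration by parts: the derivative of `-i (x + i t)^(n+1) exp(-t²/2)` has integral zero, and
writing `i t = (x + i t) - x` in it gives the Hermite recurrence. -/
theorem integral_pow_mul_gaussian_add_two (x : ℂ) (n : ℕ) :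
    ∫ t : ℝ, (x + Complex.I * t) ^ (n + 2) * Complex.exp (-(t : ℂ) ^ 2 / 2) =
      x * (∫ t : ℝ, (x + Complex.I * t) ^ (n + 1) * Complex.exp (-(t : ℂ) ^ 2 / 2)) -
        ((n : ℂ) + 1) * ∫ t : ℝ, (x + Complex.I * t) ^ n * Complex.exp (-(t : ℂ) ^ 2 / 2) := by
  have key : ∫ t : ℝ, ((x + Complex.I * t) ^ (n + 2) * Complex.exp (-(t : ℂ) ^ 2 / 2) -
      x * ((x + Complex.I * t) ^ (n + 1) * Complex.exp (-(t : ℂ) ^ 2 / 2)) +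
      ((n : ℂ) + 1) * ((x + Complex.I * t) ^ n * Complex.exp (-(t : ℂ) ^ 2 / 2))) = 0 := by
    refine integral_eq_zero_of_hasDerivAt_of_integrable
      (f := fun t : ℝ => -Complex.I * ((x + Complex.I * t) ^ (n + 1) *
        Complex.exp (-(t : ℂ) ^ 2 / 2))) (fun t => ?_)
      (((integrable_pow_mul_gaussian x _).sub ((integrable_pow_mul_gaussian x _).const_mul x)).add
        ((integrable_pow_mul_gaussian x _).const_mul _))
      ((integrable_pow_mul_gaussian x _).const_mul _)
    have h0 : HasDerivAt (fun t : ℝ => (t : ℂ)) 1 t := Complex.ofRealCLM.hasDerivAt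
    have h1 : HasDerivAt (fun t : ℝ => (x + Complex.I * (t : ℂ)) ^ (n + 1))
        (((n : ℂ) + 1) * (x + Complex.I * t) ^ n * Complex.I) t := by
      convert! ((h0.const_mul Complex.I).const_add x).pow (n + 1) using 1
      simp
    have h2 : HasDerivAt (fun t : ℝ => Complex.exp (-(t : ℂ) ^ 2 / 2))
        (Complex.exp (-(t : ℂ) ^ 2 / 2) * (-t)) t := by
      refine HasDerivAt.cexp ?_
      convert! ((h0.pow 2).neg).div_const 2 using 1
      simp; ring
    convert! (h1.mul h2).const_mul (-Complex.I) using 1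
    linear_combination (Complex.exp (-(t : ℂ) ^ 2 / 2) * ((n : ℂ) + 1) *
      (x + Complex.I * t) ^ n) * Complex.I_sq
  rw [integral_add, integral_sub, integral_const_mul, integral_const_mul] at key
  · linear_combination key
  all_goals first
    | exact integrable_pow_mul_gaussian x _
    | exact (integrable_pow_mul_gaussian x _).const_mul _
    | exact (integrable_pow_mul_gaussian x _).sub ((integrable_pow_mul_gaussian x _).const_mul x)

theorem integral_gaussian_half : ∫ t : ℝ, Complex.exp (-(t : ℂ) ^ 2 / 2) =
    ((Real.sqrt (2 * Real.pi) : ℝ) : ℂ) := by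
  have h := integral_gaussian (1 / 2)
  have h2 : ∀ t : ℝ, Complex.exp (-(t : ℂ) ^ 2 / 2) = ((Real.exp (-(1 / 2) * t ^ 2) : ℝ) : ℂ) := by
    intro t; push_cast; congr 1; ring
  simp_rw [h2]
  rw [integral_complex_ofReal, h]
  congr 2
  ring

/-- Hermite polynomials are the Gaussian averages of `(x + i t) ^ n`. -/
theorem integral_pow_mul_gaussian (x : ℂ) (n : ℕ) :
    ∫ t : ℝ, (x + Complex.I * t) ^ n * Complex.exp (-(t : ℂ) ^ 2 / 2) =
      ((Real.sqrt (2 * Real.pi) : ℝ) : ℂ) * aeval x (hermite n) := by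
  induction n using Nat.twoStepInduction with
  | zero => simp [integral_gaussian_half]
  | one =>
    have h0 : ∫ t : ℝ, (t : ℂ) * Complex.exp (-(t : ℂ) ^ 2 / 2) = 0 := by
      have := integral_neg_eq_self (fun t : ℝ => (t : ℂ) * Complex.exp (-(t : ℂ) ^ 2 / 2)) volume
      simp only [Complex.ofReal_neg, neg_mul, integral_neg, neg_sq] at this
      linear_combination (-1 / 2) * this
    have h1 := (integrable_pow_mul_gaussian x 0).const_mul x
    have h2 : Integrable fun t : ℝ => Complex.I * ((t : ℂ) * Complex.exp (-(t : ℂ) ^ 2 / 2)) := by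
      convert! (integrable_pow_mul_gaussian 0 1) using 1
      ext t; simp; ring
    have h3 : ∀ t : ℝ, (x + Complex.I * t) ^ 1 * Complex.exp (-(t : ℂ) ^ 2 / 2) =
      x * ((x + Complex.I * t) ^ 0 * Complex.exp (-(t : ℂ) ^ 2 / 2)) +
        Complex.I * ((t : ℂ) * Complex.exp (-(t : ℂ) ^ 2 / 2)) := fun t => by ring
    simp_rw [h3]
    rw [integral_add h1 h2, integral_const_mul, integral_const_mul, h0]
    simp [integral_gaussian_half, mul_comm]
  | more n h0 h1 =>
    rw [integral_pow_mul_gaussian_add_two, h0, h1, aeval_hermite_add_two]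
    ring

/-- The coefficients of the Mehler series. -/
noncomputable def mehlerCoeff (x y : ℂ) (j : ℕ) : ℂ :=
  aeval x (hermite j) * aeval y (hermite j) / j.factorial

/-- The terms whose Gaussian average is the Mehler series. -/
noncomputable def mehlerTerm (x y w : ℂ) (j : ℕ) (t : ℝ) : ℂ :=
  (w ^ j / j.factorial * aeval y (hermite j)) *
    ((x + Complex.I * t) ^ j * Complex.exp (-(t : ℂ) ^ 2 / 2))

theorem integral_mehlerTerm (x y w : ℂ) (j : ℕ) :
    ∫ t : ℝ, mehlerTerm x y w j t =
      ((Real.sqrt (2 * Real.pi) : ℝ) : ℂ) * (mehlerCoeff x y j * w ^ j) := by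
  unfold mehlerTerm mehlerCoeff
  rw [integral_const_mul, integral_pow_mul_gaussian]
  ring

theorem integrable_mehlerTerm (x y w : ℂ) (j : ℕ) : Integrable (mehlerTerm x y w j) :=
  (integrable_pow_mul_gaussian x j).const_mul _

theorem norm_exp_neg_half_sq (t : ℝ) :
    ‖Complex.exp (-(t : ℂ) ^ 2 / 2)‖ = Real.exp (-t ^ 2 / 2) := by
  rw [Complex.norm_exp]
  congr 1
  norm_cast

/-- A bound independent of the finite set. Its exponent has leading part `(‖w‖² - 1) t² / 2`, so for
`‖w‖ < 1` it is integrable and justifies exchanging sum and integral. -/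
theorem sum_norm_mehlerTerm_le (x y w : ℂ) (s : Finset ℕ) (t : ℝ) :
    ∑ j ∈ s, ‖mehlerTerm x y w j t‖ ≤
      Real.exp (‖y‖ * (‖w‖ * (‖x‖ + |t|)) + (‖w‖ * (‖x‖ + |t|)) ^ 2 / 2 - t ^ 2 / 2) := by
  have h1 : ∀ j, ‖mehlerTerm x y w j t‖ =
      ((‖w‖ * ‖x + Complex.I * t‖) ^ j / j.factorial * ‖aeval y (hermite j)‖) *
        Real.exp (-t ^ 2 / 2) := by
    intro j
    rw [mehlerTerm, norm_mul, norm_mul, norm_mul, norm_exp_neg_half_sq, norm_div, norm_pow,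
      norm_pow, Complex.norm_natCast, mul_pow]
    ring
  simp_rw [h1]
  rw [← Finset.sum_mul]
  calc _ ≤ Real.exp (‖y‖ * (‖w‖ * ‖x + Complex.I * t‖) + (‖w‖ * ‖x + Complex.I * t‖) ^ 2 / 2) *
        Real.exp (-t ^ 2 / 2) := by
        gcongr
        exact sum_norm_hermite_le y (by positivity) s
    _ ≤ Real.exp (‖y‖ * (‖w‖ * (‖x‖ + |t|)) + (‖w‖ * (‖x‖ + |t|)) ^ 2 / 2) *
        Real.exp (-t ^ 2 / 2) := by
        gcongr <;> exact norm_add_I_mul_le x t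
    _ = _ := by rw [← Real.exp_add]; congr 1; ring

theorem integrable_mehlerBound (x y w : ℂ) (hw : ‖w‖ < 1) :
    Integrable fun t : ℝ =>
      Real.exp (‖y‖ * (‖w‖ * (‖x‖ + |t|)) + (‖w‖ * (‖x‖ + |t|)) ^ 2 / 2 - t ^ 2 / 2) := by
  have h2 : ‖w‖ ^ 2 < 1 := by nlinarith [norm_nonneg w]
  refine integrable_of_norm_le_exp_neg_sq (A := ‖y‖ * ‖w‖ * ‖x‖ + ‖w‖ ^ 2 * ‖x‖ ^ 2 / 2)
    (c := ‖y‖ * ‖w‖ + ‖w‖ ^ 2 * ‖x‖) (b := (1 - ‖w‖ ^ 2) / 2)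
    (Continuous.aestronglyMeasurable (by fun_prop)) (by linarith) fun t => ?_
  rw [Real.norm_of_nonneg (Real.exp_pos _).le]
  apply le_of_eq
  congr 1
  rw [← sq_abs t]
  ring

theorem summable_integral_norm_mehlerTerm (x y w : ℂ) (hw : ‖w‖ < 1) :
    Summable fun j => ∫ t : ℝ, ‖mehlerTerm x y w j t‖ := by
  refine summable_of_sum_le (fun j => integral_nonneg fun t => norm_nonneg _) (c := ∫ t : ℝ,
    Real.exp (‖y‖ * (‖w‖ * (‖x‖ + |t|)) + (‖w‖ * (‖x‖ + |t|)) ^ 2 / 2 - t ^ 2 / 2)) fun s => ?_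
  rw [← integral_finsetSum _ fun j _ => (integrable_mehlerTerm x y w j).norm]
  exact integral_mono (integrable_finsetSum _ fun j _ => (integrable_mehlerTerm x y w j).norm)
    (integrable_mehlerBound x y w hw) (sum_norm_mehlerTerm_le x y w s)

theorem summable_norm_mehlerCoeff (x y w : ℂ) (hw : ‖w‖ < 1) :
    Summable fun j => ‖mehlerCoeff x y j * w ^ j‖ := by
  have hpos : 0 < Real.sqrt (2 * Real.pi) := Real.sqrt_pos.2 (by positivity)
  refine Summable.of_nonneg_of_le (fun j => norm_nonneg _) (fun j => ?_)
    ((summable_integral_norm_mehlerTerm x y w hw).mul_left (Real.sqrt (2 * Real.pi))⁻¹)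
  rw [le_inv_mul_iff₀ hpos]
  refine le_trans (le_of_eq ?_) (norm_integral_le_integral_norm (mehlerTerm x y w j))
  rw [integral_mehlerTerm]
  simp only [norm_mul, Complex.norm_real, Real.norm_of_nonneg hpos.le]

/-- Once one Hermite factor is replaced by the power `(x + i t)^j`, the bilinear series becomes the
ordinary generating function at `w (x + i t)`, so Mehler's formula reduces to one Gaussian integral
in `t`. -/
theorem tsum_mehlerTerm (x y w : ℂ) (t : ℝ) :
    ∑' j, mehlerTerm x y w j t =
      Complex.exp ((w ^ 2 - 1) / 2 * (t : ℂ) ^ 2 + Complex.I * (y * w - w ^ 2 * x) * t +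
        (y * w * x - w ^ 2 * x ^ 2 / 2)) := by
  have h := (hasSum_hermite y (w * (x + Complex.I * t))).mul_right
    (Complex.exp (-(t : ℂ) ^ 2 / 2))
  have h2 : ∀ j, mehlerTerm x y w j t = (w * (x + Complex.I * t)) ^ j / j.factorial *
      aeval y (hermite j) * Complex.exp (-(t : ℂ) ^ 2 / 2) := fun j => by
    rw [mehlerTerm, mul_pow]; ring
  simp_rw [h2]
  rw [h.tsum_eq, ← Complex.exp_add]
  congr 1
  linear_combination (-(w ^ 2 * t ^ 2) / 2) * Complex.I_sq

theorem re_one_sub_sq_pos {w : ℂ} (hw : ‖w‖ < 1) : 0 < (1 - w ^ 2).re := by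
  have h : (w ^ 2).re ≤ ‖w‖ ^ 2 := by
    rw [← norm_pow]; exact Complex.re_le_norm _
  have h2 : ‖w‖ ^ 2 < 1 := by nlinarith [norm_nonneg w]
  simp only [Complex.sub_re, Complex.one_re]
  linarith

/-- Branch bookkeeping: in the right half-plane the principal logarithm satisfies `log z⁻¹ = -log
z`, so complex powers can be carried as exponentials of logarithms. -/
theorem ofReal_mul_inv_cpow {r : ℝ} (hr : 0 < r) {z : ℂ} (hz : 0 < z.re) (x : ℝ) :
    ((r : ℂ) * z⁻¹) ^ (x : ℂ) = ((r ^ x : ℝ) : ℂ) * Complex.exp (-x * Complex.log z) := by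
  have hne : z ≠ 0 := fun h => by rw [h] at hz; simp at hz
  have harg : z.arg ≠ Real.pi := by
    rw [Ne, Complex.arg_eq_pi_iff]; exact fun h => by linarith [h.1]
  have hrc : (r : ℂ) ≠ 0 := by exact_mod_cast hr.ne'
  rw [Complex.cpow_def_of_ne_zero (mul_ne_zero hrc (inv_ne_zero hne)),
    Complex.log_ofReal_mul hr (inv_ne_zero hne), Complex.log_inv _ harg, add_mul, Complex.exp_add]
  congr 1
  · rw [Complex.ofReal_cpow hr.le, Complex.cpow_def_of_ne_zero hrc, ← Complex.ofReal_log hr.le]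
  · congr 1; ring

/-- Mehler's formula. -/
theorem hasSum_mehler (x y w : ℂ) (hw : ‖w‖ < 1) :
    HasSum (fun j => mehlerCoeff x y j * w ^ j)
      (Complex.exp (-(1 / 2) * Complex.log (1 - w ^ 2) +
        (2 * (w * x * y) - w ^ 2 * (x ^ 2 + y ^ 2)) / (2 * (1 - w ^ 2)))) := by
  have hre := re_one_sub_sq_pos hw
  have hne : 1 - w ^ 2 ≠ 0 := fun h => by rw [h] at hre; simp at hre
  have hne' : w ^ 2 - 1 ≠ 0 := fun h => hne (by linear_combination -h)
  have hpos : 0 < Real.sqrt (2 * Real.pi) := Real.sqrt_pos.2 (by positivity)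
  have h := hasSum_integral_of_summable_integral_norm (integrable_mehlerTerm x y w)
    (summable_integral_norm_mehlerTerm x y w hw)
  simp_rw [integral_mehlerTerm, tsum_mehlerTerm] at h
  have hb : ((w ^ 2 - 1) / 2).re < 0 := by
    have : (w ^ 2 - 1) / 2 = ((-(1 / 2) : ℝ) : ℂ) * (1 - w ^ 2) := by push_cast; ring
    rw [this, Complex.re_ofReal_mul]
    linarith
  rw [integral_cexp_quadratic hb] at h
  have h2 := h.mul_left (((Real.sqrt (2 * Real.pi) : ℝ) : ℂ))⁻¹
  have hs : (((Real.sqrt (2 * Real.pi) : ℝ) : ℂ)) ≠ 0 := by exact_mod_cast hpos.ne'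
  convert! h2 using 1
  · ext j; field_simp
  · have e1 : ((Real.pi : ℂ) / -((w ^ 2 - 1) / 2)) = ((2 * Real.pi : ℝ) : ℂ) * (1 - w ^ 2)⁻¹ := by
      push_cast; field_simp; ring
    have e2 : (Complex.I * (y * w - w ^ 2 * x)) ^ 2 / (4 * ((w ^ 2 - 1) / 2)) =
        (y * w - w ^ 2 * x) ^ 2 / (2 * (1 - w ^ 2)) := by
      rw [mul_pow, Complex.I_sq, div_eq_div_iff (by simpa using hne') (by simpa using hne)]
      ring
    have e3 := ofReal_mul_inv_cpow (r := 2 * Real.pi) (by positivity) hre (1 / 2)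
    rw [← Real.sqrt_eq_rpow] at e3
    push_cast at e3 hs ⊢
    rw [e1, e2]
    push_cast
    rw [e3, mul_assoc (((Real.sqrt (2 * Real.pi) : ℝ) : ℂ)), inv_mul_cancel_left₀ hs,
      ← Complex.exp_add]
    congr 2
    field_simp
    ring

/-! ### Coefficient extraction from absolutely convergent power series. -/

/-- The power series `p` converges absolutely at `s` to `v`. -/
def HasEval (p : PowerSeries ℂ) (s v : ℂ) : Prop :=
  Summable (fun m => ‖PowerSeries.coeff m p * s ^ m‖) ∧
    HasSum (fun m => PowerSeries.coeff m p * s ^ m) v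

theorem coeff_mul_mul_pow (p q : PowerSeries ℂ) (s : ℂ) (m : ℕ) :
    PowerSeries.coeff m (p * q) * s ^ m = ∑ kl ∈ Finset.HasAntidiagonal.antidiagonal m,
      (PowerSeries.coeff kl.1 p * s ^ kl.1) * (PowerSeries.coeff kl.2 q * s ^ kl.2) := by
  rw [PowerSeries.coeff_mul, Finset.sum_mul]
  refine Finset.sum_congr rfl fun kl hkl => ?_
  rw [← Finset.HasAntidiagonal.mem_antidiagonal.1 hkl, pow_add]
  ring

theorem HasEval.mul {p q : PowerSeries ℂ} {s v w : ℂ} (hp : HasEval p s v)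
    (hq : HasEval q s w) : HasEval (p * q) s (v * w) := by
  have h1 := summable_norm_sum_mul_antidiagonal_of_summable_norm hp.1 hq.1
  have h2 := tsum_mul_tsum_eq_tsum_sum_antidiagonal_of_summable_norm hp.1 hq.1
  refine ⟨?_, ?_⟩
  · simpa only [coeff_mul_mul_pow] using h1
  · simp_rw [coeff_mul_mul_pow]
    rw [hp.2.tsum_eq, hq.2.tsum_eq] at h2
    rw [h2]
    exact h1.of_norm.hasSum

theorem HasEval.one (s : ℂ) : HasEval 1 s 1 := by
  have h : ∀ m, m ≠ 0 → PowerSeries.coeff m (1 : PowerSeries ℂ) * s ^ m = 0 := by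
    intro m hm; simp [PowerSeries.coeff_one, hm]
  refine ⟨summable_of_ne_finset_zero (s := {0}) fun m hm => ?_, ?_⟩
  · rw [h m (by simpa using hm), norm_zero]
  · simpa using hasSum_single 0 h

theorem HasEval.prod {ι : Type*} (t : Finset ι) {p : ι → PowerSeries ℂ} {s : ℂ} {v : ι → ℂ}
    (h : ∀ k ∈ t, HasEval (p k) s (v k)) : HasEval (∏ k ∈ t, p k) s (∏ k ∈ t, v k) := by
  classical
  induction t using Finset.induction_on with
  | empty => simpa using HasEval.one s
  | insert a t ha ih =>
    rw [Finset.prod_insert ha, Finset.prod_insert ha]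
    exact (h a (Finset.mem_insert_self _ _)).mul
      (ih fun k hk => h k (Finset.mem_insert_of_mem hk))

/-- This factor replaces coefficients by partial sums, and so encodes the truncation of the
multi-index sum. -/
theorem HasEval.geometric {s : ℂ} (hs : ‖s‖ < 1) :
    HasEval (PowerSeries.mk fun _ => 1) s (1 - s)⁻¹ := by
  refine ⟨?_, ?_⟩
  · simpa using summable_geometric_of_lt_one (norm_nonneg s) hs
  · simpa using hasSum_geometric_of_norm_lt_one hs

theorem integral_exp_int_mul_I (k : ℤ) :
    ∫ θ in -Real.pi..Real.pi, Complex.exp (Complex.I * (k * θ)) =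
      if k = 0 then 2 * (Real.pi : ℂ) else 0 := by
  split_ifs with hk
  · subst hk
    simp
    ring
  · have hk' : (Complex.I * k : ℂ) ≠ 0 := by simp [hk]
    simp_rw [← mul_assoc]
    rw [integral_exp_mul_complex hk']
    have : Complex.exp (Complex.I * k * (Real.pi : ℝ)) =
        Complex.exp (Complex.I * k * ((-Real.pi : ℝ) : ℂ)) := by
      rw [Complex.exp_eq_exp_iff_exists_int]
      exact ⟨k, by push_cast; ring⟩
    rw [this, sub_self, zero_div]

/-- Cauchy's formula for the coefficients of an absolutely convergent power series. -/
theorem integral_hasEval (p : PowerSeries ℂ) {r : ℝ} (hr : 0 < r) (f : ℂ → ℂ)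
    (h : ∀ s : ℂ, ‖s‖ = r → HasEval p s (f s)) (N : ℕ) :
    ∫ θ in -Real.pi..Real.pi, f (r * Complex.exp (Complex.I * θ)) *
        ((r * Complex.exp (Complex.I * θ)) ^ N)⁻¹ =
      2 * (Real.pi : ℂ) * PowerSeries.coeff N p := by
  have hrc : (r : ℂ) ≠ 0 := by exact_mod_cast hr.ne'
  have hnorm : ∀ θ : ℝ, ‖(r : ℂ) * Complex.exp (Complex.I * θ)‖ = r := fun θ => by
    rw [norm_mul, mul_comm Complex.I, Complex.norm_exp_ofReal_mul_I, Complex.norm_real,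
      Real.norm_of_nonneg hr.le, mul_one]
  let F : ℕ → ℝ → ℂ := fun m θ => PowerSeries.coeff m p * (r : ℂ) ^ m * ((r : ℂ) ^ N)⁻¹ *
    Complex.exp (Complex.I * (((m : ℤ) - N : ℤ) * θ))
  have hF : ∀ m θ, F m θ = PowerSeries.coeff m p * (r * Complex.exp (Complex.I * θ)) ^ m *
      ((r * Complex.exp (Complex.I * θ)) ^ N)⁻¹ := by
    intro m θ
    simp only [F]
    rw [mul_pow, mul_pow, mul_inv, ← Complex.exp_nat_mul, ← Complex.exp_nat_mul, ← Complex.exp_neg]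
    have : Complex.exp (Complex.I * (((m : ℤ) - N : ℤ) * θ)) =
        Complex.exp (m * (Complex.I * θ)) * Complex.exp (-(N * (Complex.I * θ))) := by
      rw [← Complex.exp_add]; congr 1; push_cast; ring
    rw [this]; ring
  have hFn : ∀ m θ, ‖F m θ‖ = ‖PowerSeries.coeff m p * (r : ℂ) ^ m‖ * (r ^ N)⁻¹ := by
    intro m θ
    rw [hF, norm_mul, norm_mul, norm_inv, norm_pow, norm_pow, hnorm, norm_mul, norm_pow,
      Complex.norm_real, Real.norm_of_nonneg hr.le]
  have hsum : Summable fun m => ‖PowerSeries.coeff m p * (r : ℂ) ^ m‖ * (r ^ N)⁻¹ :=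
    (h r (by rw [Complex.norm_real, Real.norm_of_nonneg hr.le])).1.mul_right _
  have key := intervalIntegral.hasSum_integral_of_dominated_convergence (μ := volume)
    (a := -Real.pi) (b := Real.pi) (F := F)
    (f := fun θ : ℝ => f (r * Complex.exp (Complex.I * θ)) *
        ((r * Complex.exp (Complex.I * θ)) ^ N)⁻¹)
    (fun m _ => ‖PowerSeries.coeff m p * (r : ℂ) ^ m‖ * (r ^ N)⁻¹)
    (fun m => Continuous.aestronglyMeasurable (by fun_prop))
    (fun m => Eventually.of_forall fun θ _ => (hFn m θ).le)
    (Eventually.of_forall fun θ _ => hsum)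
    (by simp)
    (Eventually.of_forall fun θ _ => by
      simp_rw [hF]
      exact ((h _ (hnorm θ)).2).mul_right _)
  refine key.unique ?_
  have hI : ∀ m, ∫ θ in -Real.pi..Real.pi, F m θ =
      if m = N then 2 * (Real.pi : ℂ) * PowerSeries.coeff N p else 0 := by
    intro m
    simp only [F]
    rw [intervalIntegral.integral_const_mul, integral_exp_int_mul_I]
    by_cases hm : m = N
    · subst hm
      have : (r : ℂ) ^ m ≠ 0 := pow_ne_zero _ hrc
      simp
      field_simp
    · have : ((m : ℤ) - N) ≠ 0 := by omega
      simp [hm, this]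
  simp_rw [hI]
  exact hasSum_ite_eq N _

/-- The geometric factor sums the coefficients of degrees `0, …, N` of the product. The cutoff is
thus `|j| < N + 1`, so `n = N + 1` throughout. -/
theorem coeff_prod_mul_geometric {d : ℕ} (c : Fin d → ℕ → ℂ) (N : ℕ) :
    PowerSeries.coeff N ((∏ k, PowerSeries.mk (c k)) * PowerSeries.mk fun _ => 1) =
      ∑ j ∈ multiIndices d (N + 1), ∏ k, c k (j k) := by
  rw [PowerSeries.coeff_mul, Finset.Nat.sum_antidiagonal_eq_sum_range_succ_mk]
  simp only [PowerSeries.coeff_mk, mul_one, PowerSeries.coeff_prod]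
  -- Sorting the multi-indices by total degree matches them with the finitely supported functions
  -- that index the coefficients of a product.
  rw [← Finset.sum_fiberwise_of_maps_to (s := multiIndices d (N + 1))
    (t := Finset.range (N + 1)) (g := fun j => ∑ k, j k)]
  · refine Finset.sum_congr rfl fun i hi => ?_
    refine Finset.sum_nbij' (fun l => (l : Fin d → ℕ)) (fun j => Finsupp.equivFunOnFinite.symm j)
      ?_ ?_ ?_ ?_ ?_
    · intro l hl
      rw [Finset.mem_finsuppAntidiag] at hl
      simp only [multiIndices, Finset.mem_filter, Fintype.mem_piFinset, Finset.mem_range] at hi ⊢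
      have hle : ∀ k, l k ≤ ∑ k, l k := fun k =>
        Finset.single_le_sum (f := fun k => l k) (fun _ _ => Nat.zero_le _) (Finset.mem_univ k)
      refine ⟨⟨fun k => ?_, ?_⟩, hl.1⟩
      · exact (hle k).trans_lt (by rw [hl.1]; exact hi)
      · rw [hl.1]; exact hi
    · intro j hj
      simp only [Finset.mem_filter] at hj
      rw [Finset.mem_finsuppAntidiag]
      exact ⟨by simpa using hj.2, Finset.subset_univ _⟩
    · intro l _; ext; simp
    · intro j _; ext; simp
    · intro l _; rfl
  · intro j hj
    simp only [multiIndices, Finset.mem_filter, Finset.mem_range] at hj ⊢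
    exact hj.2

/-- The exponent in Mehler's formula. -/
noncomputable def mehlerExponent (x y w : ℂ) : ℂ :=
  -(1 / 2) * Complex.log (1 - w ^ 2) +
    (2 * (w * x * y) - w ^ 2 * (x ^ 2 + y ^ 2)) / (2 * (1 - w ^ 2))

theorem sum_multiIndices_eq_integral {d : ℕ} (x y : Fin d → ℂ) {τ r : ℝ} (hτ : |τ| < 1)
    (hr : 0 < r) (hr1 : r < 1) (N : ℕ) :
    2 * (Real.pi : ℂ) * ∑ j ∈ multiIndices d (N + 1),
        ∏ k, (mehlerCoeff (x k) (y k) (j k) * (τ : ℂ) ^ j k) =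
      ∫ θ in -Real.pi..Real.pi,
        Complex.exp (∑ k, mehlerExponent (x k) (y k) (r * Complex.exp (Complex.I * θ) * τ)) *
        (1 - r * Complex.exp (Complex.I * θ))⁻¹ * ((r * Complex.exp (Complex.I * θ)) ^ N)⁻¹ := by
  rw [← coeff_prod_mul_geometric fun k j => mehlerCoeff (x k) (y k) j * (τ : ℂ) ^ j]
  refine (integral_hasEval _ hr (fun s => Complex.exp (∑ k, mehlerExponent (x k) (y k) (s * τ)) *
    (1 - s)⁻¹) (fun s hs => ?_) N).symm
  rw [Complex.exp_sum]
  have hw : ‖s * τ‖ < 1 := by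
    rw [norm_mul, hs, Complex.norm_real, Real.norm_eq_abs]
    nlinarith [abs_nonneg τ]
  refine HasEval.mul (HasEval.prod _ fun k _ => ?_) (HasEval.geometric (by rwa [hs]))
  have e : ∀ m, PowerSeries.coeff m (PowerSeries.mk fun j => mehlerCoeff (x k) (y k) j *
      (τ : ℂ) ^ j) * s ^ m = mehlerCoeff (x k) (y k) m * (s * τ) ^ m := by
    intro m
    rw [PowerSeries.coeff_mk, mul_pow]; ring
  refine ⟨?_, ?_⟩
  · simp_rw [e]; exact summable_norm_mehlerCoeff _ _ _ hw
  · simp_rw [e]; exact hasSum_mehler _ _ _ hw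

/-! ### The kernel as a contour integral. -/

theorem sqrt_two_mul_div {τ : ℝ} (z : ℂ) :
    ((Real.sqrt 2 : ℝ) : ℂ) * (z / ((Real.sqrt (2 * τ) : ℝ) : ℂ)) =
      z / ((Real.sqrt τ : ℝ) : ℂ) := by
  have h2 : ((Real.sqrt 2 : ℝ) : ℂ) ≠ 0 := by
    exact_mod_cast (Real.sqrt_pos.2 (by norm_num : (0 : ℝ) < 2)).ne'
  rw [Real.sqrt_mul (by norm_num), Complex.ofReal_mul, ← mul_div_assoc, mul_div_mul_left _ _ h2]

theorem conj_aeval_hermite (j : ℕ) (z : ℂ) :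
    (starRingEnd ℂ) (aeval z (hermite j)) = aeval ((starRingEnd ℂ) z) (hermite j) := by
  rw [aeval_def, aeval_def, hom_eval₂]
  congr 1
  exact RingHom.ext_int _ _

/-- The two factors `√2 ^ j` of the physicists' normalisation cancel the `2 ^ j` in `(τ / 2) ^ j`,
and their arguments `√2 z / √(2τ)` become `z / √τ`. -/
theorem mehlerCoeff_mul_pow {τ : ℝ} (z z' : ℂ) (j : ℕ) :
    (((τ / 2) ^ j / (j.factorial : ℝ) : ℝ) : ℂ) *
        (hermiteH j (z / ((Real.sqrt (2 * τ) : ℝ) : ℂ)) *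
          (starRingEnd ℂ) (hermiteH j (z' / ((Real.sqrt (2 * τ) : ℝ) : ℂ)))) =
      mehlerCoeff (z / ((Real.sqrt τ : ℝ) : ℂ))
        ((starRingEnd ℂ) z' / ((Real.sqrt τ : ℝ) : ℂ)) j * (τ : ℂ) ^ j := by
  have h2 : ((Real.sqrt 2 : ℝ) : ℂ) ^ j * ((Real.sqrt 2 : ℝ) : ℂ) ^ j = 2 ^ j := by
    rw [← mul_pow, ← Complex.ofReal_mul, Real.mul_self_sqrt (by norm_num)]; norm_num
  simp only [hermiteH, mehlerCoeff, map_mul, map_pow, Complex.conj_ofReal, conj_aeval_hermite,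
    sqrt_two_mul_div, map_div₀]
  push_cast
  rw [div_pow]
  have h3 : (2 : ℂ) ^ j ≠ 0 := pow_ne_zero _ two_ne_zero
  field_simp
  linear_combination ((τ : ℂ) ^ j * (j.factorial : ℂ)⁻¹ *
    (aeval (z / ((Real.sqrt τ : ℝ) : ℂ)) (hermite j)) *
    (aeval ((starRingEnd ℂ) z' / ((Real.sqrt τ : ℝ) : ℂ)) (hermite j))) * h2

theorem sqrt_weight_mul_weight (τ : ℝ) (z z' : ℂ) :
    Real.sqrt (weight τ z * weight τ z') =
      Real.exp (-((z.re ^ 2 + z'.re ^ 2) / (2 * (1 + τ))) -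
        (z.im ^ 2 + z'.im ^ 2) / (2 * (1 - τ))) := by
  rw [weight, weight, ← Real.exp_add, ← Real.exp_half]
  congr 1
  simp only [div_eq_mul_inv, mul_inv]
  ring

variable {d : ℕ}

theorem norm_imVec_sq (U : EuclideanSpace ℂ (Fin d)) : ‖imVec U‖ ^ 2 = ∑ k, (U k).im ^ 2 := by
  simp [EuclideanSpace.norm_sq_eq, imVec]

/-- The sum of the squared real parts of the entries. -/
noncomputable def reSq (U : EuclideanSpace ℂ (Fin d)) : ℝ := ∑ k, (U k).re ^ 2

theorem prod_sqrt_weight (τ : ℝ) (Z Z' : EuclideanSpace ℂ (Fin d)) :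
    ∏ k, ((Real.sqrt (weight τ (Z k) * weight τ (Z' k)) : ℝ) : ℂ) =
      Complex.exp ((-((reSq Z + reSq Z') / (2 * (1 + τ))) -
        (‖imVec Z‖ ^ 2 + ‖imVec Z'‖ ^ 2) / (2 * (1 - τ)) : ℝ) : ℂ) := by
  simp_rw [sqrt_weight_mul_weight]
  rw [← Complex.ofReal_prod, ← Real.exp_sum, Complex.ofReal_exp]
  congr 2
  rw [norm_imVec_sq, norm_imVec_sq, reSq, reSq, Finset.sum_sub_distrib, Finset.sum_neg_distrib,
    ← Finset.sum_div, ← Finset.sum_div, Finset.sum_add_distrib, Finset.sum_add_distrib]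

/-- All coordinates share the same `s τ`, so the sum depends on the vectors only through `Z W` and
`Z Z + W W`; the dimension survives as the multiplicity of the logarithm. -/
theorem sum_mehlerExponent {τ : ℝ} (hτ : 0 < τ) (Z W : EuclideanSpace ℂ (Fin d)) (s : ℂ) :
    ∑ k, mehlerExponent (Z k / ((Real.sqrt τ : ℝ) : ℂ)) (W k / ((Real.sqrt τ : ℝ) : ℂ)) (s * τ) =
      -((d : ℂ) / 2) * Complex.log (1 - (s * τ) ^ 2) +
        (2 * s * dot Z W - s ^ 2 * τ * (dot Z Z + dot W W)) / (2 * (1 - (s * τ) ^ 2)) := by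
  have hq : ((Real.sqrt τ : ℝ) : ℂ) * ((Real.sqrt τ : ℝ) : ℂ) = τ := by
    rw [← Complex.ofReal_mul, Real.mul_self_sqrt hτ.le]
  have hq0 : ((Real.sqrt τ : ℝ) : ℂ) ≠ 0 := by exact_mod_cast (Real.sqrt_pos.2 hτ).ne'
  have h1 : ∀ k, 2 * (s * τ * (Z k / ((Real.sqrt τ : ℝ) : ℂ)) * (W k / ((Real.sqrt τ : ℝ) : ℂ))) -
      (s * τ) ^ 2 * ((Z k / ((Real.sqrt τ : ℝ) : ℂ)) ^ 2 + (W k / ((Real.sqrt τ : ℝ) : ℂ)) ^ 2) =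
      2 * s * (Z k * W k) - s ^ 2 * τ * (Z k * Z k + W k * W k) := by
    intro k
    rw [← hq]
    field_simp
  unfold mehlerExponent
  simp_rw [h1]
  rw [Finset.sum_add_distrib, Finset.sum_const, Finset.card_univ, Fintype.card_fin, nsmul_eq_mul,
    ← Finset.sum_div, Finset.sum_sub_distrib, ← Finset.mul_sum, ← Finset.mul_sum,
    Finset.sum_add_distrib]
  simp only [dot]
  ring

/-- The integrand of the contour integral for the correlation kernel. -/
noncomputable def contourIntegrand (d : ℕ) (τ : ℝ) (N : ℕ) (P Q s : ℂ) : ℂ :=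
  Complex.exp (-((d : ℂ) / 2) * Complex.log (1 - (s * τ) ^ 2) +
    (2 * s * P - s ^ 2 * τ * Q) / (2 * (1 - (s * τ) ^ 2))) * (1 - s)⁻¹ * (s ^ N)⁻¹

theorem kernel_eq_integral {τ r : ℝ} (hτ : 0 < τ) (hτ1 : τ < 1) (hr : 0 < r) (hr1 : r < 1)
    (N : ℕ) (Z Z' : EuclideanSpace ℂ (Fin d)) :
    kernel d (N + 1) τ Z Z' =
      ((1 / (Real.pi ^ d * (1 - τ ^ 2) ^ ((d : ℝ) / 2)) : ℝ) : ℂ) *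
      Complex.exp ((-((reSq Z + reSq Z') / (2 * (1 + τ))) -
        (‖imVec Z‖ ^ 2 + ‖imVec Z'‖ ^ 2) / (2 * (1 - τ)) : ℝ) : ℂ) *
      ((2 * (Real.pi : ℂ))⁻¹ * ∫ θ in -Real.pi..Real.pi,
        contourIntegrand d τ N (dot Z (conjVec Z')) (dot Z Z + dot (conjVec Z') (conjVec Z'))
          (r * Complex.exp (Complex.I * θ))) := by
  have hpi : 2 * (Real.pi : ℂ) ≠ 0 := by simp [Real.pi_ne_zero]
  have h := sum_multiIndices_eq_integral (fun k => Z k / ((Real.sqrt τ : ℝ) : ℂ))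
    (fun k => conjVec Z' k / ((Real.sqrt τ : ℝ) : ℂ)) (abs_lt.2 ⟨by linarith, hτ1⟩) hr hr1 N
  simp_rw [sum_mehlerExponent hτ] at h
  simp only [contourIntegrand]
  rw [← h, inv_mul_cancel_left₀ hpi, ← prod_sqrt_weight, mul_assoc, kernel]
  congr 1
  rw [Finset.mul_sum]
  refine Finset.sum_congr rfl fun j _ => ?_
  have h1 : ∀ k, mehlerCoeff (Z k / ((Real.sqrt τ : ℝ) : ℂ))
      (conjVec Z' k / ((Real.sqrt τ : ℝ) : ℂ)) (j k) * (τ : ℂ) ^ j k =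
      (((τ / 2) ^ j k / ((j k).factorial : ℝ) : ℝ) : ℂ) *
        (hermiteH (j k) (Z k / ((Real.sqrt (2 * τ) : ℝ) : ℂ)) *
          (starRingEnd ℂ) (hermiteH (j k) (Z' k / ((Real.sqrt (2 * τ) : ℝ) : ℂ)))) :=
    fun k => (mehlerCoeff_mul_pow _ _ _).symm
  simp_rw [h1]
  rw [← Finset.prod_pow_eq_pow_sum, ← Finset.prod_div_distrib, Complex.ofReal_prod,
    ← Finset.prod_mul_distrib, ← Finset.prod_mul_distrib]
  exact Finset.prod_congr rfl fun k _ => by ring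

/-! ### Scalar products at the edge points. -/

theorem dot_smul_add (a e : ℂ) (x u v : EuclideanSpace ℂ (Fin d)) :
    dot (a • (x + e • u)) (a • (x + e • v)) =
      a ^ 2 * (dot x x + e * (dot x u + dot x v) + e ^ 2 * dot u v) := by
  simp only [dot, PiLp.smul_apply, PiLp.add_apply, smul_eq_mul, Finset.mul_sum,
    ← Finset.sum_add_distrib]
  exact Finset.sum_congr rfl fun k _ => by ring

theorem conjVec_smul_add (a e : ℝ) (X : EuclideanSpace ℝ (Fin d))
    (V : EuclideanSpace ℂ (Fin d)) :
    conjVec ((a : ℂ) • (ofRealVec X + (e : ℂ) • V)) =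
      (a : ℂ) • (ofRealVec X + (e : ℂ) • conjVec V) := by
  ext k
  simp [conjVec, ofRealVec]

theorem reSq_smul_add (a e : ℝ) (X : EuclideanSpace ℝ (Fin d))
    (U : EuclideanSpace ℂ (Fin d)) :
    reSq ((a : ℂ) • (ofRealVec X + (e : ℂ) • U)) =
      a ^ 2 * (‖X‖ ^ 2 + 2 * e * ∑ k, X k * (U k).re + e ^ 2 * reSq U) := by
  simp only [reSq, EuclideanSpace.norm_sq_eq, ofRealVec, PiLp.smul_apply, PiLp.add_apply,
    smul_eq_mul, Finset.mul_sum, ← Finset.sum_add_distrib]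
  exact Finset.sum_congr rfl fun k _ => by simp; ring

theorem norm_imVec_smul_add (a e : ℝ) (X : EuclideanSpace ℝ (Fin d))
    (U : EuclideanSpace ℂ (Fin d)) :
    ‖imVec ((a : ℂ) • (ofRealVec X + (e : ℂ) • U))‖ ^ 2 = a ^ 2 * e ^ 2 * ‖imVec U‖ ^ 2 := by
  simp only [norm_imVec_sq, ofRealVec, PiLp.smul_apply, PiLp.add_apply, smul_eq_mul,
    Finset.mul_sum]
  exact Finset.sum_congr rfl fun k _ => by simp; ring

/-- Polarisation prepares the partial fractions of the exponent: with `v` a conjugate, the square of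
`u - v` will see only the pole of `1 / (1 - s τ)` and stay in the limit, while that of `u + v` will
see only `1 / (1 + s τ)` and vanish. -/
theorem dot_conj_eq (u v : EuclideanSpace ℂ (Fin d)) :
    dot u v = dot (u + v) (u + v) / 4 - dot (u - v) (u - v) / 4 := by
  simp only [dot, PiLp.add_apply, PiLp.sub_apply, Finset.sum_div, ← Finset.sum_sub_distrib]
  exact Finset.sum_congr rfl fun k _ => by ring

theorem dot_self_add_dot_self (u v : EuclideanSpace ℂ (Fin d)) :
    dot u u + dot v v = 2 * (dot (u + v) (u + v) / 4 + dot (u - v) (u - v) / 4) := by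
  simp only [dot, PiLp.add_apply, PiLp.sub_apply, Finset.sum_div, ← Finset.sum_add_distrib,
    Finset.mul_sum]
  exact Finset.sum_congr rfl fun k _ => by ring

theorem dot_add_right (x u v : EuclideanSpace ℂ (Fin d)) :
    dot x (u + v) = dot x u + dot x v := by
  simp [dot, mul_add, Finset.sum_add_distrib]

theorem dot_ofRealVec_add_conjVec (Ω : EuclideanSpace ℝ (Fin d))
    (U V : EuclideanSpace ℂ (Fin d)) :
    dot (ofRealVec Ω) (U + conjVec V) =
      ((∑ k, Ω k * (U k).re + ∑ k, Ω k * (V k).re : ℝ) : ℂ) +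
        Complex.I * ((inner ℝ Ω (imVec (U - V)) : ℝ) : ℂ) := by
  simp only [dot, ofRealVec, conjVec, imVec, PiLp.inner_apply, PiLp.add_apply, PiLp.sub_apply,
    ← Finset.sum_add_distrib, Complex.ofReal_sum, Finset.mul_sum]
  refine Finset.sum_congr rfl fun k _ => ?_
  apply Complex.ext <;> simp <;> ring

theorem dot_ofRealVec_self (X : EuclideanSpace ℝ (Fin d)) :
    dot (ofRealVec X) (ofRealVec X) = ((‖X‖ ^ 2 : ℝ) : ℂ) := by
  rw [EuclideanSpace.norm_sq_eq]
  simp [dot, ofRealVec, sq]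

theorem dot_ofRealVec_smul (t : ℝ) (X : EuclideanSpace ℝ (Fin d))
    (U : EuclideanSpace ℂ (Fin d)) :
    dot (ofRealVec (t • X)) U = (t : ℂ) * dot (ofRealVec X) U := by
  simp [dot, ofRealVec, Finset.mul_sum, mul_assoc]

/-! ### The exact rescaled integrand. -/

/-- The exponent of the contour integral for the rescaled kernel, in the variable `σ` with
`s = exp (ε σ)`. -/
noncomputable def edgePhase (d : ℕ) (κ q : ℝ) (ζ γ b : ℂ) (ε : ℝ) (σ : ℂ) : ℂ :=
  ((2 - κ * ε) * (Complex.exp (ε * σ) - 1) / (1 + Complex.exp (ε * σ) * (1 - κ * ε)) - ε * σ) /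
      ε ^ 3 +
    ζ * (Complex.exp (ε * σ) - 1) / (1 + Complex.exp (ε * σ) * (1 - κ * ε)) / ε +
    ε * γ * Complex.exp (ε * σ) / (1 + Complex.exp (ε * σ) * (1 - κ * ε)) -
    ε * b * Complex.exp (ε * σ) / (1 - Complex.exp (ε * σ) * (1 - κ * ε)) -
    ε * q / (2 * (2 - κ * ε)) + ε * σ -
    (d : ℂ) / 2 * Complex.log ((1 - (Complex.exp (ε * σ) * (1 - κ * ε)) ^ 2) / ε) -
    Complex.log ((1 - Complex.exp (ε * σ)) / ε)

/-- Partial fractions for `1 - (s τ)² = (1 - s τ)(1 + s τ)`: every term except `b` contains the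
factor `1 - s τ`, and the `b`-term contains `1 + s τ`. The weight then removes `(2 - κ ε) / ε³` and
leaves `(ζ - p) / ε`. -/
theorem exponent_identity {ε κ s ζ γ b p q m : ℂ} (hε : ε ≠ 0) (hκ : κ ≠ 0)
    (h2 : 2 - κ * ε ≠ 0) (hp : 1 + s * (1 - κ * ε) ≠ 0) (hm : 1 - s * (1 - κ * ε) ≠ 0) :
    -((1 / ε ^ 3 * (2 * (2 - κ * ε) ^ 2 + 2 * (2 - κ * ε) * ε ^ 2 * p + ε ^ 4 * q)) /
        (2 * (2 - κ * ε))) - 1 / ε ^ 3 * ε ^ 4 * m / (2 * (κ * ε)) +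
      (2 * s * (1 / ε ^ 3 * ((2 - κ * ε) ^ 2 + ε ^ 2 * ((2 - κ * ε) * ζ) + ε ^ 4 * (γ - b))) -
        s ^ 2 * (1 - κ * ε) * (1 / ε ^ 3 * (2 * (2 - κ * ε) ^ 2 + 2 * ε ^ 2 * ((2 - κ * ε) * ζ) +
          ε ^ 4 * (2 * (γ + b))))) / (2 * (1 - (s * (1 - κ * ε)) ^ 2)) =
      (ζ - p) / ε - m / (2 * κ) + (2 - κ * ε) * (s - 1) / (1 + s * (1 - κ * ε)) / ε ^ 3 +
        ζ * (s - 1) / (1 + s * (1 - κ * ε)) / ε + ε * γ * s / (1 + s * (1 - κ * ε)) -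
        ε * b * s / (1 - s * (1 - κ * ε)) - ε * q / (2 * (2 - κ * ε)) := by
  have h3 : 1 - (s * (1 - κ * ε)) ^ 2 = (1 - s * (1 - κ * ε)) * (1 + s * (1 - κ * ε)) := by ring
  rw [h3]
  generalize hA : 1 + s * (1 - κ * ε) = A at *
  generalize hB : 1 - s * (1 - κ * ε) = B at *
  generalize hC : 2 - κ * ε = C at *
  have e1 : (2 * s * (1 / ε ^ 3 * (C ^ 2 + ε ^ 2 * (C * ζ) + ε ^ 4 * (γ - b))) -
        s ^ 2 * (1 - κ * ε) * (1 / ε ^ 3 * (2 * C ^ 2 + 2 * ε ^ 2 * (C * ζ) +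
          ε ^ 4 * (2 * (γ + b))))) / (2 * (B * A)) =
      s * (C ^ 2 + ε ^ 2 * (C * ζ) + ε ^ 4 * γ) / (ε ^ 3 * A) - ε * b * s / B := by
    rw [div_sub_div _ _ (mul_ne_zero (pow_ne_zero _ hε) hp) hm,
      div_eq_div_iff (by simp [hp, hm]) (by simp [hp, hm, hε])]
    subst hA hB
    field_simp
    ring
  rw [e1]
  -- This splits off the value at `s = 1`, which carries the divergent constants; what remains is
  -- proportional to `s - 1`.
  have e2 : s * C = A + (s - 1) := by subst hA hC; ring
  have e3 : s * (C ^ 2 + ε ^ 2 * (C * ζ) + ε ^ 4 * γ) / (ε ^ 3 * A) =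
      C / ε ^ 3 + ζ / ε + C * (s - 1) / A / ε ^ 3 + ζ * (s - 1) / A / ε + ε * γ * s / A := by
    field_simp
    linear_combination (C + ε ^ 2 * ζ) * e2
  rw [e3]
  field_simp
  ring

/-- Every factor is put into one exponential. Dividing the arguments of both logarithms by `ε` makes
them converge, at the price of the powers of `ε` in front. -/
theorem edge_integrand_eq {ε κ : ℝ} (hε : 0 < ε) (hκ : 0 < κ) (hκε : κ * ε < 1) (N : ℕ)
    (hN : ((N + 1 : ℕ) : ℝ) = 1 / ε ^ 3) (q m p : ℝ) (ζ γ b : ℂ) {σ : ℂ} (hσ : σ.re < 0) :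
    Complex.exp (((-((1 / ε ^ 3 * (2 * (2 - κ * ε) ^ 2 + 2 * (2 - κ * ε) * ε ^ 2 * p +
        ε ^ 4 * q)) / (2 * (2 - κ * ε))) - 1 / ε ^ 3 * ε ^ 4 * m / (2 * (κ * ε)) : ℝ) : ℂ)) *
      contourIntegrand d (1 - κ * ε) N
        (1 / ε ^ 3 * ((2 - κ * ε) ^ 2 + ε ^ 2 * ((2 - κ * ε) * ζ) + ε ^ 4 * (γ - b)))
        (1 / ε ^ 3 * (2 * (2 - κ * ε) ^ 2 + 2 * ε ^ 2 * ((2 - κ * ε) * ζ) +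
          ε ^ 4 * (2 * (γ + b)))) (Complex.exp (ε * σ)) =
      Complex.exp ((ζ - p) / ε) * Complex.exp (-(m / (2 * κ))) * ((ε ^ (-(d / 2 : ℝ)) : ℝ) : ℂ) *
        (ε : ℂ)⁻¹ * Complex.exp (edgePhase d κ q ζ γ b ε σ) := by
  set s := Complex.exp (ε * σ) with hs
  have hsn : ‖s‖ < 1 := by
    rw [hs, Complex.norm_exp, Real.exp_lt_one_iff, Complex.re_ofReal_mul]
    exact mul_neg_of_pos_of_neg hε hσ
  have hτ0 : 0 < 1 - κ * ε := by linarith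
  have hτ1 : 1 - κ * ε < 1 := by nlinarith
  have hwn : ‖s * (1 - κ * ε)‖ < 1 := by
    have : (1 - κ * ε : ℂ) = ((1 - κ * ε : ℝ) : ℂ) := by push_cast; ring
    rw [norm_mul, this, Complex.norm_real, Real.norm_of_nonneg hτ0.le]
    nlinarith [norm_nonneg s]
  have hεc : (ε : ℂ) ≠ 0 := by exact_mod_cast hε.ne'
  have hκc : (κ : ℂ) ≠ 0 := by exact_mod_cast hκ.ne'
  have h1s : 1 - s ≠ 0 := fun h => by
    rw [← sub_eq_zero.1 h] at hsn; simp at hsn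
  have hm : 1 - s * (1 - κ * ε) ≠ 0 := fun h => by
    rw [← sub_eq_zero.1 h] at hwn; simp at hwn
  have hp : 1 + s * (1 - κ * ε) ≠ 0 := fun h => by
    rw [← neg_eq_of_add_eq_zero_right h] at hwn; simp at hwn
  have h2 : (2 - κ * ε : ℂ) ≠ 0 := by
    have : (2 - κ * ε : ℝ) ≠ 0 := by linarith
    exact_mod_cast this
  have hw2 : 1 - (s * (1 - κ * ε)) ^ 2 ≠ 0 := by
    have : 1 - (s * (1 - κ * ε)) ^ 2 = (1 - s * (1 - κ * ε)) * (1 + s * (1 - κ * ε)) := by ring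
    rw [this]; exact mul_ne_zero hm hp
  have hlog : ∀ z : ℂ, z ≠ 0 → Complex.log (z / ε) = Complex.log z - Complex.log ε := by
    intro z hz
    have : z / ε = ((ε⁻¹ : ℝ) : ℂ) * z := by push_cast; field_simp
    rw [this, Complex.log_ofReal_mul (inv_pos.2 hε) hz, Real.log_inv, ← Complex.ofReal_log hε.le]
    push_cast; ring
  have hinv : (1 - s)⁻¹ = Complex.exp (-Complex.log (1 - s)) := by
    rw [Complex.exp_neg, Complex.exp_log h1s]
  -- The exponent is `N = ε^(-3) - 1`, not `ε^(-3)`; the offset is the lone term `ε σ` in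
  -- `edgePhase`.
  have hpow : (s ^ N)⁻¹ = Complex.exp (ε * σ - σ / ε ^ 2) := by
    have : (N : ℂ) = 1 / (ε : ℂ) ^ 3 - 1 := by
      have h : ((N + 1 : ℕ) : ℂ) = 1 / (ε : ℂ) ^ 3 := by exact_mod_cast congrArg Complex.ofReal hN
      push_cast at h
      linear_combination h
    rw [hs, ← Complex.exp_nat_mul, ← Complex.exp_neg, this]
    congr 1
    field_simp
    ring
  have hεpow : ((ε ^ (-(d / 2 : ℝ)) : ℝ) : ℂ) = Complex.exp (-((d : ℂ) / 2) * Complex.log ε) := by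
    rw [Complex.ofReal_cpow hε.le, Complex.cpow_def_of_ne_zero hεc]
    push_cast
    ring_nf
  have hεinv : (ε : ℂ)⁻¹ = Complex.exp (-Complex.log ε) := by
    rw [Complex.exp_neg, Complex.exp_log hεc]
  rw [contourIntegrand, hinv, hpow, hεpow, hεinv]
  simp only [← Complex.exp_add]
  congr 1
  rw [edgePhase, ← hs, hlog _ hw2, hlog _ h1s]
  have key := exponent_identity (ζ := ζ) (γ := γ) (b := b) (p := p) (q := q) (m := m)
    hεc hκc h2 hp hm
  push_cast
  have e : (ε : ℂ) * σ / ε ^ 3 = σ / ε ^ 2 := by field_simp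
  rw [sub_div ((2 - (κ : ℂ) * ε) * (s - 1) / (1 + s * (1 - κ * ε))), e]
  linear_combination key

/-- The normalising constant of the rescaled kernel. -/
noncomputable def edgeConst (d : ℕ) (κ ε : ℝ) : ℝ :=
  1 / (Real.pi ^ d * (κ * (2 - κ * ε)) ^ ((d : ℝ) / 2))

/-- Power count in `ε`: `4d - 3d - d/2 = d/2`, which is exactly compensated by `1 - τ² = ε κ (2 - κ
ε)` raised to `-d/2`. -/
theorem edgeConst_eq {n : ℕ} {κ ε : ℝ} (hε : 0 < ε) (hκ : 0 < κ) (hκε : κ * ε < 1)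
    (hn : (n : ℝ) = 1 / ε ^ 3) :
    1 / (n : ℝ) ^ (4 * (d : ℝ) / 3) * (n : ℝ) ^ d *
      (1 / (Real.pi ^ d * (1 - (1 - κ * ε) ^ 2) ^ ((d : ℝ) / 2))) * ε ^ (-((d : ℝ) / 2)) =
      edgeConst d κ ε := by
  have hK : 0 < κ * (2 - κ * ε) := mul_pos hκ (by linarith)
  have hnr : (n : ℝ) = ε ^ (-3 : ℝ) := by
    rw [hn, Real.rpow_neg hε.le, one_div]; norm_num
  have h1 : 1 - (1 - κ * ε) ^ 2 = ε * (κ * (2 - κ * ε)) := by ring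
  have h2 : 1 / (n : ℝ) ^ (4 * (d : ℝ) / 3) = ε ^ (4 * (d : ℝ)) := by
    rw [hnr, ← Real.rpow_mul hε.le, one_div, ← Real.rpow_neg hε.le]
    congr 1; ring
  have h3 : (n : ℝ) ^ d = ε ^ (-3 * (d : ℝ)) := by
    rw [hnr, ← Real.rpow_natCast, ← Real.rpow_mul hε.le]
  have h4 : ε ^ (4 * (d : ℝ)) * ε ^ (-3 * (d : ℝ)) * ε ^ (-((d : ℝ) / 2)) = ε ^ ((d : ℝ) / 2) := by
    rw [← Real.rpow_add hε, ← Real.rpow_add hε]; congr 1; ring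
  have h5 : 0 < ε ^ ((d : ℝ) / 2) := Real.rpow_pos_of_pos hε _
  have h6 : 0 < (κ * (2 - κ * ε)) ^ ((d : ℝ) / 2) := Real.rpow_pos_of_pos hK _
  rw [h1, h2, h3, Real.mul_rpow hε.le hK.le, edgeConst]
  have hpi := Real.pi_pos
  rw [mul_comm _ (ε ^ (-((d : ℝ) / 2))), ← mul_assoc,
    mul_comm (ε ^ (-((d : ℝ) / 2))), h4]
  field_simp

/-- The substitution `θ = ε y`; its Jacobian later cancels the `ε⁻¹` coming from `1 / (1 - s)`. -/
theorem integral_circle_eq {ε : ℝ} (hε : 0 < ε) (F : ℂ → ℂ) :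
    ∫ θ in -Real.pi..Real.pi, F (((Real.exp (-ε) : ℝ) : ℂ) * Complex.exp (Complex.I * θ)) =
      ε * ∫ y in -(Real.pi / ε)..Real.pi / ε, F (Complex.exp (ε * (-1 + y * Complex.I))) := by
  have h := intervalIntegral.integral_comp_mul_left (a := -(Real.pi / ε)) (b := Real.pi / ε)
    (fun θ : ℝ => F (((Real.exp (-ε) : ℝ) : ℂ) * Complex.exp (Complex.I * θ))) hε.ne'
  have hεc : (ε : ℂ) ≠ 0 := by exact_mod_cast hε.ne'
  have e : ∀ y : ℝ, ((Real.exp (-ε) : ℝ) : ℂ) * Complex.exp (Complex.I * ((ε * y : ℝ) : ℂ)) =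
      Complex.exp (ε * (-1 + y * Complex.I)) := by
    intro y
    rw [Complex.ofReal_exp, ← Complex.exp_add]
    congr 1
    push_cast
    ring
  simp_rw [e] at h
  rw [h, mul_neg, mul_div_cancel₀ _ hε.ne', Complex.real_smul]
  push_cast
  rw [mul_inv_cancel_left₀ hεc]

/-- No approximation is made yet: the dependence on `n` now sits in the cocycle, in a smooth
constant and in one scalar integral. -/
theorem scaledKernel_eq_integral {κ : ℝ} (hκ : 0 < κ) (Ω : EuclideanSpace ℝ (Fin d))
    (hΩ : ‖Ω‖ = 1) (U V : EuclideanSpace ℂ (Fin d)) {n : ℕ} (hn : n ≠ 0) {ε : ℝ}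
    (hε : ε = (n : ℝ) ^ (-(1 / 3) : ℝ)) (hκε : κ * ε < 1) :
    (((1 / (n : ℝ) ^ (4 * (d : ℝ) / 3) : ℝ)) : ℂ) *
          scaledKernel d n (edgeTau κ n)
            (edgePoint n ((1 + edgeTau κ n) • Ω) U)
            (edgePoint n ((1 + edgeTau κ n) • Ω) V) =
      edgeCocycle n Ω U V *
        ((((Real.exp (-((‖imVec U‖ ^ 2 + ‖imVec V‖ ^ 2) / (2 * κ))) : ℝ) : ℂ) *
          ((edgeConst d κ ε : ℝ) : ℂ)) * ((2 * (Real.pi : ℂ))⁻¹ *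
        ∫ y in -(Real.pi / ε)..Real.pi / ε, Complex.exp (edgePhase d κ (reSq U + reSq V)
          (dot (ofRealVec Ω) (U + conjVec V)) (dot (U + conjVec V) (U + conjVec V) / 4)
          (dot (U - conjVec V) (U - conjVec V) / 4) ε (-1 + y * Complex.I)))) := by
  have hn0 : (0 : ℝ) < n := by exact_mod_cast Nat.pos_of_ne_zero hn
  have hε0 : 0 < ε := hε ▸ Real.rpow_pos_of_pos hn0 _
  have hn3 : (n : ℝ) = 1 / ε ^ 3 := by
    rw [hε, ← Real.rpow_natCast, ← Real.rpow_mul hn0.le]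
    norm_num
    rw [Real.rpow_neg_one, inv_inv]
  have hn23 : ((n : ℝ) ^ (2 / 3 : ℝ))⁻¹ = ε ^ 2 := by
    rw [hε, ← Real.rpow_natCast, ← Real.rpow_mul hn0.le, ← Real.rpow_neg hn0.le]
    norm_num
  have hn13 : (n : ℝ) ^ (1 / 3 : ℝ) = 1 / ε := by
    rw [hε, Real.rpow_neg hn0.le, one_div, one_div, inv_inv]
  have hτ : edgeTau κ n = 1 - κ * ε := by rw [edgeTau, hε]
  have hsq : Real.sqrt n ^ 2 = 1 / ε ^ 3 := by rw [Real.sq_sqrt hn0.le, hn3]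
  obtain ⟨N, rfl⟩ := Nat.exists_eq_succ_of_ne_zero hn
  have hconst := edgeConst_eq (d := d) hε0 hκ hκε hn3
  have hεc : (ε : ℂ) ≠ 0 := by exact_mod_cast hε0.ne'
  have h1τ : 1 + (1 - κ * ε) = 2 - κ * ε := by ring
  have h1τ' : 1 - (1 - κ * ε) = κ * ε := by ring
  have hr1 : Real.exp (-ε) < 1 := by rw [Real.exp_lt_one_iff]; linarith
  have hsqc : ((Real.sqrt (N.succ : ℕ) : ℝ) : ℂ) ^ 2 = 1 / (ε : ℂ) ^ 3 := by
    rw [← Complex.ofReal_pow, hsq]; push_cast; ring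
  set ζ := dot (ofRealVec Ω) (U + conjVec V) with hζ
  set γ := dot (U + conjVec V) (U + conjVec V) / 4 with hγ
  set b := dot (U - conjVec V) (U - conjVec V) / 4 with hb
  have hXX : dot (ofRealVec ((2 - κ * ε) • Ω)) (ofRealVec ((2 - κ * ε) • Ω)) =
      (2 - κ * ε) ^ 2 := by
    rw [dot_ofRealVec_self, norm_smul, hΩ, mul_one, Real.norm_eq_abs, sq_abs]
    push_cast; ring
  have hζ' : dot (ofRealVec Ω) U + dot (ofRealVec Ω) (conjVec V) = ζ := by
    rw [hζ, dot_add_right]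
  have hUV : dot U (conjVec V) = γ - b := dot_conj_eq _ _
  have hUU : dot U U + dot (conjVec V) (conjVec V) = 2 * (γ + b) := dot_self_add_dot_self _ _
  have hP : ∀ a e : ℝ, (a : ℂ) ^ 2 = 1 / (ε : ℂ) ^ 3 → e = ε ^ 2 →
      dot ((a : ℂ) • (ofRealVec ((2 - κ * ε) • Ω) + (e : ℂ) • U))
        (conjVec ((a : ℂ) • (ofRealVec ((2 - κ * ε) • Ω) + (e : ℂ) • V))) =
      1 / ε ^ 3 * ((2 - κ * ε) ^ 2 + ε ^ 2 * ((2 - κ * ε) * ζ) + ε ^ 4 * (γ - b)) := by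
    intro a e ha he
    rw [conjVec_smul_add, dot_smul_add, hXX, dot_ofRealVec_smul, dot_ofRealVec_smul, ha, he, hUV,
      ← hζ']
    push_cast; ring
  have hQ : ∀ a e : ℝ, (a : ℂ) ^ 2 = 1 / (ε : ℂ) ^ 3 → e = ε ^ 2 →
      dot ((a : ℂ) • (ofRealVec ((2 - κ * ε) • Ω) + (e : ℂ) • U))
        ((a : ℂ) • (ofRealVec ((2 - κ * ε) • Ω) + (e : ℂ) • U)) +
      dot (conjVec ((a : ℂ) • (ofRealVec ((2 - κ * ε) • Ω) + (e : ℂ) • V)))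
        (conjVec ((a : ℂ) • (ofRealVec ((2 - κ * ε) • Ω) + (e : ℂ) • V))) =
      1 / ε ^ 3 * (2 * (2 - κ * ε) ^ 2 + 2 * ε ^ 2 * ((2 - κ * ε) * ζ) +
          ε ^ 4 * (2 * (γ + b))) := by
    intro a e ha he
    rw [conjVec_smul_add, dot_smul_add, dot_smul_add, hXX, dot_ofRealVec_smul, dot_ofRealVec_smul,
      ha, he, ← hζ', ← hUU]
    push_cast; ring
  have hW : -((Real.sqrt (N.succ : ℕ) ^ 2 * (‖(2 - κ * ε) • Ω‖ ^ 2 +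
        2 * ε ^ 2 * ∑ k, ((2 - κ * ε) • Ω) k * (U k).re + (ε ^ 2) ^ 2 * reSq U) +
      Real.sqrt (N.succ : ℕ) ^ 2 * (‖(2 - κ * ε) • Ω‖ ^ 2 +
        2 * ε ^ 2 * ∑ k, ((2 - κ * ε) • Ω) k * (V k).re + (ε ^ 2) ^ 2 * reSq V)) /
          (2 * (2 - κ * ε))) -
      (Real.sqrt (N.succ : ℕ) ^ 2 * (ε ^ 2) ^ 2 * ‖imVec U‖ ^ 2 +
        Real.sqrt (N.succ : ℕ) ^ 2 * (ε ^ 2) ^ 2 * ‖imVec V‖ ^ 2) / (2 * (κ * ε)) =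
      -((1 / ε ^ 3 * (2 * (2 - κ * ε) ^ 2 + 2 * (2 - κ * ε) * ε ^ 2 *
        (∑ k, Ω k * (U k).re + ∑ k, Ω k * (V k).re) +
        ε ^ 4 * (reSq U + reSq V))) / (2 * (2 - κ * ε))) -
        1 / ε ^ 3 * ε ^ 4 * (‖imVec U‖ ^ 2 + ‖imVec V‖ ^ 2) / (2 * (κ * ε)) := by
    rw [hsq, norm_smul, hΩ, mul_one, Real.norm_eq_abs, sq_abs]
    simp only [PiLp.smul_apply, smul_eq_mul, mul_assoc, ← Finset.mul_sum]
    ring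
  rw [scaledKernel, hτ, edgePoint, edgePoint, hn23, h1τ,
    kernel_eq_integral (r := Real.exp (-ε)) (by linarith) (by nlinarith) (Real.exp_pos _) hr1,
    integral_circle_eq hε0, hP _ _ hsqc rfl, hQ _ _ hsqc rfl,
    reSq_smul_add, reSq_smul_add, norm_imVec_smul_add, norm_imVec_smul_add, h1τ, h1τ', hW]
  have hint := fun y : ℝ => edge_integrand_eq (d := d) hε0 hκ hκε N hn3 (reSq U + reSq V)
    (‖imVec U‖ ^ 2 + ‖imVec V‖ ^ 2) (∑ k, Ω k * (U k).re + ∑ k, Ω k * (V k).re) ζ γ b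
    (σ := -1 + y * Complex.I) (by simp)
  have hint2 := intervalIntegral.integral_congr (μ := volume) (a := -(Real.pi / ε))
    (b := Real.pi / ε) fun y _ => hint y
  rw [intervalIntegral.integral_const_mul, intervalIntegral.integral_const_mul] at hint2
  -- The real part of `ζ` is the weight's linear term, so `(ζ - p) / ε` is purely imaginary.
  have hcoc : edgeCocycle N.succ Ω U V = Complex.exp
      ((ζ - ((∑ k, Ω k * (U k).re + ∑ k, Ω k * (V k).re : ℝ) : ℂ)) / ε) := by
    rw [edgeCocycle, hn13, hζ, dot_ofRealVec_add_conjVec]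
    congr 1
    push_cast
    ring
  have hexp : ((Real.exp (-((‖imVec U‖ ^ 2 + ‖imVec V‖ ^ 2) / (2 * κ))) : ℝ) : ℂ) =
      Complex.exp (-(((‖imVec U‖ ^ 2 + ‖imVec V‖ ^ 2 : ℝ) : ℂ) / (2 * κ))) := by
    push_cast; rfl
  have hc : ((edgeConst d κ ε : ℝ) : ℂ) =
      ((1 / (N.succ : ℝ) ^ (4 * (d : ℝ) / 3) : ℝ) : ℂ) * (N.succ : ℂ) ^ d *
      ((1 / (Real.pi ^ d * (1 - (1 - κ * ε) ^ 2) ^ ((d : ℝ) / 2)) : ℝ) : ℂ) *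
      ((ε ^ (-((d : ℝ) / 2)) : ℝ) : ℂ) := by
    rw [← hconst]
    simp only [Complex.ofReal_mul, Complex.ofReal_pow, Complex.ofReal_natCast]
  rw [hcoc, hexp, hc]
  linear_combination (((1 / (N.succ : ℝ) ^ (4 * (d : ℝ) / 3) : ℝ) : ℂ) * (N.succ : ℂ) ^ d *
      ((1 / (Real.pi ^ d * (1 - (1 - κ * ε) ^ 2) ^ ((d : ℝ) / 2)) : ℝ) : ℂ) *
      (2 * (Real.pi : ℂ))⁻¹ * ε) * hint2 +
    (Complex.exp ((ζ - ((∑ k, Ω k * (U k).re + ∑ k, Ω k * (V k).re : ℝ) : ℂ)) / ε) *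
      Complex.exp (-(((‖imVec U‖ ^ 2 + ‖imVec V‖ ^ 2 : ℝ) : ℂ) / (2 * κ))) *
      (((1 / (N.succ : ℝ) ^ (4 * (d : ℝ) / 3) : ℝ) : ℂ) * (N.succ : ℂ) ^ d *
      ((1 / (Real.pi ^ d * (1 - (1 - κ * ε) ^ 2) ^ ((d : ℝ) / 2)) : ℝ) : ℂ) *
      ((ε ^ (-((d : ℝ) / 2)) : ℝ) : ℂ)) * (2 * (Real.pi : ℂ))⁻¹ *
      ∫ y in -(Real.pi / ε)..Real.pi / ε, Complex.exp (edgePhase d κ (reSq U + reSq V)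
        ζ γ b ε (-1 + y * Complex.I))) * mul_inv_cancel₀ hεc

/-! ### Convergence of the phase near the real point of the circle. -/

/-- The limit of `edgePhase` as `ε → 0`. -/
noncomputable def limitPhase (d : ℕ) (κ : ℝ) (ζ b σ : ℂ) : ℂ :=
  κ * σ ^ 2 / 4 - σ ^ 3 / 12 + ζ * σ / 2 - b / (κ - σ) -
    (d : ℂ) / 2 * Complex.log (2 * (κ - σ)) - Complex.log (-σ)

theorem norm_log_sub_log_le {δ : ℝ} (hδ : 0 < δ) {z w : ℂ} (hz : δ ≤ z.re) (hw : δ ≤ w.re) :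
    ‖Complex.log z - Complex.log w‖ ≤ δ⁻¹ * ‖z - w‖ := by
  refine Convex.norm_image_sub_le_of_norm_hasDerivWithin_le (s := {z : ℂ | δ ≤ z.re})
    (f := Complex.log) (f' := fun z => z⁻¹) (fun x hx => ?_) (fun x hx => ?_)
    (convex_halfSpace_re_ge δ) hw hz
  · exact (Complex.hasDerivAt_log (Or.inl (hδ.trans_le hx))).hasDerivWithinAt
  · rw [norm_inv]
    exact inv_anti₀ hδ (le_trans hx (Complex.re_le_norm x))

theorem exp_le_three {x : ℝ} (hx : x ≤ 1) : Real.exp x ≤ 3 :=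
  (Real.exp_le_exp.2 hx).trans Real.exp_one_lt_three.le

theorem norm_exp_sub_one_le_three {h : ℂ} {η : ℝ} (hη : η ≤ 1) (hh : ‖h‖ ≤ η) :
    ‖Complex.exp h - 1‖ ≤ 3 * η := by
  have := Complex.norm_exp_sub_sum_le_norm_mul_exp h 1
  simp only [Finset.sum_range_one, pow_zero, Nat.factorial_zero, Nat.cast_one, div_one,
    pow_one] at this
  nlinarith [exp_le_three (hh.trans hη), norm_nonneg h, Real.exp_pos ‖h‖]

theorem norm_exp_sub_one_sub_le {h : ℂ} {η : ℝ} (hη : η ≤ 1) (hh : ‖h‖ ≤ η) :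
    ‖Complex.exp h - 1 - h‖ ≤ 3 * η ^ 2 := by
  have := Complex.norm_exp_sub_sum_le_norm_mul_exp h 2
  simp only [Finset.sum_range_succ, Finset.sum_range_zero, pow_zero, Nat.factorial,
    Nat.cast_one, div_one, pow_one, zero_add, mul_one] at this
  rw [sub_sub]
  calc _ ≤ ‖h‖ ^ 2 * Real.exp ‖h‖ := this
    _ ≤ η ^ 2 * 3 := by gcongr; exact exp_le_three (hh.trans hη)
    _ = _ := by ring

theorem norm_exp_sub_cubic_le {h : ℂ} {η : ℝ} (hη : η ≤ 1) (hh : ‖h‖ ≤ η) :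
    ‖Complex.exp h - 1 - h - h ^ 2 / 2 - h ^ 3 / 6‖ ≤ 3 * η ^ 4 := by
  have := Complex.norm_exp_sub_sum_le_norm_mul_exp h 4
  simp only [Finset.sum_range_succ, Finset.sum_range_zero, pow_zero, Nat.factorial,
    Nat.cast_one, div_one, pow_one, zero_add, mul_one] at this
  have e : Complex.exp h - 1 - h - h ^ 2 / 2 - h ^ 3 / 6 = Complex.exp h -
    (1 + h + h ^ 2 / ((1 + 1 : ℕ) : ℂ) + h ^ 3 / (((2 + 1) * (1 + 1) : ℕ) : ℂ)) := by
    push_cast; ring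
  rw [e]
  calc _ ≤ ‖h‖ ^ 4 * Real.exp ‖h‖ := this
    _ ≤ η ^ 4 * 3 := by gcongr; exact exp_le_three (hh.trans hη)
    _ = _ := by ring

/-- The rescaled remainder in the expansion of the leading term of the phase. -/
noncomputable def phaseRemainder (p : ℂ × ℂ × ℂ × ℂ) : ℂ :=
  let η := p.1; let u := p.2.1; let v := p.2.2.1; let t := p.2.2.2
  2 * t + v ^ 2 * u ^ 2 / 4 + v * u ^ 3 / 4 - η * v * t -
    (1 - η * v) * (v * u ^ 3 / 4 + u ^ 4 / 12 + η * u * t + η * v * u ^ 4 / 8 +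
      η ^ 2 * v * u ^ 5 / 24 + η ^ 3 * v * u ^ 2 * t / 4 - η * u ^ 5 / 24 - η ^ 2 * u ^ 6 / 72 -
      η ^ 3 * u ^ 3 * t / 12)

theorem continuous_phaseRemainder : Continuous phaseRemainder := by
  unfold phaseRemainder
  have h1 : Continuous fun p : ℂ × ℂ × ℂ × ℂ => p.1 := continuous_fst
  have h2 : Continuous fun p : ℂ × ℂ × ℂ × ℂ => p.2.1 := continuous_snd.fst
  have h3 : Continuous fun p : ℂ × ℂ × ℂ × ℂ => p.2.2.1 := continuous_snd.snd.fst
  have h4 : Continuous fun p : ℂ × ℂ × ℂ × ℂ => p.2.2.2 := continuous_snd.snd.snd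
  fun_prop

theorem exists_phaseRemainder_le (R : ℝ) :
    ∃ C, ∀ p : ℂ × ℂ × ℂ × ℂ, ‖p‖ ≤ R → ‖phaseRemainder p‖ ≤ C := by
  obtain ⟨C, hC⟩ := (isCompact_closedBall (0 : ℂ × ℂ × ℂ × ℂ) R).exists_bound_of_continuousOn
    (f := phaseRemainder) continuous_phaseRemainder.continuousOn
  exact ⟨C, fun p hp => hC p (by simpa using hp)⟩

/-- Cleared of denominators, the expansion of the leading term cancels through order three, and `η⁴`
factors out of a polynomial in the normalised variables. -/
theorem phaseRemainder_spec {h k S ρ η u v t : ℂ} (hS : S = h + h ^ 2 / 2 + h ^ 3 / 6 + ρ)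
    (hh : h = η * u) (hk : k = η * v) (hρ : ρ = η ^ 4 * t) :
    (2 - k) * S - (h + k * h ^ 2 / 4 - h ^ 3 / 12) * (1 + (1 + S) * (1 - k)) =
      η ^ 4 * phaseRemainder (η, u, v, t) := by
  subst hρ hk hh hS
  simp only [phaseRemainder]
  ring

/-- Normalise by `η = ε L`: then `σ / L`, `κ / L` and the Taylor remainder over `η⁴` range over a
bounded set, where the polynomial remainder is bounded. The error is of order `η⁴ / ε³ = ε L⁴`. -/
theorem leading_phase_sub_le (κ : ℝ) (hκ : 0 < κ) : ∃ C, 0 ≤ C ∧ ∀ (ε L : ℝ) (σ : ℂ), 0 < ε →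
    1 ≤ L → ε * L ≤ 1 → ‖σ‖ ≤ L → 1 ≤ ‖1 + Complex.exp (ε * σ) * (1 - κ * ε)‖ →
    ‖((2 - κ * ε) * (Complex.exp (ε * σ) - 1) / (1 + Complex.exp (ε * σ) * (1 - κ * ε)) -
      ε * σ) / ε ^ 3 - (κ * σ ^ 2 / 4 - σ ^ 3 / 12)‖ ≤ C * (ε * L ^ 4) := by
  -- The `3` comes from the exponential's Taylor remainder and covers `η` and `u`; `κ` covers `v`.
  obtain ⟨C, hC⟩ := exists_phaseRemainder_le (max 3 κ)
  refine ⟨max C 0, le_max_right _ _, fun ε L σ hε hL hεL hσ h1 => ?_⟩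
  have hL0 : 0 < L := by linarith
  have hεc : (ε : ℂ) ≠ 0 := by exact_mod_cast hε.ne'
  have hLc : (L : ℂ) ≠ 0 := by exact_mod_cast hL0.ne'
  have hh : ‖(ε : ℂ) * σ‖ ≤ ε * L := by
    rw [norm_mul, Complex.norm_real, Real.norm_of_nonneg hε.le]; gcongr
  set s := Complex.exp (ε * σ) with hs
  have hρ := norm_exp_sub_cubic_le hεL hh
  rw [← hs] at hρ
  set ρ := s - 1 - ε * σ - (ε * σ) ^ 2 / 2 - (ε * σ) ^ 3 / 6 with hρd
  have hηc : ((ε * L : ℝ) : ℂ) ≠ 0 := by push_cast; exact mul_ne_zero hεc hLc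
  have hA : 1 + s * (1 - κ * ε) ≠ 0 := fun h => by rw [h, norm_zero] at h1; linarith
  have spec := phaseRemainder_spec (h := ε * σ) (k := κ * ε) (S := s - 1) (ρ := ρ)
    (η := ((ε * L : ℝ) : ℂ)) (u := σ / L) (v := κ / L) (t := ρ / ((ε * L : ℝ) : ℂ) ^ 4)
    (by rw [hρd]; ring) (by push_cast; field_simp) (by push_cast; field_simp)
    (by field_simp)
  have hb : ‖phaseRemainder (((ε * L : ℝ) : ℂ), σ / L, κ / L, ρ / ((ε * L : ℝ) : ℂ) ^ 4)‖ ≤ C := by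
    refine hC _ ?_
    simp only [Prod.norm_def, sup_le_iff]
    refine ⟨?_, ?_, ?_, ?_⟩
    · rw [Complex.norm_real, Real.norm_of_nonneg (by positivity)]
      exact hεL.trans ((by norm_num : (1 : ℝ) ≤ 3).trans (le_max_left _ _))
    · rw [norm_div, Complex.norm_real, Real.norm_of_nonneg hL0.le]
      exact ((div_le_one hL0).2 hσ).trans ((by norm_num : (1 : ℝ) ≤ 3).trans (le_max_left _ _))
    · rw [norm_div, Complex.norm_real, Complex.norm_real, Real.norm_of_nonneg hL0.le,
        Real.norm_of_nonneg hκ.le]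
      exact (div_le_self hκ.le hL).trans (le_max_right _ _)
    · rw [norm_div, norm_pow, Complex.norm_real, Real.norm_of_nonneg (by positivity)]
      exact ((div_le_iff₀ (by positivity)).2 hρ).trans (le_max_left _ _)
  have e : ((2 - κ * ε) * (s - 1) / (1 + s * (1 - κ * ε)) - ε * σ) / ε ^ 3 -
      (κ * σ ^ 2 / 4 - σ ^ 3 / 12) =
      ((2 - κ * ε) * (s - 1) - (ε * σ + κ * ε * (ε * σ) ^ 2 / 4 - (ε * σ) ^ 3 / 12) *
        (1 + (1 + (s - 1)) * (1 - κ * ε))) / ((1 + s * (1 - κ * ε)) * ε ^ 3) := by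
    rw [add_sub_cancel]
    field_simp
    ring
  rw [e, spec, norm_div, norm_mul, norm_mul, norm_pow, norm_pow, Complex.norm_real,
    Complex.norm_real, Real.norm_of_nonneg hε.le, Real.norm_of_nonneg (by positivity : 0 ≤ ε * L),
    div_le_iff₀ (by positivity)]
  calc (ε * L) ^ 4 * _ ≤ (ε * L) ^ 4 * max C 0 := by gcongr; exact hb.trans (le_max_left _ _)
    _ = max C 0 * (ε * L ^ 4) * (1 * ε ^ 3) := by ring
    _ ≤ _ := by gcongr

theorem norm_edge_sigma_le (y : ℝ) : ‖(-1 + y * Complex.I : ℂ)‖ ≤ 1 + |y| := by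
  refine (norm_add_le _ _).trans ?_
  simp

theorem norm_exp_edge (ε y : ℝ) :
    ‖Complex.exp (ε * (-1 + y * Complex.I))‖ = Real.exp (-ε) := by
  rw [Complex.norm_exp]
  congr 1
  simp

theorem norm_one_sub_mul_ge {s : ℂ} (hs : ‖s‖ ≤ 1) {κ ε : ℝ} (hκε : κ * ε ≤ 1) :
    κ * ε ≤ ‖1 - s * (1 - κ * ε)‖ := by
  have h1 : (1 - κ * ε : ℂ) = ((1 - κ * ε : ℝ) : ℂ) := by push_cast; ring
  have h2 : ‖s * (1 - κ * ε)‖ ≤ 1 - κ * ε := by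
    rw [norm_mul, h1, Complex.norm_real, Real.norm_of_nonneg (by linarith)]
    exact mul_le_of_le_one_left (by linarith) hs
  have := norm_sub_norm_le (1 : ℂ) (s * (1 - κ * ε))
  rw [norm_one] at this
  linarith

theorem one_le_norm_one_add {ε y κ : ℝ} (hε : 0 < ε) (hεL : ε * (1 + |y|) ≤ 1)
    (hκε : κ * ε ≤ 1) :
    1 ≤ ‖1 + Complex.exp (ε * (-1 + y * Complex.I)) * (1 - κ * ε)‖ := by
  refine le_trans ?_ (Complex.re_le_norm _)
  have h1 : (1 - κ * ε : ℂ) = ((1 - κ * ε : ℝ) : ℂ) := by push_cast; ring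
  have h2 : 0 < Real.cos (ε * y) := Real.cos_pos_of_le_one (by
    rw [abs_mul, abs_of_pos hε]; nlinarith)
  rw [h1, Complex.add_re, Complex.one_re, Complex.re_mul_ofReal, Complex.exp_re]
  have h3 : ((ε : ℂ) * (-1 + y * Complex.I)).im = ε * y := by simp
  rw [h3]
  have : 0 ≤ Real.exp ((ε : ℂ) * (-1 + y * Complex.I)).re * Real.cos (ε * y) * (1 - κ * ε) :=
    mul_nonneg (mul_nonneg (Real.exp_pos _).le h2.le) (by linarith)
  linarith

section terms

variable {κ ε L : ℝ} {s σ : ℂ}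

theorem second_term_sub_le (hκ : 0 < κ) (hε : 0 < ε) (hκε : κ * ε ≤ 1)
    (hL : 1 ≤ L) (hσ : ‖σ‖ ≤ L) (h1 : ‖s - 1‖ ≤ 3 * (ε * L))
    (h2 : ‖s - 1 - ε * σ‖ ≤ 3 * (ε * L) ^ 2) (hA : 1 ≤ ‖1 + s * (1 - κ * ε)‖) :
    ‖(s - 1) / (1 + s * (1 - κ * ε)) / ε - σ / 2‖ ≤ (5 + κ) * (ε * L ^ 2) := by
  have hεc : (ε : ℂ) ≠ 0 := by exact_mod_cast hε.ne'
  have hA0 : 1 + s * (1 - κ * ε) ≠ 0 := fun h => by rw [h, norm_zero] at hA; linarith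
  have e : (s - 1) / (1 + s * (1 - κ * ε)) / ε - σ / 2 =
      ((s - 1 - ε * σ) + ε * σ * (κ * ε) / 2 - ε * σ * (s - 1) * (1 - κ * ε) / 2) /
        ((1 + s * (1 - κ * ε)) * ε) := by
    field_simp
    ring
  have h3 : ‖(ε : ℂ)‖ = ε := by rw [Complex.norm_real, Real.norm_of_nonneg hε.le]
  have h3' : ‖(κ : ℂ)‖ = κ := by rw [Complex.norm_real, Real.norm_of_nonneg hκ.le]
  have h4 : ‖(1 - κ * ε : ℂ)‖ ≤ 1 := by
    have : (1 - κ * ε : ℂ) = ((1 - κ * ε : ℝ) : ℂ) := by push_cast; ring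
    rw [this, Complex.norm_real, Real.norm_of_nonneg (by linarith)]
    nlinarith
  have h5 : ‖(ε : ℂ) * σ * (κ * ε) / 2‖ ≤ ε * L * (κ * ε) / 2 := by
    rw [norm_div, norm_mul, norm_mul, norm_mul, h3, h3', Complex.norm_ofNat]; gcongr
  have h6 : ‖(ε : ℂ) * σ * (s - 1) * (1 - κ * ε) / 2‖ ≤ ε * L * (3 * (ε * L)) * 1 / 2 := by
    rw [norm_div, norm_mul, norm_mul, norm_mul, h3, Complex.norm_ofNat]; gcongr
  rw [e, norm_div, norm_mul, h3, div_le_iff₀ (by positivity)]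
  have h7 := norm_sub_le ((s - 1 - ε * σ) + ε * σ * (κ * ε) / 2)
    (ε * σ * (s - 1) * (1 - κ * ε) / 2)
  have h8 := norm_add_le (s - 1 - ε * σ) (ε * σ * (κ * ε) / 2)
  have h9 : ε * L * (κ * ε) / 2 ≤ κ * (ε * L) ^ 2 := by
    have : 0 ≤ ε ^ 2 * κ * L := by positivity
    nlinarith
  have h10 : (5 + κ) * (ε * L) ^ 2 = (5 + κ) * (ε * L ^ 2) * (1 * ε) := by ring
  have h11 : (5 + κ) * (ε * L ^ 2) * (1 * ε) ≤
      (5 + κ) * (ε * L ^ 2) * (‖1 + s * (1 - κ * ε)‖ * ε) := by gcongr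
  have h12 : 0 ≤ (ε * L) ^ 2 := by positivity
  nlinarith

theorem one_sub_div_sub_le (hκ : 0 < κ) (hε : 0 < ε) (hL : 1 ≤ L)
    (h1 : ‖s - 1‖ ≤ 3 * (ε * L)) (h2 : ‖s - 1 - ε * σ‖ ≤ 3 * (ε * L) ^ 2) :
    ‖(1 - s * (1 - κ * ε)) / ε - (κ - σ)‖ ≤ (3 + 3 * κ) * (ε * L ^ 2) := by
  have hεc : (ε : ℂ) ≠ 0 := by exact_mod_cast hε.ne'
  have h3 : ‖(ε : ℂ)‖ = ε := by rw [Complex.norm_real, Real.norm_of_nonneg hε.le]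
  have h3' : ‖(κ : ℂ)‖ = κ := by rw [Complex.norm_real, Real.norm_of_nonneg hκ.le]
  have e : (1 - s * (1 - κ * ε)) / ε - (κ - σ) =
      (-(s - 1 - ε * σ) + κ * ε * (s - 1)) / ε := by
    field_simp
    ring
  rw [e, norm_div, h3, div_le_iff₀ hε]
  refine (norm_add_le _ _).trans ?_
  rw [norm_neg, norm_mul, norm_mul, h3, h3']
  have h4 : κ * ε * ‖s - 1‖ ≤ κ * ε * (3 * (ε * L)) := by gcongr
  have h5 : κ * ε * (3 * (ε * L)) ≤ κ * ε * (3 * (ε * L)) * L :=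
    le_mul_of_one_le_right (by positivity) hL
  nlinarith

theorem pole_term_sub_le (hκ : 0 < κ) (hε : 0 < ε) (hκε : κ * ε ≤ 1) (hL : 1 ≤ L)
    (hs : ‖s‖ ≤ 1) (hσ : σ.re = -1)
    (h1 : ‖s - 1‖ ≤ 3 * (ε * L)) (h2 : ‖s - 1 - ε * σ‖ ≤ 3 * (ε * L) ^ 2) :
    ‖ε * s / (1 - s * (1 - κ * ε)) - 1 / (κ - σ)‖ ≤ (6 + 3 * κ) / κ * (ε * L ^ 2) := by
  have hεc : (ε : ℂ) ≠ 0 := by exact_mod_cast hε.ne'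
  have hB := norm_one_sub_mul_ge hs hκε
  have hB0 : 1 - s * (1 - κ * ε) ≠ 0 := fun h => by
    rw [h, norm_zero] at hB; nlinarith
  have h3 : ‖(ε : ℂ)‖ = ε := by rw [Complex.norm_real, Real.norm_of_nonneg hε.le]
  have hre : (κ - σ).re = κ + 1 := by simp [hσ]
  have hn : κ + 1 ≤ ‖(κ - σ : ℂ)‖ := hre ▸ Complex.re_le_norm _
  have hn0 : (κ - σ : ℂ) ≠ 0 := fun h => by rw [h, norm_zero] at hn; linarith
  have h4 := one_sub_div_sub_le hκ hε hL h1 h2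
  set a := (1 - s * (1 - κ * ε)) / ε with ha
  have ha0 : a ≠ 0 := div_ne_zero hB0 hεc
  have ha1 : κ ≤ ‖a‖ := by rw [ha, norm_div, h3, le_div_iff₀ hε]; exact hB
  have e : ε * s / (1 - s * (1 - κ * ε)) - 1 / (κ - σ) =
      ((s - 1) * (κ - σ) - (a - (κ - σ))) / (a * (κ - σ)) := by
    have : (1 - s * (1 - κ * ε)) = a * ε := by rw [ha]; field_simp
    rw [this]
    field_simp
    ring
  rw [e, norm_div, norm_mul, div_le_iff₀ (by nlinarith [norm_nonneg a])]
  refine (norm_sub_le _ _).trans ?_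
  rw [norm_mul]
  have h5 : ‖a - (κ - σ)‖ ≤ (3 + 3 * κ) * (ε * L ^ 2) * ‖(κ - σ : ℂ)‖ :=
    h4.trans (le_mul_of_one_le_right (by positivity) (by linarith))
  have h6 : ‖s - 1‖ ≤ 3 * (ε * L ^ 2) := by
    refine h1.trans ?_
    have : ε * L ≤ ε * L * L := le_mul_of_one_le_right (by positivity) hL
    nlinarith
  calc _ ≤ 3 * (ε * L ^ 2) * ‖(κ - σ : ℂ)‖ + (3 + 3 * κ) * (ε * L ^ 2) * ‖(κ - σ : ℂ)‖ := by
        gcongr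
    _ = (6 + 3 * κ) / κ * (ε * L ^ 2) * (κ * ‖(κ - σ : ℂ)‖) := by field_simp; ring
    _ ≤ _ := by gcongr

theorem re_one_sub_sq_ge (hε : 0 < ε) (hκ : 0 < κ) (hκε : κ * ε ≤ 1) (hs : ‖s‖ ≤ 1) :
    κ ≤ ((1 - (s * (1 - κ * ε)) ^ 2) / ε).re := by
  have h1 : (1 - κ * ε : ℂ) = ((1 - κ * ε : ℝ) : ℂ) := by push_cast; ring
  have h2 : ‖(s * (1 - κ * ε)) ^ 2‖ ≤ 1 - κ * ε := by
    rw [norm_pow, norm_mul, h1, Complex.norm_real, Real.norm_of_nonneg (by linarith)]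
    have : ‖s‖ * (1 - κ * ε) ≤ 1 - κ * ε := mul_le_of_le_one_left (by linarith) hs
    have h0 : 0 ≤ ‖s‖ * (1 - κ * ε) := mul_nonneg (norm_nonneg _) (by linarith)
    have hk : 0 < κ * ε := by positivity
    nlinarith
  rw [Complex.div_ofReal_re, le_div_iff₀ hε, Complex.sub_re, Complex.one_re]
  linarith [Complex.re_le_norm ((s * (1 - κ * ε)) ^ 2)]

theorem log_term_sub_le (hκ : 0 < κ) (hε : 0 < ε) (hκε : κ * ε ≤ 1) (hεL : ε * L ≤ 1)
    (hL : 1 ≤ L) (hσL : ‖σ‖ ≤ L) (hs : ‖s‖ ≤ 1) (hσ : σ.re = -1)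
    (h1 : ‖s - 1‖ ≤ 3 * (ε * L)) (h2 : ‖s - 1 - ε * σ‖ ≤ 3 * (ε * L) ^ 2) :
    ‖Complex.log ((1 - (s * (1 - κ * ε)) ^ 2) / ε) - Complex.log (2 * (κ - σ))‖ ≤
      (min κ 1)⁻¹ * ((2 * (3 + 3 * κ) + (4 + 4 * κ) ^ 2) * (ε * L ^ 2)) := by
  have hεc : (ε : ℂ) ≠ 0 := by exact_mod_cast hε.ne'
  have h3 : ‖(ε : ℂ)‖ = ε := by rw [Complex.norm_real, Real.norm_of_nonneg hε.le]
  have h3' : ‖(κ : ℂ)‖ = κ := by rw [Complex.norm_real, Real.norm_of_nonneg hκ.le]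
  have hmin : 0 < min κ 1 := lt_min hκ one_pos
  refine (norm_log_sub_log_le hmin ((min_le_left _ _).trans
    (re_one_sub_sq_ge hε hκ hκε hs)) ((min_le_right _ _).trans ?_)).trans ?_
  · have : (2 * (κ - σ) : ℂ) = ((2 : ℝ) : ℂ) * (κ - σ) := by push_cast; ring
    rw [this, Complex.re_ofReal_mul, Complex.sub_re, hσ, Complex.ofReal_re]
    linarith
  have h4 := one_sub_div_sub_le hκ hε hL h1 h2
  set a := (1 - s * (1 - κ * ε)) / ε with ha
  have ha' : s * (1 - κ * ε) = 1 - ε * a := by rw [ha]; field_simp; ring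
  have haL : ‖a‖ ≤ (4 + 4 * κ) * L := by
    have e : a = (a - (κ - σ)) + (κ - σ) := by ring
    have h5 : (3 + 3 * κ) * (ε * L ^ 2) ≤ (3 + 3 * κ) * (1 * L) := by
      have : ε * L ^ 2 ≤ 1 * L := by nlinarith
      gcongr
    have h6 : ‖(κ - σ : ℂ)‖ ≤ κ * L + L := by
      refine (norm_sub_le _ _).trans ?_
      rw [h3']; nlinarith
    rw [e]
    refine (norm_add_le _ _).trans ?_
    nlinarith
  -- Substituting `s τ = 1 - ε a` gives `(1 - (s τ)²) / ε = 2 a - ε a²`.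
  have e : (1 - (s * (1 - κ * ε)) ^ 2) / ε - 2 * (κ - σ) = 2 * (a - (κ - σ)) - ε * a ^ 2 := by
    rw [ha']; field_simp; ring
  rw [e]
  gcongr
  refine (norm_sub_le _ _).trans ?_
  rw [norm_mul, norm_mul, norm_pow, h3, Complex.norm_ofNat]
  calc _ ≤ 2 * ((3 + 3 * κ) * (ε * L ^ 2)) + ε * ((4 + 4 * κ) * L) ^ 2 := by gcongr
    _ = _ := by ring

theorem half_le_one_sub_exp_neg (hε : 0 < ε) (hε1 : ε ≤ 1) : ε / 2 ≤ 1 - Real.exp (-ε) := by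
  have h1 := Real.add_one_le_exp ε
  have h2 : Real.exp (-ε) ≤ (1 + ε)⁻¹ := by
    rw [Real.exp_neg]; exact inv_anti₀ (by linarith) (by linarith)
  have h3 : (1 + ε)⁻¹ ≤ 1 - ε / 2 := by
    rw [inv_le_iff_one_le_mul₀ (by linarith)]; nlinarith
  linarith

theorem re_one_sub_ge (hε : 0 < ε) (hε1 : ε ≤ 1) (hs : ‖s‖ = Real.exp (-ε)) :
    1 / 2 ≤ ((1 - s) / ε).re := by
  rw [Complex.div_ofReal_re, le_div_iff₀ hε, Complex.sub_re, Complex.one_re]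
  linarith [Complex.re_le_norm s, half_le_one_sub_exp_neg hε hε1]

theorem log_one_sub_sub_le (hε : 0 < ε) (hε1 : ε ≤ 1) (hs : ‖s‖ = Real.exp (-ε))
    (hσ : σ.re = -1) (h2 : ‖s - 1 - ε * σ‖ ≤ 3 * (ε * L) ^ 2) :
    ‖Complex.log ((1 - s) / ε) - Complex.log (-σ)‖ ≤ 6 * (ε * L ^ 2) := by
  have hεc : (ε : ℂ) ≠ 0 := by exact_mod_cast hε.ne'
  have h3 : ‖(ε : ℂ)‖ = ε := by rw [Complex.norm_real, Real.norm_of_nonneg hε.le]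
  refine (norm_log_sub_log_le (by norm_num : (0 : ℝ) < 1 / 2) (re_one_sub_ge hε hε1 hs)
    (by simp [hσ]; norm_num)).trans ?_
  have e : (1 - s) / ε - -σ = -(s - 1 - ε * σ) / ε := by field_simp; ring
  rw [e, norm_div, norm_neg, h3]
  have : ‖s - 1 - ε * σ‖ / ε ≤ 3 * (ε * L ^ 2) := by
    rw [div_le_iff₀ hε]; linarith
  linarith

end terms

/-- Term by term. The terms with `γ`, `q` and the lone `ε σ` have no counterpart in the limit and
are small by themselves; the leading term alone needs the fourth power. -/
theorem edgePhase_sub_limitPhase_le (d : ℕ) {κ : ℝ} (hκ : 0 < κ) (q : ℝ) (ζ γ b : ℂ) :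
    ∃ C, 0 ≤ C ∧ ∀ ε y : ℝ, 0 < ε → κ * ε ≤ 1 → ε * (1 + |y|) ≤ 1 →
      ‖edgePhase d κ q ζ γ b ε (-1 + y * Complex.I) - limitPhase d κ ζ b (-1 + y * Complex.I)‖ ≤
        C * (ε * (1 + |y|) ^ 4) := by
  obtain ⟨C, hC0, hC⟩ := leading_phase_sub_le κ hκ
  have hmin : 0 < min κ 1 := lt_min hκ one_pos
  refine ⟨C + ‖ζ‖ * (5 + κ) + ‖γ‖ + ‖b‖ * ((6 + 3 * κ) / κ) + |q| + 1 +
    d / 2 * ((min κ 1)⁻¹ * (2 * (3 + 3 * κ) + (4 + 4 * κ) ^ 2)) + 6, by positivity,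
    fun ε y hε hκε hεL => ?_⟩
  have hL : 1 ≤ 1 + |y| := by linarith [abs_nonneg y]
  have hσL := norm_edge_sigma_le y
  have hσ : (-1 + y * Complex.I : ℂ).re = -1 := by simp
  have hs := norm_exp_edge ε y
  have hA := one_le_norm_one_add hε hεL hκε
  generalize (1 + |y|) = L at *
  generalize (-1 + y * Complex.I : ℂ) = σ at *
  have hε1 : ε ≤ 1 := by nlinarith
  have h3 : ‖(ε : ℂ)‖ = ε := by rw [Complex.norm_real, Real.norm_of_nonneg hε.le]
  have hh : ‖(ε : ℂ) * σ‖ ≤ ε * L := by rw [norm_mul, h3]; gcongr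
  have h1 := norm_exp_sub_one_le_three hεL hh
  have h2 := norm_exp_sub_one_sub_le hεL hh
  have t1 := hC ε L σ hε hL hεL hσL hA
  unfold edgePhase limitPhase
  generalize Complex.exp (ε * σ) = s at *
  have hs1 : ‖s‖ ≤ 1 := by rw [hs]; exact Real.exp_le_one_iff.2 (by linarith)
  have t2 := second_term_sub_le hκ hε hκε hL hσL h1 h2 hA
  have t5 := pole_term_sub_le hκ hε hκε hL hs1 hσ h1 h2
  have t7 := log_term_sub_le hκ hε hκε hεL hL hσL hs1 hσ h1 h2
  have t8 := log_one_sub_sub_le hε hε1 hs hσ h2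
  have hL2 : L ^ 2 ≤ L ^ 4 := pow_le_pow_right₀ hL (by norm_num)
  have hL1 : L ≤ L ^ 4 := le_self_pow₀ hL (by norm_num)
  have hL0 : 1 ≤ L ^ 4 := one_le_pow₀ hL
  set M := ε * L ^ 4 with hM
  have hM2 : ε * L ^ 2 ≤ M := by rw [hM]; gcongr
  have hM1 : ε * L ≤ M := by rw [hM]; gcongr
  have hM0 : ε ≤ M := le_mul_of_one_le_right hε.le hL0
  have b2 : ‖ζ * ((s - 1) / (1 + s * (1 - κ * ε)) / ε - σ / 2)‖ ≤ ‖ζ‖ * (5 + κ) * M := by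
    rw [norm_mul, mul_assoc]
    gcongr
    exact t2.trans (by gcongr)
  have b3 : ‖ε * γ * s / (1 + s * (1 - κ * ε))‖ ≤ ‖γ‖ * M := by
    rw [norm_div, norm_mul, norm_mul, h3, div_le_iff₀ (by linarith)]
    calc _ ≤ M * ‖γ‖ * 1 := by gcongr
      _ ≤ M * ‖γ‖ * ‖1 + s * (1 - κ * ε)‖ := by gcongr
      _ = _ := by ring
  have b5 : ‖b * (ε * s / (1 - s * (1 - κ * ε)) - 1 / (κ - σ))‖ ≤
      ‖b‖ * ((6 + 3 * κ) / κ) * M := by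
    rw [norm_mul, mul_assoc]
    gcongr
    exact t5.trans (by gcongr)
  have b6 : ‖(ε : ℂ) * q / (2 * (2 - κ * ε))‖ ≤ |q| * M := by
    have : (2 * (2 - κ * ε) : ℂ) = ((2 * (2 - κ * ε) : ℝ) : ℂ) := by push_cast; ring
    rw [this, norm_div, norm_mul, h3, Complex.norm_real, Complex.norm_real,
      Real.norm_of_nonneg (by linarith : (0 : ℝ) ≤ 2 * (2 - κ * ε)), Real.norm_eq_abs,
      div_le_iff₀ (by linarith)]
    calc _ ≤ M * |q| * 1 := by rw [mul_one]; gcongr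
      _ ≤ M * |q| * (2 * (2 - κ * ε)) := by gcongr; linarith
      _ = _ := by ring
  have b7 : ‖(d : ℂ) / 2 * (Complex.log ((1 - (s * (1 - κ * ε)) ^ 2) / ε) -
      Complex.log (2 * (κ - σ)))‖ ≤
      d / 2 * ((min κ 1)⁻¹ * (2 * (3 + 3 * κ) + (4 + 4 * κ) ^ 2)) * M := by
    rw [norm_mul, norm_div, Complex.norm_natCast, Complex.norm_ofNat, mul_assoc]
    gcongr
    refine t7.trans ?_
    rw [← mul_assoc]
    gcongr
  have b8 : ‖Complex.log ((1 - s) / ε) - Complex.log (-σ)‖ ≤ 6 * M := t8.trans (by gcongr)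
  set T1 := ((2 - κ * ε) * (s - 1) / (1 + s * (1 - κ * ε)) - ε * σ) / ε ^ 3
  rw [show (T1 + ζ * (s - 1) / (1 + s * (1 - κ * ε)) / ε + ε * γ * s / (1 + s * (1 - κ * ε)) -
      ε * b * s / (1 - s * (1 - κ * ε)) - ε * q / (2 * (2 - κ * ε)) + ε * σ -
      (d : ℂ) / 2 * Complex.log ((1 - (s * (1 - κ * ε)) ^ 2) / ε) - Complex.log ((1 - s) / ε)) -
      (κ * σ ^ 2 / 4 - σ ^ 3 / 12 + ζ * σ / 2 - b / (κ - σ) -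
        (d : ℂ) / 2 * Complex.log (2 * (κ - σ)) - Complex.log (-σ)) =
      (T1 - (κ * σ ^ 2 / 4 - σ ^ 3 / 12)) +
      ζ * ((s - 1) / (1 + s * (1 - κ * ε)) / ε - σ / 2) + ε * γ * s / (1 + s * (1 - κ * ε)) -
      b * (ε * s / (1 - s * (1 - κ * ε)) - 1 / (κ - σ)) - ε * q / (2 * (2 - κ * ε)) + ε * σ -
      (d : ℂ) / 2 * (Complex.log ((1 - (s * (1 - κ * ε)) ^ 2) / ε) - Complex.log (2 * (κ - σ))) -
      (Complex.log ((1 - s) / ε) - Complex.log (-σ)) by ring]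
  refine (norm_sub_le _ _).trans ?_
  refine (add_le_add ((norm_sub_le _ _).trans (add_le_add ((norm_add_le _ _).trans (add_le_add
    ((norm_sub_le _ _).trans (add_le_add ((norm_sub_le _ _).trans (add_le_add
    ((norm_add_le _ _).trans (add_le_add ((norm_add_le _ _).trans (add_le_add t1 b2)) b3)) b5))
    b6)) (hh.trans hM1))) b7)) b8).trans (le_of_eq ?_)
  ring

/-! ### Gaussian bounds along the whole contour. -/

section circle

variable {r τ : ℝ} {s : ℂ}

theorem one_add_mul_ne_zero (hr1 : r ≤ 1) (hs : ‖s‖ = r) (hτ : 0 ≤ τ) (hτ1 : τ < 1) :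
    1 + s * τ ≠ 0 := fun h => by
  have h1 : ‖s * τ‖ = 1 := by rw [← neg_eq_of_add_eq_zero_right h]; simp
  rw [norm_mul, hs, Complex.norm_real, Real.norm_of_nonneg hτ] at h1
  nlinarith

/-- On the circle `|s - r|² = 2 r (r - Re s)`, so the real part is exactly a negative multiple of a
square. This is the source of decay far from `s = r`, where Taylor expansion is useless. -/
theorem re_sub_div_one_add (hr : 0 < r) (hr1 : r ≤ 1) (hs : ‖s‖ = r) (hτ : 0 ≤ τ)
    (hτ1 : τ < 1) :
    ((s - r) / (1 + s * τ)).re =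
      -((1 - r * τ) / (2 * r)) * (‖s - r‖ / ‖1 + s * τ‖) ^ 2 := by
  have h0 := one_add_mul_ne_zero hr1 hs hτ hτ1
  have h1 : Complex.normSq (1 + s * τ) ≠ 0 := by rwa [Ne, Complex.normSq_eq_zero]
  have h2 : s.re ^ 2 + s.im ^ 2 = r ^ 2 := by
    rw [← hs, ← Complex.normSq_eq_norm_sq, Complex.normSq_apply]; ring
  rw [Complex.div_re, div_pow, ← Complex.normSq_eq_norm_sq, ← Complex.normSq_eq_norm_sq]
  have h3 : Complex.normSq (s - r) = 2 * r * (r - s.re) := by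
    rw [Complex.normSq_apply]
    simp only [Complex.sub_re, Complex.ofReal_re, Complex.sub_im, Complex.ofReal_im]
    linear_combination h2
  rw [h3]
  simp only [Complex.sub_re, Complex.sub_im, Complex.add_re, Complex.add_im, Complex.one_re,
    Complex.one_im, Complex.re_mul_ofReal, Complex.im_mul_ofReal, Complex.ofReal_re,
    Complex.ofReal_im]
  field_simp
  linear_combination τ * h2

/-- The denominator may be small near `s = -1`, but then `‖s - r‖ / ‖1 + s τ‖` is just as large.
Lower-order terms thus grow at most linearly in this ratio, while the leading term decays
quadratically in it. -/
theorem inv_norm_one_add_le (hr : 0 < r) (hr1 : r ≤ 1) (hs : ‖s‖ = r) (hτ : 0 ≤ τ)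
    (hτ1 : τ < 1) : ‖1 + s * τ‖⁻¹ ≤ 1 + ‖s - r‖ / ‖1 + s * τ‖ := by
  have h0 := norm_pos_iff.2 (one_add_mul_ne_zero hr1 hs hτ hτ1)
  rw [inv_eq_one_div, div_le_iff₀ h0, add_mul, div_mul_cancel₀ _ h0.ne', one_mul]
  have e : ((1 + r * τ : ℝ) : ℂ) = (1 + s * τ) - (s - r) * τ := by push_cast; ring
  have h1 : ‖((1 + r * τ : ℝ) : ℂ)‖ = 1 + r * τ := by
    rw [Complex.norm_real, Real.norm_of_nonneg (by positivity)]
  have h2 : ‖(s - r) * (τ : ℂ)‖ ≤ ‖s - r‖ := by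
    rw [norm_mul, Complex.norm_real, Real.norm_of_nonneg hτ]
    exact mul_le_of_le_one_right (norm_nonneg _) hτ1.le
  have h3 := norm_sub_le (1 + s * τ) ((s - r) * (τ : ℂ))
  rw [← e, h1] at h3
  nlinarith [mul_nonneg hr.le hτ]

theorem norm_div_one_add_le (hr : 0 < r) (hr1 : r ≤ 1) (hs : ‖s‖ = r) (hτ : 0 ≤ τ)
    (hτ1 : τ < 1) : ‖s / (1 + s * τ)‖ ≤ 1 + ‖s - r‖ / ‖1 + s * τ‖ := by
  refine le_trans ?_ (inv_norm_one_add_le hr hr1 hs hτ hτ1)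
  rw [norm_div, div_eq_mul_inv, hs]
  exact mul_le_of_le_one_left (by positivity) hr1

/-- Separates the value at `s = r` from a positive multiple of the Möbius quotient whose real part
is known exactly. -/
theorem sub_one_div_one_add_eq (hr : 0 < r) (hr1 : r ≤ 1) (hs : ‖s‖ = r) (hτ : 0 ≤ τ)
    (hτ1 : τ < 1) :
    (s - 1) / (1 + s * τ) = (r - 1) / (1 + r * τ) +
      (((1 + τ) / (1 + r * τ) : ℝ) : ℂ) * ((s - r) / (1 + s * τ)) := by
  have h0 := one_add_mul_ne_zero hr1 hs hτ hτ1
  have h1 : (1 + r * τ : ℂ) ≠ 0 := by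
    have : (1 + r * τ : ℝ) ≠ 0 := by positivity
    exact_mod_cast this
  have key : (s - 1) * (1 + r * τ) = (r - 1) * (1 + s * τ) + (1 + τ) * (s - r) := by ring
  push_cast
  generalize 1 + s * (τ : ℂ) = a at *
  generalize 1 + (r : ℂ) * (τ : ℂ) = b at *
  field_simp
  linear_combination key

theorem norm_sub_one_div_one_add_le (hr : 0 < r) (hr1 : r ≤ 1) (hs : ‖s‖ = r) (hτ : 0 ≤ τ)
    (hτ1 : τ < 1) :
    ‖(s - 1) / (1 + s * τ)‖ ≤ (1 - r) + 2 * (‖s - r‖ / ‖1 + s * τ‖) := by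
  rw [sub_one_div_one_add_eq hr hr1 hs hτ hτ1]
  have h1 : ‖((r - 1) / (1 + r * τ) : ℂ)‖ ≤ 1 - r := by
    have : ((r - 1) / (1 + r * τ) : ℂ) = (((r - 1) / (1 + r * τ) : ℝ) : ℂ) := by push_cast; ring
    rw [this, Complex.norm_real, norm_div, Real.norm_of_nonpos (by linarith),
      Real.norm_of_nonneg (by positivity), neg_sub]
    exact div_le_self (by linarith) (by nlinarith)
  refine (norm_add_le _ _).trans (add_le_add h1 ?_)
  rw [norm_mul, Complex.norm_real, Real.norm_of_nonneg (by positivity), norm_div]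
  gcongr
  rw [div_le_iff₀ (by positivity)]
  nlinarith [mul_nonneg hr.le hτ]

end circle

/-- A chord has length `2 r |sin(θ / 2)|`; Jordan's inequality applies up to `|θ| = π`, and `2 / π`
is weakened to `1 / 2`. -/
theorem norm_sub_radius_ge {ε y : ℝ} (hε : 0 < ε) (hy : ε * |y| ≤ Real.pi) :
    Real.exp (-ε) * (ε * |y|) / 2 ≤
      ‖Complex.exp (ε * (-1 + y * Complex.I)) - (Real.exp (-ε) : ℝ)‖ := by
  have e : Complex.exp (ε * (-1 + y * Complex.I)) - (Real.exp (-ε) : ℝ) =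
      ((Real.exp (-ε) : ℝ) : ℂ) * (Complex.exp (Complex.I * ((ε * y : ℝ) : ℂ)) - 1) := by
    rw [mul_sub, mul_one, Complex.ofReal_exp, ← Complex.exp_add]
    congr 2
    push_cast; ring
  rw [e, norm_mul, Complex.norm_exp_I_mul_ofReal_sub_one, Complex.norm_real,
    Real.norm_of_nonneg (Real.exp_pos _).le, norm_mul, Real.norm_eq_abs, Real.norm_eq_abs,
    abs_two, mul_div_assoc]
  gcongr
  have hpi := Real.pi_pos
  have h1 : |ε * y / 2| = ε * |y| / 2 := by
    rw [abs_div, abs_mul, abs_of_pos hε, abs_two]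
  have h2 := Real.mul_abs_le_abs_sin (x := ε * y / 2) (by rw [h1]; linarith)
  rw [h1] at h2
  have h3 : 1 / 2 ≤ 2 / Real.pi := by
    rw [div_le_div_iff₀ (by norm_num) hpi]; linarith [Real.pi_le_four]
  have h4 : 0 ≤ ε * |y| := by positivity
  nlinarith

theorem re_neg_log_le {δ : ℝ} (hδ : 0 < δ) {z : ℂ} (hz : δ ≤ z.re) :
    (-Complex.log z).re ≤ -Real.log δ := by
  rw [Complex.neg_re, Complex.log_re]
  exact neg_le_neg (Real.log_le_log hδ (hz.trans (Complex.re_le_norm z)))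

/-- At `s = r` the value is bounded by the local expansion. The remaining part is a negative square
with coefficient at least `κ ε / 2` over `ε³`, because `1 - r τ ≥ 1 - τ = κ ε`. -/
theorem leading_phase_re_le {κ : ℝ} (hκ : 0 < κ) : ∃ A, ∀ ε y : ℝ, 0 < ε → ε ≤ 1 →
    κ * ε < 1 →
    (((2 - κ * ε) * (Complex.exp (ε * (-1 + y * Complex.I)) - 1) /
      (1 + Complex.exp (ε * (-1 + y * Complex.I)) * (1 - κ * ε)) -
        ε * (-1 + y * Complex.I)) / ε ^ 3).re ≤
      A - κ / 2 * (‖Complex.exp (ε * (-1 + y * Complex.I)) - (Real.exp (-ε) : ℝ)‖ /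
        ‖1 + Complex.exp (ε * (-1 + y * Complex.I)) * (1 - κ * ε)‖ / ε) ^ 2 := by
  obtain ⟨C, hC0, hC⟩ := leading_phase_sub_le κ hκ
  refine ⟨κ / 4 + 1 / 12 + C, fun ε y hε hε1 hκε => ?_⟩
  have hr := Real.exp_pos (-ε)
  have hr1 : Real.exp (-ε) ≤ 1 := Real.exp_le_one_iff.2 (by linarith)
  have hs := norm_exp_edge ε y
  -- The point `s = r` is `σ = -1`, for which `L = 1` suffices.
  have h0 := hC ε 1 (-1) hε le_rfl (by linarith) (by simp) (by
    simpa using one_le_norm_one_add (y := 0) hε (by simpa using hε1) hκε.le)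
  have hs0 : Complex.exp (ε * (-1)) = ((Real.exp (-ε) : ℝ) : ℂ) := by
    push_cast; congr 1; ring
  rw [hs0] at h0
  generalize Complex.exp (ε * (-1 + y * Complex.I)) = s at *
  generalize Real.exp (-ε) = r at *
  have hτc : (1 - κ * ε : ℂ) = ((1 - κ * ε : ℝ) : ℂ) := by push_cast; ring
  have hτ0 : 0 ≤ 1 - κ * ε := by linarith
  have hτ1 : 1 - κ * ε < 1 := by nlinarith
  have hεc : (ε : ℂ) ≠ 0 := by exact_mod_cast hε.ne'
  rw [hτc] at h0 ⊢
  set τ := 1 - κ * ε with hτ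
  have h2τ : (2 - κ * ε : ℂ) = ((1 + τ : ℝ) : ℂ) := by rw [hτ]; push_cast; ring
  rw [h2τ] at h0 ⊢
  have hre := re_sub_div_one_add hr hr1 hs hτ0 hτ1
  have e : (((1 + τ : ℝ) : ℂ) * (s - 1) / (1 + s * τ) - ε * (-1 + y * Complex.I)) / ε ^ 3 =
      (((1 + τ : ℝ) : ℂ) * (r - 1) / (1 + r * τ) - ε * (-1)) / ε ^ 3 +
      (((1 + τ) * ((1 + τ) / (1 + r * τ)) / ε ^ 3 : ℝ) : ℂ) * ((s - r) / (1 + s * τ)) -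
      ((y / ε ^ 2 : ℝ) : ℂ) * Complex.I := by
    rw [mul_div_assoc, sub_one_div_one_add_eq hr hr1 hs hτ0 hτ1, mul_div_assoc]
    generalize (1 + τ) / (1 + r * τ) = K
    generalize (s - r) / (1 + s * τ) = w
    generalize ((r : ℂ) - 1) / (1 + r * τ) = p
    push_cast
    field_simp
    ring
  rw [e, Complex.sub_re, Complex.add_re, Complex.re_ofReal_mul, Complex.re_ofReal_mul, hre,
    Complex.I_re, mul_zero, sub_zero]
  have h5 : ((((1 + τ : ℝ) : ℂ) * (r - 1) / (1 + r * τ) - ε * (-1)) / ε ^ 3 : ℂ).re ≤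
      κ / 4 + 1 / 12 + C := by
    have h6 := (Complex.re_le_norm _).trans h0
    rw [Complex.sub_re] at h6
    have h7 : ((κ : ℂ) * (-1) ^ 2 / 4 - (-1) ^ 3 / 12).re = κ / 4 + 1 / 12 := by
      have : ((κ : ℂ) * (-1) ^ 2 / 4 - (-1) ^ 3 / 12) = ((κ / 4 + 1 / 12 : ℝ) : ℂ) := by
        push_cast; ring
      rw [this, Complex.ofReal_re]
    rw [h7] at h6
    have : C * (ε * 1 ^ 4) ≤ C := by nlinarith
    linarith
  generalize ‖s - r‖ / ‖1 + s * τ‖ = D at *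
  have h8 : κ / 2 * (D / ε) ^ 2 ≤
      (1 + τ) * ((1 + τ) / (1 + r * τ)) / ε ^ 3 * ((1 - r * τ) / (2 * r) * D ^ 2) := by
    have hK : 1 ≤ (1 + τ) * ((1 + τ) / (1 + r * τ)) := by
      have : 1 ≤ (1 + τ) / (1 + r * τ) := by
        rw [one_le_div (by positivity)]; nlinarith
      nlinarith
    have hM : κ * ε / 2 ≤ (1 - r * τ) / (2 * r) := by
      rw [div_le_div_iff₀ (by norm_num) (by positivity)]
      have h9 : r * τ ≤ τ := mul_le_of_le_one_left hτ0 hr1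
      have h10 : κ * ε ≤ 1 - r * τ := by linarith
      have h11 : κ * ε * r ≤ κ * ε := mul_le_of_le_one_right (by positivity) hr1
      nlinarith
    calc κ / 2 * (D / ε) ^ 2 = 1 / ε ^ 3 * (κ * ε / 2 * D ^ 2) := by field_simp
      _ ≤ _ := by gcongr
  linarith

set_option maxHeartbeats 1000000 in
-- All terms are measured in `Y = ‖s - r‖ / (‖1 + s τ‖ ε)`. Half of the quadratic decay absorbs the
-- linear terms, and `Y ≥ |y| / 8` turns the other half into a Gaussian in `y`.
theorem exists_re_edgePhase_le (d : ℕ) {κ : ℝ} (hκ : 0 < κ) (q : ℝ) (ζ γ b : ℂ) :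
    ∃ A a : ℝ, 0 < a ∧ ∀ ε y : ℝ, 0 < ε → ε ≤ 1 / 2 → κ * ε < 1 → ε * |y| ≤ Real.pi →
      (edgePhase d κ q ζ γ b ε (-1 + y * Complex.I)).re ≤ A - a * y ^ 2 := by
  obtain ⟨A, hA⟩ := leading_phase_re_le hκ
  -- The total coefficient of `Y` in the bounds for the `ζ`- and `γ`-terms.
  set B := 2 * ‖ζ‖ + ‖γ‖ with hB
  refine ⟨A + B ^ 2 / κ + ‖ζ‖ + ‖γ‖ + ‖b‖ / κ + |q| - d / 2 * Real.log κ - Real.log (1 / 2),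
    κ / 4 * (1 / 8) ^ 2, by positivity, fun ε y hε hε1 hκε hy => ?_⟩
  have h1 := hA ε y hε (by linarith) hκε
  have hr := Real.exp_pos (-ε)
  have hr1 : Real.exp (-ε) ≤ 1 := Real.exp_le_one_iff.2 (by linarith)
  have hrε : 1 - ε ≤ Real.exp (-ε) := by linarith [Real.add_one_le_exp (-ε)]
  have hs := norm_exp_edge ε y
  have hg := norm_sub_radius_ge hε hy
  have hσ : (ε * (-1 + y * Complex.I) : ℂ).re ≤ 0 := by simp [hε.le]
  have h8 := re_neg_log_le (by norm_num) (re_one_sub_ge hε (by linarith) hs)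
  unfold edgePhase
  generalize Complex.exp (ε * (-1 + y * Complex.I)) = s at *
  generalize Real.exp (-ε) = r at *
  have hs1 : ‖s‖ ≤ 1 := hs.trans_le hr1
  have h7 := re_neg_log_le hκ (re_one_sub_sq_ge hε hκ hκε.le hs1)
  have hm := norm_one_sub_mul_ge hs1 hκε.le
  have hτc : (1 - κ * ε : ℂ) = ((1 - κ * ε : ℝ) : ℂ) := by push_cast; ring
  have hτ0 : 0 ≤ 1 - κ * ε := by linarith
  have hτ1 : 1 - κ * ε < 1 := by nlinarith
  have h3 : ‖(ε : ℂ)‖ = ε := by rw [Complex.norm_real, Real.norm_of_nonneg hε.le]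
  have hp := norm_pos_iff.2 (one_add_mul_ne_zero hr1 hs hτ0 hτ1)
  have h2 := norm_sub_one_div_one_add_le hr hr1 hs hτ0 hτ1
  have h4 := norm_div_one_add_le hr hr1 hs hτ0 hτ1
  -- Three factors `1 / 2`: the chord bound, `r ≥ 1 / 2` from `ε ≤ 1 / 2`, and `‖1 + s τ‖ ≤ 2`.
  have hY : |y| / 8 ≤ ‖s - r‖ / ‖1 + s * ((1 - κ * ε : ℝ) : ℂ)‖ / ε := by
    rw [le_div_iff₀ hε, le_div_iff₀ hp]
    have h5 : ‖1 + s * ((1 - κ * ε : ℝ) : ℂ)‖ ≤ 2 := by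
      refine (norm_add_le _ _).trans ?_
      rw [norm_one, norm_mul, Complex.norm_real, Real.norm_of_nonneg hτ0]
      nlinarith [norm_nonneg s]
    have h6 : 1 / 2 * (ε * |y|) / 2 ≤ ‖s - r‖ := by
      refine le_trans ?_ hg
      gcongr
      linarith
    calc |y| / 8 * ε * _ ≤ |y| / 8 * ε * 2 := by gcongr
      _ = 1 / 2 * (ε * |y|) / 2 := by ring
      _ ≤ _ := h6
  rw [← hτc] at *
  set D := ‖s - r‖ / ‖1 + s * (1 - κ * ε)‖ with hD
  set Y := D / ε with hYd
  have hDY : D = ε * Y := by rw [hYd]; field_simp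
  have hY0 : 0 ≤ Y := le_trans (by positivity) hY
  have b2 : (ζ * (s - 1) / (1 + s * (1 - κ * ε)) / ε).re ≤ ‖ζ‖ * (1 + 2 * Y) := by
    refine (Complex.re_le_norm _).trans ?_
    rw [mul_div_assoc, mul_div_assoc, norm_mul, norm_div, h3]
    gcongr
    rw [div_le_iff₀ hε]
    refine h2.trans ?_
    rw [hDY]
    linarith
  have b3 : (ε * γ * s / (1 + s * (1 - κ * ε))).re ≤ ‖γ‖ * (1 + Y) := by
    refine (Complex.re_le_norm _).trans ?_
    rw [mul_div_assoc, norm_mul, norm_mul, h3]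
    calc _ ≤ ε * ‖γ‖ * (1 + D) := by gcongr
      _ = ‖γ‖ * (ε + ε * ε * Y) := by rw [hDY]; ring
      _ ≤ ‖γ‖ * (1 + Y) := by
        have : ε * ε * Y ≤ 1 * Y := by gcongr; nlinarith
        gcongr
        · linarith
        · linarith
  have b5 : (-(ε * b * s / (1 - s * (1 - κ * ε)))).re ≤ ‖b‖ / κ := by
    refine (Complex.re_le_norm _).trans ?_
    rw [norm_neg, norm_div, norm_mul, norm_mul, h3, div_le_div_iff₀
      (lt_of_lt_of_le (by positivity) hm) hκ]
    calc ε * ‖b‖ * ‖s‖ * κ ≤ ε * ‖b‖ * 1 * κ := by gcongr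
      _ = ‖b‖ * (κ * ε) := by ring
      _ ≤ _ := by gcongr
  have b6 : (-((ε : ℂ) * q / (2 * (2 - κ * ε)))).re ≤ |q| := by
    have : -((ε : ℂ) * q / (2 * (2 - κ * ε))) = ((-(ε * q / (2 * (2 - κ * ε))) : ℝ) : ℂ) := by
      push_cast; ring
    rw [this, Complex.ofReal_re]
    refine (neg_le_abs _).trans ?_
    rw [abs_div, abs_mul, abs_of_pos hε, abs_of_pos (by linarith : 0 < 2 * (2 - κ * ε)),
      div_le_iff₀ (by linarith)]
    nlinarith [abs_nonneg q]
  have b7 : (-((d : ℂ) / 2 * Complex.log ((1 - (s * (1 - κ * ε)) ^ 2) / ε))).re ≤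
      -(d / 2 * Real.log κ) := by
    have : -((d : ℂ) / 2 * Complex.log ((1 - (s * (1 - κ * ε)) ^ 2) / ε)) =
        (((d : ℝ) / 2 : ℝ) : ℂ) * -Complex.log ((1 - (s * (1 - κ * ε)) ^ 2) / ε) := by
      push_cast; ring
    rw [this, Complex.re_ofReal_mul, ← mul_neg]
    gcongr
  have hquad : B * Y - κ / 2 * Y ^ 2 ≤ B ^ 2 / κ - κ / 4 * (1 / 8) ^ 2 * y ^ 2 := by
    have h9 : (|y| / 8) ^ 2 ≤ Y ^ 2 := by gcongr
    have h10 : B * Y ≤ B ^ 2 / κ + κ / 4 * Y ^ 2 := by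
      have : B ^ 2 / κ + κ / 4 * Y ^ 2 - B * Y = (B - κ / 2 * Y) ^ 2 / κ := by
        field_simp; ring
      have h11 : 0 ≤ (B - κ / 2 * Y) ^ 2 / κ := by positivity
      linarith
    rw [div_pow, sq_abs] at h9
    have h12 : κ / 4 * (1 / 8) ^ 2 * y ^ 2 ≤ κ / 4 * Y ^ 2 := by
      calc _ = κ / 4 * (y ^ 2 / 8 ^ 2) := by ring
        _ ≤ _ := by gcongr
    linarith
  simp only [Complex.sub_re, Complex.add_re, Complex.neg_re] at *
  have hBY : ‖ζ‖ * (1 + 2 * Y) + ‖γ‖ * (1 + Y) = ‖ζ‖ + ‖γ‖ + B * Y := by rw [hB]; ring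
  linarith

/-- The cubic term supplies `-y² / 4` on the line `Re σ = -1`; half of it pays for the linear
`ζ`-term. Both logarithms have arguments of real part at least one, hence contribute nothing
positive. -/
theorem exists_re_limitPhase_le (d : ℕ) {κ : ℝ} (hκ : 0 < κ) (ζ b : ℂ) :
    ∃ A a : ℝ, 0 < a ∧ ∀ y : ℝ,
      (limitPhase d κ ζ b (-1 + y * Complex.I)).re ≤ A - a * y ^ 2 := by
  refine ⟨κ / 4 + 1 / 12 + ‖ζ‖ / 2 + ‖ζ‖ ^ 2 / 2 + ‖b‖, 1 / 8, by norm_num, fun y => ?_⟩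
  have hσ : (-1 + y * Complex.I : ℂ).re = -1 := by simp
  have hσL := norm_edge_sigma_le y
  have h1 : (κ * (-1 + y * Complex.I : ℂ) ^ 2 / 4 - (-1 + y * Complex.I) ^ 3 / 12).re =
      κ / 4 + 1 / 12 - y ^ 2 / 4 - κ * y ^ 2 / 4 := by
    have : (κ * (-1 + y * Complex.I : ℂ) ^ 2 / 4 - (-1 + y * Complex.I) ^ 3 / 12) =
        ((κ / 4 + 1 / 12 - y ^ 2 / 4 - κ * y ^ 2 / 4 : ℝ) : ℂ) +
          ((-κ * y / 2 - y / 4 + y ^ 3 / 12 : ℝ) : ℂ) * Complex.I := by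
      push_cast
      linear_combination (κ * y ^ 2 / 4 - (y ^ 3 * Complex.I - 3 * y ^ 2) / 12 : ℂ) * Complex.I_sq
    rw [this]
    simp only [Complex.add_re, Complex.ofReal_re, Complex.re_ofReal_mul, Complex.I_re, mul_zero,
      add_zero]
  have h7 := re_neg_log_le one_pos (z := 2 * (κ - (-1 + y * Complex.I)))
    (by simp; linarith)
  have h8 := re_neg_log_le one_pos (z := -(-1 + y * Complex.I)) (by simp)
  unfold limitPhase
  generalize (-1 + y * Complex.I : ℂ) = σ at *
  have h2 : (ζ * σ / 2).re ≤ ‖ζ‖ / 2 + ‖ζ‖ ^ 2 / 2 + y ^ 2 / 8 := by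
    refine (Complex.re_le_norm _).trans ?_
    rw [norm_div, norm_mul, Complex.norm_ofNat]
    have h3 : ‖ζ‖ * ‖σ‖ ≤ ‖ζ‖ * (1 + |y|) := by gcongr
    have h4 : ‖ζ‖ * |y| ≤ ‖ζ‖ ^ 2 + y ^ 2 / 4 := by
      rw [← sq_abs y]; nlinarith [sq_nonneg (‖ζ‖ - |y| / 2)]
    linarith
  have h5 : (-(b / (κ - σ))).re ≤ ‖b‖ := by
    refine (Complex.re_le_norm _).trans ?_
    rw [norm_neg, norm_div]
    refine div_le_self (norm_nonneg _) ?_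
    refine le_trans ?_ (Complex.re_le_norm _)
    rw [Complex.sub_re, hσ, Complex.ofReal_re]
    linarith
  have h6 : (-((d : ℂ) / 2 * Complex.log (2 * (κ - σ)))).re ≤ 0 := by
    have : -((d : ℂ) / 2 * Complex.log (2 * (κ - σ))) =
        (((d : ℝ) / 2 : ℝ) : ℂ) * -Complex.log (2 * (κ - σ)) := by
      push_cast; ring
    rw [this, Complex.re_ofReal_mul]
    rw [Real.log_one, neg_zero] at h7
    exact mul_nonpos_of_nonneg_of_nonpos (by positivity) h7
  rw [Real.log_one, neg_zero] at h8
  simp only [Complex.sub_re, Complex.add_re, Complex.neg_re] at *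
  have : 0 ≤ κ * y ^ 2 := by positivity
  linarith

/-! ### Comparison of the two contour integrals. -/

theorem norm_exp_sub_exp_le {u v : ℂ} {M : ℝ} (hu : u.re ≤ M) (hv : v.re ≤ M) :
    ‖Complex.exp u - Complex.exp v‖ ≤ Real.exp M * ‖u - v‖ := by
  refine Convex.norm_image_sub_le_of_norm_hasDerivWithin_le (s := {z : ℂ | z.re ≤ M})
    (f := Complex.exp) (f' := Complex.exp) (fun x _ => (Complex.hasDerivAt_exp x).hasDerivWithinAt)
    (fun x hx => ?_) (convex_halfSpace_re_le M) hv hu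
  rw [Complex.norm_exp]
  exact Real.exp_le_exp.2 hx

theorem measurable_edgePhase (d : ℕ) (κ q : ℝ) (ζ γ b : ℂ) (ε : ℝ) :
    Measurable fun y : ℝ => Complex.exp (edgePhase d κ q ζ γ b ε (-1 + y * Complex.I)) := by
  unfold edgePhase
  fun_prop

theorem measurable_limitPhase (d : ℕ) (κ : ℝ) (ζ b : ℂ) :
    Measurable fun y : ℝ => Complex.exp (limitPhase d κ ζ b (-1 + y * Complex.I)) := by
  unfold limitPhase
  fun_prop

theorem integrable_pow_four_mul_exp (A : ℝ) {a : ℝ} (ha : 0 < a) :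
    Integrable fun y : ℝ => (1 + |y|) ^ 4 * Real.exp (A - a * y ^ 2) := by
  refine ((integrable_of_norm_le_exp_neg_sq (A := 1 + A) (b := a) (c := 1)
    (f := fun y : ℝ => ((Nat.factorial 4 : ℕ) : ℝ)⁻¹ * ((1 + |y|) ^ 4 * Real.exp (A - a * y ^ 2)))
    (Continuous.aestronglyMeasurable (by fun_prop)) ha fun y => ?_).const_mul
      ((Nat.factorial 4 : ℕ) : ℝ)).congr (Eventually.of_forall fun y => ?_)
  · rw [Real.norm_of_nonneg (by positivity), inv_mul_le_iff₀ (by positivity)]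
    calc _ ≤ ((Nat.factorial 4 : ℕ) * Real.exp (1 + |y|)) * Real.exp (A - a * y ^ 2) := by
          gcongr
          exact pow_le_factorial_mul_exp (by positivity) 4
      _ = _ := by rw [mul_assoc, ← Real.exp_add]; congr 2; ring
  · have : ((Nat.factorial 4 : ℕ) : ℝ) ≠ 0 := by positivity
    simp only
    rw [mul_inv_cancel_left₀ this]

theorem integral_edgePhase_sub_le (d : ℕ) {κ : ℝ} (hκ : 0 < κ) (q : ℝ) (ζ γ b : ℂ) :
    ∃ C : ℝ, ∀ ε : ℝ, 0 < ε → ε ≤ 1 / 2 → κ * ε < 1 →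
      ‖(∫ y in -(Real.pi / ε)..Real.pi / ε,
          Complex.exp (edgePhase d κ q ζ γ b ε (-1 + y * Complex.I))) -
        ∫ y : ℝ, Complex.exp (limitPhase d κ ζ b (-1 + y * Complex.I))‖ ≤ C * ε := by
  obtain ⟨A₁, a₁, ha₁, h₁⟩ := exists_re_edgePhase_le d hκ q ζ γ b
  obtain ⟨A₂, a₂, ha₂, h₂⟩ := exists_re_limitPhase_le d hκ ζ b
  obtain ⟨C, hC0, hC⟩ := edgePhase_sub_limitPhase_le d hκ q ζ γ b
  set A := max A₁ A₂
  set a := min a₁ a₂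
  have ha : 0 < a := lt_min ha₁ ha₂
  have hle₁ : ∀ y : ℝ, A₁ - a₁ * y ^ 2 ≤ A - a * y ^ 2 := fun y => by
    have h1 : A₁ ≤ A := le_max_left _ _
    have h2 : a * y ^ 2 ≤ a₁ * y ^ 2 := by gcongr; exact min_le_left _ _
    linarith
  have hle₂ : ∀ y : ℝ, A₂ - a₂ * y ^ 2 ≤ A - a * y ^ 2 := fun y => by
    have h1 : A₂ ≤ A := le_max_right _ _
    have h2 : a * y ^ 2 ≤ a₂ * y ^ 2 := by gcongr; exact min_le_right _ _
    linarith
  have hint := integrable_pow_four_mul_exp A ha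
  -- `C` comes from the region where the phases are compared, `2` from bounding both integrands
  -- separately elsewhere.
  refine ⟨(C + 2) * ∫ y : ℝ, (1 + |y|) ^ 4 * Real.exp (A - a * y ^ 2),
    fun ε hε hε1 hκε => ?_⟩
  have hpi := Real.pi_pos
  have hI : -(Real.pi / ε) ≤ Real.pi / ε := by
    have : 0 < Real.pi / ε := by positivity
    linarith
  rw [intervalIntegral.integral_of_le hI, ← integral_indicator measurableSet_Ioc]
  set I := Set.Ioc (-(Real.pi / ε)) (Real.pi / ε) with hIdef
  set G := fun y : ℝ => Complex.exp (edgePhase d κ q ζ γ b ε (-1 + y * Complex.I)) with hG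
  set H := fun y : ℝ => Complex.exp (limitPhase d κ ζ b (-1 + y * Complex.I)) with hH
  have hone : ∀ y : ℝ, Real.exp (A - a * y ^ 2) ≤ (1 + |y|) ^ 4 * Real.exp (A - a * y ^ 2) :=
    fun y => le_mul_of_one_le_left (Real.exp_pos _).le
      (one_le_pow₀ (by linarith [abs_nonneg y]))
  have hGre : ∀ y ∈ I, (edgePhase d κ q ζ γ b ε (-1 + y * Complex.I)).re ≤ A - a * y ^ 2 := by
    intro y hy
    refine (h₁ ε y hε hε1 hκε ?_).trans (hle₁ y)
    have : |y| ≤ Real.pi / ε := abs_le.2 ⟨hy.1.le, hy.2⟩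
    calc ε * |y| ≤ ε * (Real.pi / ε) := by gcongr
      _ = Real.pi := by field_simp
  have hHre : ∀ y : ℝ, (limitPhase d κ ζ b (-1 + y * Complex.I)).re ≤ A - a * y ^ 2 :=
    fun y => (h₂ y).trans (hle₂ y)
  have hGn : ∀ y, ‖I.indicator G y‖ ≤ Real.exp (A - a * y ^ 2) := by
    intro y
    by_cases hy : y ∈ I
    · rw [Set.indicator_of_mem hy, hG, Complex.norm_exp]
      exact Real.exp_le_exp.2 (hGre y hy)
    · rw [Set.indicator_of_notMem hy, norm_zero]
      exact (Real.exp_pos _).le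
  have hHn : ∀ y, ‖H y‖ ≤ Real.exp (A - a * y ^ 2) := by
    intro y
    rw [hH, Complex.norm_exp]
    exact Real.exp_le_exp.2 (hHre y)
  have hGi : Integrable (I.indicator G) := hint.mono'
    ((measurable_edgePhase d κ q ζ γ b ε).indicator measurableSet_Ioc).aestronglyMeasurable
    (Eventually.of_forall fun y => (hGn y).trans (hone y))
  have hHi : Integrable H := hint.mono' (measurable_limitPhase d κ ζ b).aestronglyMeasurable
    (Eventually.of_forall fun y => (hHn y).trans (hone y))
  rw [← integral_sub hGi hHi, mul_assoc, mul_comm _ ε, ← mul_assoc, ← integral_const_mul]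
  refine norm_integral_le_of_norm_le (hint.const_mul _) (Eventually.of_forall fun y => ?_)
  have hL : 1 ≤ 1 + |y| := by linarith [abs_nonneg y]
  by_cases hy : ε * (1 + |y|) ≤ 1
  · have hyI : y ∈ I := by
      have h3 : |y| < Real.pi / ε := by
        rw [lt_div_iff₀ hε]
        nlinarith [Real.pi_gt_three]
      exact ⟨(abs_lt.1 h3).1, (abs_lt.1 h3).2.le⟩
    rw [Set.indicator_of_mem hyI]
    calc _ ≤ Real.exp (A - a * y ^ 2) * _ := norm_exp_sub_exp_le (hGre y hyI) (hHre y)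
      _ ≤ Real.exp (A - a * y ^ 2) * (C * (ε * (1 + |y|) ^ 4)) := by
          gcongr
          exact hC ε y hε hκε.le hy
      _ = C * ε * ((1 + |y|) ^ 4 * Real.exp (A - a * y ^ 2)) := by ring
      _ ≤ (C + 2) * ε * ((1 + |y|) ^ 4 * Real.exp (A - a * y ^ 2)) := by gcongr; linarith
  -- Outside the comparison region the factor `ε (1 + |y|)⁴` already exceeds one, so the Gaussian
  -- bounds alone give the required rate.
  · have h3 : 1 ≤ ε * (1 + |y|) ^ 4 := by
      have : (1 + |y|) ≤ (1 + |y|) ^ 4 := le_self_pow₀ hL (by norm_num)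
      nlinarith
    calc _ ≤ Real.exp (A - a * y ^ 2) + Real.exp (A - a * y ^ 2) :=
          (norm_sub_le _ _).trans (add_le_add (hGn y) (hHn y))
      _ = 2 * 1 * Real.exp (A - a * y ^ 2) := by ring
      _ ≤ (C + 2) * (ε * (1 + |y|) ^ 4) * Real.exp (A - a * y ^ 2) := by gcongr; linarith
      _ = _ := by ring

/-! ### Contour integrals for the Airy function. -/

/-- The integrand of the Airy function. -/
noncomputable def airyIntegrand (z t : ℂ) : ℂ := Complex.exp (-z * t + t ^ 3 / 3)

theorem norm_airyIntegrand (z : ℂ) (x y : ℝ) :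
    ‖airyIntegrand z (x + y * Complex.I)‖ =
      Real.exp (-z.re * x + z.im * y + x ^ 3 / 3 - x * y ^ 2) := by
  rw [airyIntegrand, Complex.norm_exp]
  congr 1
  have : -z * (x + y * Complex.I) + (x + y * Complex.I) ^ 3 / 3 =
      ((-z.re * x + z.im * y + x ^ 3 / 3 - x * y ^ 2 : ℝ) : ℂ) +
        ((-z.re * y - z.im * x + x ^ 2 * y - y ^ 3 / 3 : ℝ) : ℂ) * Complex.I := by
    conv_lhs => rw [← Complex.re_add_im z]
    push_cast
    linear_combination (-z.im * y + x * y ^ 2 + y ^ 3 / 3 * Complex.I : ℂ) * Complex.I_sq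
  rw [this]
  simp only [Complex.add_re, Complex.ofReal_re, Complex.re_ofReal_mul, Complex.I_re, mul_zero,
    add_zero]

theorem differentiable_airyIntegrand (z : ℂ) : Differentiable ℂ (airyIntegrand z) := by
  unfold airyIntegrand
  fun_prop

theorem integrable_airyIntegrand (z : ℂ) {c : ℝ} (hc : 0 < c) :
    Integrable fun y : ℝ => airyIntegrand z (c + y * Complex.I) := by
  refine integrable_of_norm_le_exp_neg_sq (A := -z.re * c + c ^ 3 / 3) (b := c) (c := |z.im|)
    (((differentiable_airyIntegrand z).continuous.comp (by fun_prop)).aestronglyMeasurable) hc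
    fun y => ?_
  rw [norm_airyIntegrand]
  refine Real.exp_le_exp.2 ?_
  have : z.im * y ≤ |z.im| * |y| := by rw [← abs_mul]; exact le_abs_self _
  linarith

theorem tendsto_exp_add_mul_sub_sq (K b : ℝ) {m : ℝ} (hm : 0 < m) :
    Tendsto (fun T : ℝ => Real.exp (K + b * T - m * T ^ 2)) atTop (nhds 0) := by
  refine Real.tendsto_exp_atBot.comp ?_
  have h1 : Tendsto (fun T : ℝ => b - m * T) atTop atBot :=
    tendsto_atBot_add_const_left _ _ (tendsto_neg_atTop_atBot.comp (tendsto_id.const_mul_atTop hm))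
  have h2 := tendsto_atBot_add_const_left _ K (tendsto_id.atTop_mul_atBot₀ h1)
  refine h2.congr fun T => ?_
  simp only [id]
  ring

theorem norm_integral_horizontal_le (z : ℂ) {c₁ c₂ : ℝ} (h₁ : 0 < c₁) (h₂ : 0 < c₂) (T : ℝ) :
    ‖∫ x in c₁..c₂, airyIntegrand z (x + (T : ℂ) * Complex.I)‖ ≤
      Real.exp ((|z.re| * max c₁ c₂ + max c₁ c₂ ^ 3 / 3) + |z.im| * |T| - min c₁ c₂ * |T| ^ 2) *
        |c₂ - c₁| := by
  refine intervalIntegral.norm_integral_le_of_norm_le_const fun x hx => ?_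
  have hx1 : min c₁ c₂ < x := hx.1
  have hx2 : x ≤ max c₁ c₂ := hx.2
  have hx0 : 0 < x := (lt_min h₁ h₂).trans hx1
  rw [norm_airyIntegrand]
  refine Real.exp_le_exp.2 ?_
  have h3 : z.im * T ≤ |z.im| * |T| := by rw [← abs_mul]; exact le_abs_self _
  have h4 : -z.re * x ≤ |z.re| * max c₁ c₂ :=
    mul_le_mul (neg_le_abs _) hx2 hx0.le (abs_nonneg _)
  have h5 : x ^ 3 / 3 ≤ max c₁ c₂ ^ 3 / 3 := by gcongr
  have h6 : min c₁ c₂ * |T| ^ 2 ≤ x * T ^ 2 := by rw [sq_abs]; gcongr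
  linarith

/-- The vertical contour of the Airy integral can be moved within the right half-plane. -/
theorem integral_airyIntegrand_eq (z : ℂ) {c₁ c₂ : ℝ} (h₁ : 0 < c₁) (h₂ : 0 < c₂) :
    ∫ y : ℝ, airyIntegrand z (c₁ + y * Complex.I) =
      ∫ y : ℝ, airyIntegrand z (c₂ + y * Complex.I) := by
  set B := fun T : ℝ => Real.exp ((|z.re| * max c₁ c₂ + max c₁ c₂ ^ 3 / 3) + |z.im| * T -
    min c₁ c₂ * T ^ 2) * |c₂ - c₁| with hB
  have hB0 : Tendsto B atTop (nhds 0) := by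
    simpa using (tendsto_exp_add_mul_sub_sq (|z.re| * max c₁ c₂ + max c₁ c₂ ^ 3 / 3) |z.im|
      (lt_min h₁ h₂)).mul_const |c₂ - c₁|
  have hlim : ∀ e : ℝ, |e| = 1 → Tendsto (fun T : ℝ => ∫ x in c₁..c₂,
      airyIntegrand z (x + ((e * T : ℝ) : ℂ) * Complex.I)) atTop (nhds 0) := by
    intro e he
    refine squeeze_zero_norm' ?_ hB0
    filter_upwards [eventually_ge_atTop (0 : ℝ)] with T hT
    refine (norm_integral_horizontal_le z h₁ h₂ (e * T)).trans (le_of_eq ?_)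
    rw [abs_mul, he, one_mul, abs_of_nonneg hT]
  have hv : ∀ c : ℝ, 0 < c → Tendsto (fun T : ℝ => ∫ y in -T..T,
      airyIntegrand z (c + y * Complex.I)) atTop
      (nhds (∫ y : ℝ, airyIntegrand z (c + y * Complex.I))) := fun c hc =>
    intervalIntegral_tendsto_integral (integrable_airyIntegrand z hc) tendsto_neg_atTop_atBot
      tendsto_id
  have hrect : ∀ T : ℝ, (∫ x in c₁..c₂, airyIntegrand z (x + ((-1 * T : ℝ) : ℂ) * Complex.I)) -
      (∫ x in c₁..c₂, airyIntegrand z (x + ((1 * T : ℝ) : ℂ) * Complex.I)) +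
      Complex.I * (∫ y in -T..T, airyIntegrand z (c₂ + y * Complex.I)) -
      Complex.I * (∫ y in -T..T, airyIntegrand z (c₁ + y * Complex.I)) = 0 := by
    intro T
    have := Complex.integral_boundary_rect_eq_zero_of_differentiableOn (airyIntegrand z)
      (c₁ + ((-1 * T : ℝ) : ℂ) * Complex.I) (c₂ + ((1 * T : ℝ) : ℂ) * Complex.I)
      (differentiable_airyIntegrand z).differentiableOn
    simpa using this
  have hsum := (((hlim (-1) (by simp)).sub (hlim 1 (by simp))).add
    ((hv c₂ h₂).const_mul Complex.I)).sub ((hv c₁ h₁).const_mul Complex.I)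
  have h0 := tendsto_nhds_unique (hsum.congr hrect) tendsto_const_nhds
  have hI := Complex.I_ne_zero
  apply mul_left_cancel₀ hI
  linear_combination -h0

theorem airyAi_eq_integral (z : ℂ) {c : ℝ} (hc : 0 < c) :
    airyAi z = (1 / (2 * Real.pi) : ℂ) * ∫ y : ℝ, airyIntegrand z (c + y * Complex.I) := by
  rw [← integral_airyIntegrand_eq z one_pos hc, airyAi]
  congr 1
  refine integral_congr_ae (Eventually.of_forall fun y => ?_)
  simp only [airyIntegrand, Complex.ofReal_one, mul_comm Complex.I]

/-- The contour is moved to `t = α (κ - σ)` with `σ = -1 + i y`, so that the Airy integral uses the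
same variable as the kernel. Here `Re t = α (κ + 1) > 0`, and the reversed orientation is absorbed
by the absolute value of the Jacobian. -/
theorem airyAi_eq_integral_rescaled (z : ℂ) {κ α : ℝ} (hκ : 0 < κ) (hα : 0 < α) :
    airyAi z = (α / (2 * Real.pi) : ℂ) *
      ∫ y : ℝ, airyIntegrand z (α * (κ - (-1 + y * Complex.I))) := by
  have h := Measure.integral_comp_mul_left
    (fun y : ℝ => airyIntegrand z ((α * (κ + 1) : ℝ) + y * Complex.I)) (-α)
  have e : ∀ y : ℝ, airyIntegrand z ((α * (κ + 1) : ℝ) + ((-α * y : ℝ) : ℂ) * Complex.I) =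
      airyIntegrand z (α * (κ - (-1 + y * Complex.I))) := by
    intro y
    congr 1
    push_cast
    ring
  simp_rw [e] at h
  have hαc : (α : ℂ) ≠ 0 := by exact_mod_cast hα.ne'
  rw [h, airyAi_eq_integral z (c := α * (κ + 1)) (by positivity), inv_neg, abs_neg,
    abs_of_pos (inv_pos.2 hα), Complex.real_smul,
    Complex.ofReal_inv, ← mul_assoc]
  congr 1
  field_simp

/-! ### Separation of variables in the limiting kernel. -/

theorem two_rpow_cube : ((2 : ℝ) ^ (-(2 / 3) : ℝ)) ^ 3 = 1 / 4 := by
  rw [← Real.rpow_natCast, ← Real.rpow_mul (by norm_num)]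
  norm_num

theorem two_rpow_mul : (2 : ℝ) ^ (2 / 3 : ℝ) * (2 : ℝ) ^ (-(2 / 3) : ℝ) = 1 := by
  rw [← Real.rpow_add (by norm_num)]; norm_num

theorem two_rpow_sq : (2 : ℝ) ^ (-(4 / 3) : ℝ) = ((2 : ℝ) ^ (-(2 / 3) : ℝ)) ^ 2 := by
  rw [← Real.rpow_natCast, ← Real.rpow_mul (by norm_num)]; norm_num

/-- The Gaussian plane wave that is left of the Airy integrand after separating variables. -/
noncomputable def gaussianWave (β : EuclideanSpace ℂ (Fin d)) (w : ℂ)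
    (Q : EuclideanSpace ℝ (Fin d)) : ℂ :=
  Complex.exp (-w * ((‖Q‖ ^ 2 : ℝ) : ℂ) + -Complex.I * dot (ofRealVec Q) β)

theorem gaussianWave_toLp (β : EuclideanSpace ℂ (Fin d)) (w : ℂ) (v : Fin d → ℝ) :
    gaussianWave β w (WithLp.toLp 2 v) =
      Complex.exp (-w * ∑ i, (v i : ℂ) ^ 2 + ∑ i, (-Complex.I * β i) * v i) := by
  rw [gaussianWave, EuclideanSpace.norm_sq_eq, dot, Finset.mul_sum]
  congr 2
  · simp
  · exact Finset.sum_congr rfl fun i _ => by simp [ofRealVec]; ring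

theorem integrable_gaussianWave (β : EuclideanSpace ℂ (Fin d)) {w : ℂ} (hw : 0 < w.re) :
    Integrable (gaussianWave β w) := by
  rw [← (PiLp.volume_preserving_toLp (Fin d)).integrable_comp_emb
    (MeasurableEquiv.toLp 2 _).measurableEmbedding]
  refine (GaussianFourier.integrable_cexp_neg_mul_sum_add hw fun i => -Complex.I * β i).congr
    (Eventually.of_forall fun v => ?_)
  exact (gaussianWave_toLp β w v).symm

theorem integral_gaussianWave (β : EuclideanSpace ℂ (Fin d)) {w : ℂ} (hw : 0 < w.re) :
    ∫ Q, gaussianWave β w Q = ((Real.pi ^ ((d : ℝ) / 2) : ℝ) : ℂ) *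
      Complex.exp (-(d / 2) * Complex.log w - dot β β / 4 / w) := by
  have hne : w ≠ 0 := fun h => by rw [h] at hw; simp at hw
  rw [← (PiLp.volume_preserving_toLp (Fin d)).integral_comp
    (MeasurableEquiv.toLp 2 _).measurableEmbedding]
  simp_rw [gaussianWave_toLp]
  rw [GaussianFourier.integral_cexp_neg_mul_sum_add hw, div_eq_mul_inv (Real.pi : ℂ)]
  have e1 : ((Fintype.card (Fin d) : ℂ) / 2) = (((d : ℝ) / 2 : ℝ) : ℂ) := by simp
  have e2 : (∑ i, (-Complex.I * β i) ^ 2) = -dot β β := by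
    rw [dot, ← Finset.sum_neg_distrib]
    refine Finset.sum_congr rfl fun i _ => ?_
    linear_combination (β i) ^ 2 * Complex.I_sq
  rw [e1, e2, ofReal_mul_inv_cpow Real.pi_pos hw, mul_assoc, ← Complex.exp_add]
  congr 2
  push_cast
  field_simp
  ring

/-- Since `Re (κ - σ)` is constant along the contour, this makes the modulus of the Gaussian factor
independent of `y`. -/
theorem norm_gaussianWave (β : EuclideanSpace ℂ (Fin d)) (w : ℂ) (Q : EuclideanSpace ℝ (Fin d)) :
    ‖gaussianWave β w Q‖ = ‖gaussianWave β (w.re : ℂ) Q‖ := by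
  rw [gaussianWave, gaussianWave, Complex.norm_exp, Complex.norm_exp]
  congr 1
  simp only [Complex.add_re, Complex.neg_re, neg_mul, Complex.re_mul_ofReal, Complex.ofReal_re]

/-- The part of the Airy integrand that depends only on the contour variable. -/
noncomputable def cubicFactor (κ : ℝ) (ζ σ : ℂ) : ℂ :=
  Complex.exp ((κ - σ) ^ 3 / 12 - (κ - σ) * (κ ^ 2 + 2 * ζ) / 4)

/-- With `α = 2^(-2/3)`, `2^(2/3) α = 1` makes the Gaussian parameter `κ - σ`, and the growth `exp(α
κ s)` combines with `exp(-α (κ - σ) s)` into `exp(α σ s)`, which decays because `Re σ < 0` on the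
contour. -/
theorem planeWave_mul_airyIntegrand (κ : ℝ) (Ω : EuclideanSpace ℝ (Fin d))
    (U V : EuclideanSpace ℂ (Fin d)) (Q : EuclideanSpace ℝ (Fin d)) (s : ℝ) (σ : ℂ) :
    planeWave U V Q * (Complex.exp (((2 : ℝ) ^ (-(2 / 3) : ℝ) * κ * s : ℝ) : ℂ) *
      airyIntegrand ((((2 : ℝ) ^ (2 / 3 : ℝ) * ‖Q‖ ^ 2 : ℝ) : ℂ) +
      (((2 : ℝ) ^ (-(4 / 3) : ℝ) : ℝ) : ℂ) *
        ((κ : ℂ) ^ 2 + 2 * dot (ofRealVec Ω) (U + conjVec V)) + (s : ℂ))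
        (((2 : ℝ) ^ (-(2 / 3) : ℝ) : ℝ) * (κ - σ))) =
      gaussianWave (U - conjVec V) (κ - σ) Q *
        Complex.exp ((((2 : ℝ) ^ (-(2 / 3) : ℝ) : ℝ) : ℂ) * σ * s) *
        cubicFactor κ (dot (ofRealVec Ω) (U + conjVec V)) σ := by
  have h3 : ((((2 : ℝ) ^ (-(2 / 3) : ℝ) : ℝ)) : ℂ) ^ 3 = 1 / 4 := by
    rw [← Complex.ofReal_pow, two_rpow_cube]; push_cast; ring
  have h1 : ((((2 : ℝ) ^ (2 / 3 : ℝ) : ℝ)) : ℂ) * ((((2 : ℝ) ^ (-(2 / 3) : ℝ) : ℝ)) : ℂ) = 1 := by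
    rw [← Complex.ofReal_mul, two_rpow_mul]; push_cast; ring
  rw [two_rpow_sq]
  simp only [planeWave, airyIntegrand, gaussianWave, cubicFactor, Complex.ofReal_mul,
    Complex.ofReal_pow]
  generalize ((((2 : ℝ) ^ (-(2 / 3) : ℝ) : ℝ)) : ℂ) = α at *
  generalize ((((2 : ℝ) ^ (2 / 3 : ℝ) : ℝ)) : ℂ) = α' at *
  generalize dot (ofRealVec Ω) (U + conjVec V) = ζ
  simp only [← Complex.exp_add]
  congr 1
  linear_combination (-(‖Q‖ : ℂ) ^ 2 * (κ - σ)) * h1 +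
    ((κ - σ) ^ 3 / 3 - (κ ^ 2 + 2 * ζ) * (κ - σ)) * h3

/-- The integrand of the triple integral behind the deformed Airy kernel, as a function of
`((Q, s), y)`. -/
noncomputable def tripleIntegrand (κ α : ℝ) (ζ : ℂ) (β : EuclideanSpace ℂ (Fin d))
    (p : (EuclideanSpace ℝ (Fin d) × ℝ) × ℝ) : ℂ :=
  gaussianWave β (κ - (-1 + p.2 * Complex.I)) p.1.1 *
    Complex.exp (α * (-1 + p.2 * Complex.I) * p.1.2) * cubicFactor κ ζ (-1 + p.2 * Complex.I)

theorem integrable_cubicFactor {κ α : ℝ} (hκ : 0 < κ) (hα : 0 < α) (hα3 : α ^ 3 = 1 / 4)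
    (ζ : ℂ) : Integrable fun y : ℝ => cubicFactor κ ζ (-1 + y * Complex.I) := by
  have h := (integrable_airyIntegrand (α ^ 2 * (κ ^ 2 + 2 * ζ)) (c := α * (κ + 1))
    (by positivity)).comp_mul_left' (R := -α) (by linarith)
  refine h.congr (Eventually.of_forall fun y => ?_)
  have hα3c : (α : ℂ) ^ 3 = 1 / 4 := by rw [← Complex.ofReal_pow, hα3]; push_cast; ring
  simp only [airyIntegrand, cubicFactor]
  congr 1
  push_cast
  linear_combination ((κ - (-1 + y * Complex.I)) ^ 3 / 3 -
    (κ ^ 2 + 2 * ζ) * (κ - (-1 + y * Complex.I))) * hα3c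

theorem continuous_tripleIntegrand (κ α : ℝ) (ζ : ℂ) (β : EuclideanSpace ℂ (Fin d)) :
    Continuous (tripleIntegrand κ α ζ β) := by
  unfold tripleIntegrand gaussianWave cubicFactor dot ofRealVec
  fun_prop

/-- Because `Re σ = -1` on the whole contour, the modulus is a product of functions of `Q`, `s` and
`y` separately, each integrable. -/
theorem integrable_tripleIntegrand {κ α : ℝ} (hκ : 0 < κ) (hα : 0 < α) (hα3 : α ^ 3 = 1 / 4)
    (ζ : ℂ) (β : EuclideanSpace ℂ (Fin d)) :
    Integrable (tripleIntegrand κ α ζ β)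
      ((volume.prod (volume.restrict (Set.Ioi (0 : ℝ)))).prod volume) := by
  have h1 := integrable_gaussianWave β (w := ((κ + 1 : ℝ) : ℂ))
    (by rw [Complex.ofReal_re]; linarith)
  have h2 := integrableOn_exp_mul_complex_Ioi (a := -(α : ℂ)) (by simpa using hα) 0
  have h := (h1.norm.mul_prod h2.norm).mul_prod (integrable_cubicFactor hκ hα hα3 ζ).norm
  refine h.mono' (continuous_tripleIntegrand κ α ζ β).aestronglyMeasurable
    (Eventually.of_forall fun p => le_of_eq ?_)
  rw [tripleIntegrand, norm_mul, norm_mul, norm_gaussianWave]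
  congr 2
  · congr 2; simp
  · rw [Complex.norm_exp, Complex.norm_exp]; congr 1; simp

theorem integral_tripleIntegrand {κ : ℝ} (hκ : 0 < κ) (Ω : EuclideanSpace ℝ (Fin d))
    (U V : EuclideanSpace ℂ (Fin d)) (p : EuclideanSpace ℝ (Fin d) × ℝ) :
    planeWave U V p.1 * airyFactor κ Ω U V p.1 p.2 =
      ((((2 : ℝ) ^ (-(2 / 3) : ℝ) : ℝ) : ℂ) / (2 * Real.pi)) *
        ∫ y : ℝ, tripleIntegrand κ ((2 : ℝ) ^ (-(2 / 3) : ℝ))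
          (dot (ofRealVec Ω) (U + conjVec V)) (U - conjVec V) (p, y) := by
  have hα : (0 : ℝ) < (2 : ℝ) ^ (-(2 / 3) : ℝ) := by positivity
  simp only [tripleIntegrand, ← planeWave_mul_airyIntegrand]
  rw [integral_const_mul, integral_const_mul, airyFactor, airyAi_eq_integral_rescaled _ hκ hα]
  ring

theorem integrable_planeWave_mul_airyFactor {κ : ℝ} (hκ : 0 < κ) (Ω : EuclideanSpace ℝ (Fin d))
    (U V : EuclideanSpace ℂ (Fin d)) :
    Integrable (fun p : EuclideanSpace ℝ (Fin d) × ℝ =>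
        planeWave U V p.1 * airyFactor κ Ω U V p.1 p.2)
      (volume.prod (volume.restrict (Set.Ioi (0 : ℝ)))) := by
  simp_rw [integral_tripleIntegrand hκ]
  exact (integrable_tripleIntegrand hκ (by positivity) two_rpow_cube _ _).integral_prod_left
    |>.const_mul _

/-- Fubini, with `Q` and `s` integrated first: they give `(κ - σ)^(-d/2) exp(-b / (κ - σ))` and `-1
/ (α σ)` up to constants, with `b = β β / 4`. The prefactor `exp(κ³/6 + κ ζ/2)` cancels the constant
terms of the cubic, which becomes that of `limitPhase`. -/
theorem integral_planeWave_mul_airyFactor {κ : ℝ} (hκ : 0 < κ) (Ω : EuclideanSpace ℝ (Fin d))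
    (U V : EuclideanSpace ℂ (Fin d)) :
    Complex.exp ((κ : ℂ) ^ 3 / 6 + (κ : ℂ) / 2 * dot (ofRealVec Ω) (U + conjVec V)) *
      ∫ Q : EuclideanSpace ℝ (Fin d),
        planeWave U V Q * ∫ s in Set.Ioi (0 : ℝ), airyFactor κ Ω U V Q s =
      ((Real.pi ^ ((d : ℝ) / 2) * 2 ^ ((d : ℝ) / 2) : ℝ) : ℂ) * ((2 * (Real.pi : ℂ))⁻¹ *
        ∫ y : ℝ, Complex.exp (limitPhase d κ (dot (ofRealVec Ω) (U + conjVec V))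
          (dot (U - conjVec V) (U - conjVec V) / 4) (-1 + y * Complex.I))) := by
  have hα : (0 : ℝ) < (2 : ℝ) ^ (-(2 / 3) : ℝ) := by positivity
  have hT := integrable_tripleIntegrand hκ hα two_rpow_cube
    (dot (ofRealVec Ω) (U + conjVec V)) (U - conjVec V)
  have h1 : ∫ Q : EuclideanSpace ℝ (Fin d),
      planeWave U V Q * ∫ s in Set.Ioi (0 : ℝ), airyFactor κ Ω U V Q s =
      ∫ p, planeWave U V p.1 * airyFactor κ Ω U V p.1 p.2
        ∂(volume.prod (volume.restrict (Set.Ioi (0 : ℝ)))) := by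
    rw [integral_prod _ (integrable_planeWave_mul_airyFactor hκ Ω U V)]
    simp_rw [integral_const_mul]
  rw [h1]
  simp_rw [integral_tripleIntegrand hκ]
  rw [integral_const_mul,
    integral_integral_swap (f := fun p y => tripleIntegrand κ _ _ _ (p, y)) hT]
  generalize dot (ofRealVec Ω) (U + conjVec V) = ζ at *
  generalize U - conjVec V = β at *
  generalize (2 : ℝ) ^ (-(2 / 3) : ℝ) = α at *
  have hαc : (α : ℂ) ≠ 0 := by exact_mod_cast hα.ne'
  have h2 : ∀ y : ℝ, ∫ p, tripleIntegrand κ α ζ β (p, y)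
        ∂(volume.prod (volume.restrict (Set.Ioi (0 : ℝ)))) =
      ((Real.pi ^ ((d : ℝ) / 2) * 2 ^ ((d : ℝ) / 2) : ℝ) : ℂ) * (α : ℂ)⁻¹ *
        Complex.exp (-((κ : ℂ) ^ 3 / 6 + (κ : ℂ) / 2 * ζ)) *
        Complex.exp (limitPhase d κ ζ (dot β β / 4) (-1 + y * Complex.I)) := by
    intro y
    have hσ : (-1 + y * Complex.I : ℂ).re = -1 := by simp
    simp only [tripleIntegrand]
    generalize (-1 + y * Complex.I : ℂ) = σ at *
    have hw : 0 < (κ - σ : ℂ).re := by rw [Complex.sub_re, hσ, Complex.ofReal_re]; linarith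
    have hw0 : (κ - σ : ℂ) ≠ 0 := fun h => by rw [h] at hw; simp at hw
    have hσ0 : -σ ≠ 0 := fun h => by
      have : σ = 0 := by linear_combination -h
      rw [this] at hσ; simp at hσ
    rw [integral_mul_const,
      integral_prod_mul (gaussianWave β (κ - σ)) fun s : ℝ => Complex.exp (α * σ * s),
      integral_gaussianWave β hw,
      integral_exp_mul_complex_Ioi (by rw [Complex.re_ofReal_mul, hσ]; linarith)]
    have e1 : ((2 ^ ((d : ℝ) / 2) : ℝ) : ℂ) = Complex.exp (d / 2 * Complex.log 2) := by
      rw [Complex.ofReal_cpow (by norm_num), Complex.ofReal_ofNat,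
        Complex.cpow_def_of_ne_zero two_ne_zero]
      push_cast
      ring_nf
    have e2 : -Complex.exp (α * σ * ((0 : ℝ) : ℂ)) / (α * σ) =
        (α : ℂ)⁻¹ * Complex.exp (-Complex.log (-σ)) := by
      rw [Complex.exp_neg, Complex.exp_log hσ0]
      have : σ ≠ 0 := fun h => hσ0 (by rw [h, neg_zero])
      simp
      field_simp
    have e3 : Complex.log (2 * (κ - σ)) = Complex.log 2 + Complex.log (κ - σ) := by
      have := Complex.log_ofReal_mul (by norm_num : (0 : ℝ) < 2) hw0
      rw [Complex.ofReal_log (by norm_num)] at this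
      simpa using this
    rw [e2, limitPhase, e3, Complex.ofReal_mul, e1, cubicFactor]
    have e4 : Complex.exp (-(d / 2) * Complex.log (κ - σ) - dot β β / 4 / (κ - σ)) *
        Complex.exp (-Complex.log (-σ)) *
        Complex.exp ((κ - σ) ^ 3 / 12 - (κ - σ) * (κ ^ 2 + 2 * ζ) / 4) =
        Complex.exp (d / 2 * Complex.log 2) *
        Complex.exp (-((κ : ℂ) ^ 3 / 6 + (κ : ℂ) / 2 * ζ)) *
        Complex.exp (κ * σ ^ 2 / 4 - σ ^ 3 / 12 + ζ * σ / 2 - dot β β / 4 / (κ - σ) -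
          d / 2 * (Complex.log 2 + Complex.log (κ - σ)) - Complex.log (-σ)) := by
      simp only [← Complex.exp_add]
      congr 1
      ring
    linear_combination (((Real.pi ^ ((d : ℝ) / 2) : ℝ) : ℂ) * (α : ℂ)⁻¹) * e4
  simp_rw [h2]
  rw [integral_const_mul, Complex.exp_neg]
  have := Complex.exp_ne_zero ((κ : ℂ) ^ 3 / 6 + (κ : ℂ) / 2 * ζ)
  generalize (∫ y : ℝ, Complex.exp (limitPhase d κ ζ (dot β β / 4) (-1 + y * Complex.I))) = J
  field_simp

theorem deformedAiryKernel_eq {κ : ℝ} (hκ : 0 < κ) (Ω : EuclideanSpace ℝ (Fin d))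
    (U V : EuclideanSpace ℂ (Fin d)) :
    deformedAiryKernel κ Ω U V =
      (((Real.exp (-((‖imVec U‖ ^ 2 + ‖imVec V‖ ^ 2) / (2 * κ))) : ℝ) : ℂ) *
          ((edgeConst d κ 0 : ℝ) : ℂ)) * ((2 * (Real.pi : ℂ))⁻¹ *
        ∫ y : ℝ, Complex.exp (limitPhase d κ (dot (ofRealVec Ω) (U + conjVec V))
          (dot (U - conjVec V) (U - conjVec V) / 4) (-1 + y * Complex.I))) := by
  have h := integral_planeWave_mul_airyFactor hκ Ω U V
  have hpi := Real.pi_pos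
  have hc : 1 / ((κ * Real.pi) ^ ((d : ℝ) / 2) * (2 * Real.pi) ^ d) *
      (Real.pi ^ ((d : ℝ) / 2) * 2 ^ ((d : ℝ) / 2)) = edgeConst d κ 0 := by
    have h2 : (2 : ℝ) ^ d = 2 ^ ((d : ℝ) / 2) * 2 ^ ((d : ℝ) / 2) := by
      rw [← Real.rpow_add (by norm_num), ← Real.rpow_natCast]; congr 1; ring
    have h3 : (0 : ℝ) < κ ^ ((d : ℝ) / 2) := by positivity
    have h4 : (0 : ℝ) < Real.pi ^ ((d : ℝ) / 2) := by positivity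
    have h5 : (0 : ℝ) < (2 : ℝ) ^ ((d : ℝ) / 2) := by positivity
    rw [edgeConst, mul_zero, sub_zero, Real.mul_rpow hκ.le hpi.le, mul_pow, h2,
      Real.mul_rpow hκ.le (by norm_num)]
    field_simp
  have hcc : ((edgeConst d κ 0 : ℝ) : ℂ) =
      ((1 / ((κ * Real.pi) ^ ((d : ℝ) / 2) * (2 * Real.pi) ^ d) : ℝ) : ℂ) *
        ((Real.pi ^ ((d : ℝ) / 2) * 2 ^ ((d : ℝ) / 2) : ℝ) : ℂ) := by
    rw [← hc, Complex.ofReal_mul]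
  rw [deformedAiryKernel, mul_assoc, h, hcc, mul_comm (Complex.ofReal (1 / _)), mul_assoc,
    mul_assoc, mul_assoc]

/-! ### Cocycle, smooth constant and conclusion. -/

theorem isCocycle_edgeCocycle (n : ℕ) (Ω : EuclideanSpace ℝ (Fin d)) :
    IsCocycle (edgeCocycle n Ω) := by
  refine ⟨fun U => Complex.exp (Complex.I *
      (((n : ℝ) ^ (1 / 3 : ℝ) * inner ℝ Ω (imVec U) : ℝ) : ℂ)),
    fun U => Complex.exp_ne_zero _, fun U V => ?_⟩
  have h : imVec (U - V) = imVec U - imVec V := by ext k; simp [imVec]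
  rw [edgeCocycle, h, inner_sub_right, ← Complex.exp_sub]
  congr 1
  push_cast
  ring

theorem norm_edgeCocycle (n : ℕ) (Ω : EuclideanSpace ℝ (Fin d)) (U V : EuclideanSpace ℂ (Fin d)) :
    ‖edgeCocycle n Ω U V‖ = 1 := by
  rw [edgeCocycle, mul_comm, Complex.norm_exp_ofReal_mul_I]

theorem edgeConst_sub_isBigO (d : ℕ) {κ : ℝ} (hκ : 0 < κ) :
    (fun ε => edgeConst d κ ε - edgeConst d κ 0) =O[nhds 0] fun ε => ε := by
  have h : DifferentiableAt ℝ (edgeConst d κ) 0 := by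
    unfold edgeConst
    have h0 : κ * (2 - κ * 0) ≠ 0 := by simp [hκ.ne']
    have h1 : (κ * (2 - κ * 0)) ^ ((d : ℝ) / 2) ≠ 0 := by
      rw [mul_zero, sub_zero]; positivity
    have h2 : DifferentiableAt ℝ (fun ε : ℝ => κ * (2 - κ * ε)) 0 := by fun_prop
    refine (differentiableAt_const _).div ((differentiableAt_const _).mul
      (h2.rpow_const (Or.inl h0))) (mul_ne_zero (by positivity) h1)
  simpa using h.isBigO_sub

theorem edgeConst_mul_integral_sub_isBigO (d : ℕ) {κ : ℝ} (hκ : 0 < κ) (q : ℝ) (ζ γ b : ℂ) :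
    (fun ε : ℝ => (edgeConst d κ ε : ℂ) * (∫ y in -(Real.pi / ε)..Real.pi / ε,
          Complex.exp (edgePhase d κ q ζ γ b ε (-1 + y * Complex.I))) -
        (edgeConst d κ 0 : ℂ) *
          ∫ y : ℝ, Complex.exp (limitPhase d κ ζ b (-1 + y * Complex.I)))
      =O[nhdsWithin 0 (Set.Ioi 0)] fun ε => ε := by
  obtain ⟨C, hC⟩ := integral_edgePhase_sub_le d hκ q ζ γ b
  generalize (∫ y : ℝ, Complex.exp (limitPhase d κ ζ b (-1 + y * Complex.I))) = J at *
  have hid : Tendsto (fun ε : ℝ => ε) (nhdsWithin 0 (Set.Ioi 0)) (nhds 0) :=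
    tendsto_nhdsWithin_of_tendsto_nhds tendsto_id
  have hκε : Tendsto (fun ε => κ * ε) (nhdsWithin 0 (Set.Ioi 0)) (nhds 0) := by
    simpa using hid.const_mul κ
  have hF : (fun ε : ℝ => (∫ y in -(Real.pi / ε)..Real.pi / ε,
      Complex.exp (edgePhase d κ q ζ γ b ε (-1 + y * Complex.I))) - J)
      =O[nhdsWithin 0 (Set.Ioi 0)] fun ε => ε := by
    refine IsBigO.of_bound C ?_
    filter_upwards [self_mem_nhdsWithin, hid.eventually_le_const (by norm_num : (0 : ℝ) < 1 / 2),
      hκε.eventually_lt_const one_pos] with ε h0 h1 h2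
    rw [Real.norm_of_nonneg (le_of_lt h0)]
    exact hC ε h0 h1 h2
  have hc := (edgeConst_sub_isBigO d hκ).mono (nhdsWithin_le_nhds (s := Set.Ioi 0))
  have hc1 : (fun ε => (edgeConst d κ ε : ℂ) - (edgeConst d κ 0 : ℂ))
      =O[nhdsWithin 0 (Set.Ioi 0)] fun ε => ε := by
    refine IsBigO.of_norm_left ?_
    simpa only [← Complex.ofReal_sub, Complex.norm_real] using hc.norm_left
  have hc2 : (fun ε => (edgeConst d κ ε : ℂ)) =O[nhdsWithin 0 (Set.Ioi 0)] fun _ => (1 : ℝ) := by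
    have h := (hc1.trans (hid.isBigO_one ℝ)).add
      (isBigO_const_const (edgeConst d κ 0 : ℂ) (one_ne_zero (α := ℝ)) _)
    simpa using h
  have h := (hc2.mul hF).add ((isBigO_const_const J (one_ne_zero (α := ℝ)) _).mul hc1)
  exact h.congr (fun ε => by ring) fun ε => one_mul ε

theorem tendsto_natCast_rpow_neg_third :
    Tendsto (fun n : ℕ => (n : ℝ) ^ (-(1 / 3) : ℝ)) atTop (nhdsWithin 0 (Set.Ioi 0)) := by
  refine tendsto_nhdsWithin_iff.2
    ⟨(tendsto_rpow_neg_atTop (by norm_num)).comp tendsto_natCast_atTop_atTop, ?_⟩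
  filter_upwards [eventually_gt_atTop 0] with n hn
  exact Real.rpow_pos_of_pos (Nat.cast_pos.2 hn) _

end EllipticGinibre

theorem mainTheorem9 {d : ℕ} (κ : ℝ) (hκ : 0 < κ)
    (Ω : EuclideanSpace ℝ (Fin d)) (hΩ : ‖Ω‖ = 1)
    (U V : EuclideanSpace ℂ (Fin d)) :
    (∀ n : ℕ, EllipticGinibre.IsCocycle (EllipticGinibre.edgeCocycle n Ω)) ∧
    Integrable
      (fun p : EuclideanSpace ℝ (Fin d) × ℝ =>
        EllipticGinibre.planeWave U V p.1 * EllipticGinibre.airyFactor κ Ω U V p.1 p.2)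
      (volume.prod (volume.restrict (Set.Ioi (0 : ℝ)))) ∧
    (fun n : ℕ =>
        (((1 / (n : ℝ) ^ (4 * (d : ℝ) / 3) : ℝ)) : ℂ) *
          EllipticGinibre.scaledKernel d n (EllipticGinibre.edgeTau κ n)
            (EllipticGinibre.edgePoint n ((1 + EllipticGinibre.edgeTau κ n) • Ω) U)
            (EllipticGinibre.edgePoint n ((1 + EllipticGinibre.edgeTau κ n) • Ω) V)
        - EllipticGinibre.edgeCocycle n Ω U V *
            EllipticGinibre.deformedAiryKernel κ Ω U V)
      =O[atTop] (fun n : ℕ => (n : ℝ) ^ (-(1 / 3) : ℝ)) := by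
  refine ⟨fun n => EllipticGinibre.isCocycle_edgeCocycle n Ω,
    EllipticGinibre.integrable_planeWave_mul_airyFactor hκ Ω U V, ?_⟩
  have hε := EllipticGinibre.tendsto_natCast_rpow_neg_third
  have hκε : ∀ᶠ n : ℕ in atTop, κ * (n : ℝ) ^ (-(1 / 3) : ℝ) < 1 := by
    have h := (hε.mono_right nhdsWithin_le_nhds).const_mul κ
    rw [mul_zero] at h
    exact h.eventually_lt_const one_pos
  have hlim := ((EllipticGinibre.edgeConst_mul_integral_sub_isBigO d hκ
    (EllipticGinibre.reSq U + EllipticGinibre.reSq V)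
    (EllipticGinibre.dot (EllipticGinibre.ofRealVec Ω) (U + EllipticGinibre.conjVec V))
    (EllipticGinibre.dot (U + EllipticGinibre.conjVec V) (U + EllipticGinibre.conjVec V) / 4)
    (EllipticGinibre.dot (U - EllipticGinibre.conjVec V) (U - EllipticGinibre.conjVec V) / 4)
    ).comp_tendsto hε).const_mul_left
      (((Real.exp (-((‖EllipticGinibre.imVec U‖ ^ 2 + ‖EllipticGinibre.imVec V‖ ^ 2) /
        (2 * κ))) : ℝ) : ℂ) * (2 * (Real.pi : ℂ))⁻¹)
  refine IsBigO.trans (IsBigO.of_norm_eventuallyLE ?_) hlim.norm_left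
  filter_upwards [eventually_ne_atTop 0, hκε] with n hn hn1
  -- Both kernels now have the same shape, and the common cocycle has modulus one, so it drops out
  -- of the error.
  rw [EllipticGinibre.scaledKernel_eq_integral hκ Ω hΩ U V hn rfl hn1,
    EllipticGinibre.deformedAiryKernel_eq hκ, ← mul_sub, norm_mul,
    EllipticGinibre.norm_edgeCocycle, one_mul]
  refine le_of_eq (congrArg norm ?_)
  simp only [Function.comp_apply]
  ring
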